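/- Let $M$ be a smooth manifold with boundary $\partial M$, $\dim M=n+1\ge 1$, with a smooth Finsler metric $\varphi$ (smooth and positive off the zero section of $TM$, positively $1$-homogeneous, with $\varphi^2$ having positive definite Hessian along the fibres away from $0$; $\varphi$ need not be symmetric). Let $g:\partial M\to\mathbb R$ be smooth and let $\Gamma$ be a smooth characteristic vector field along $\partial M$ of the Hamilton–Jacobi problem with boundary data $g$: for every $z\in\partial M$, $\Gamma(z)\in T_zM$ points strictly inwards, $\varphi(\Gamma(z))=1$, and the Finsler dual one-form $w\mapsto\varphi(v)\,d(\varphi|_{T_zM})_v(w)$ of $v=\Gamma(z)$ restricts to $dg_z$ on $T_z\partial M$. (For $g=0$, $\Gamma$ is the inner unit normal.) For $z\in\partial M$ let $\gamma_z:[0,T(z))\to M$ be the maximal geodesic with $\gamma_z(0)=z$, $\dot\gamma_z(0)=\Gamma(z)$ and $\gamma_z(t)$ in the interior of $M$ for $t>0$; put $V=\{(t,z):0\le t<T(z)\}$ and $F(t,z)=\gamma_z(t)$. A point $x=(t,z)\in V$ with $t>0$ is conjugate of order $k\geq 1$ if $\dim\ker d_xF=k$. For $j\ge1$ let $\lambda_j(z)\in(0,\infty]$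 be the parameter $t$ of the $j$-th conjugate point along $\gamma_z$, each conjugate point being counted as many times as its order, and $\lambda_j(z)=\infty$ if there is no such point. Then, for every $j\ge 1$: 1. the set $\{\lambda_j<\infty\}$ is open in $\partial M$ and $\lambda_j$ is locally Lipschitz on it: every point has a neighborhood in which $\lambda_j$ is Lipschitz with respect to the Euclidean distance of a coordinate chart of $\partial M$; 2. if $\lambda_j(z_0)=\infty$ and $(t,z_0)\in V$, then $\lambda_j>t$ in a neighborhood of $z_0$. Moreover, if $(t_0,z_0)$ is a conjugate point, then in a coordinate chart of $\partial M$ around $z_0$ there is a constant $C$ such that all conjugate points $(t,z)$ in some neighborhood of $(t_0,z_0)$ satisfy $|t-t_0|\le C|z-z_0|$; that is, they lie in a cone around a hyperplane transverse to the radial direction $\partial/\partial t$. -/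

import Mathlib

open Set Filter Topology
open scoped Manifold ContDiff ENNReal

noncomputable section

namespace Finsler

/-- A Finsler metric `φ` on a smooth `(n+1)`-dimensional manifold with boundary `M`: a function on
the tangent bundle, smooth and positive off the zero section (up to the boundary of `M`), positively
homogeneous of degree one on each fibre, and such that the Hessian of `φ²` along each fibre is
positive definite at every nonzero vector. No symmetry `φ(-v) = φ(v)` is required. -/
structure Metric (n : ℕ) (M : Type*) [TopologicalSpace M]
    [ChartedSpace (EuclideanHalfSpace (n + 1)) M] [IsManifold (𝓡∂ (n + 1)) ∞ M] where
  toFun : TangentBundle (𝓡∂ (n + 1)) M → ℝ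
  smooth : ContMDiffOn (𝓡∂ (n + 1)).tangent 𝓘(ℝ, ℝ) ∞ toFun {v | v.2 ≠ 0}
  pos : ∀ (p : M) (v : TangentSpace (𝓡∂ (n + 1)) p), v ≠ 0 → 0 < toFun ⟨p, v⟩
  homog : ∀ (p : M) (v : TangentSpace (𝓡∂ (n + 1)) p) (c : ℝ), 0 ≤ c →
    toFun ⟨p, c • v⟩ = c * toFun ⟨p, v⟩
  convex : ∀ (p : M) (v w : TangentSpace (𝓡∂ (n + 1)) p), v ≠ 0 → w ≠ 0 →
    0 < iteratedDeriv 2 (fun s : ℝ => toFun ⟨p, v + s • w⟩ ^ 2) 0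

section

variable {n : ℕ} {M : Type*} [TopologicalSpace M]
  [ChartedSpace (EuclideanHalfSpace (n + 1)) M]

/-- The lift of a curve `γ` to the tangent bundle. -/
def velocity (γ : ℝ → M) (s : ℝ) : TangentBundle (𝓡∂ (n + 1)) M :=
  ⟨γ s, mfderiv 𝓘(ℝ, ℝ) (𝓡∂ (n + 1)) γ s (1 : ℝ)⟩

variable [IsManifold (𝓡∂ (n + 1)) ∞ M] (φ : Metric n M)

/-- The Finsler dual one-form of the tangent vector `v`, in coordinates
`w_j = φ(v) ∂φ/∂v^j`, evaluated at `w`. -/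
def Metric.dual {p : M} (v w : TangentSpace (𝓡∂ (n + 1)) p) : ℝ :=
  φ.toFun ⟨p, v⟩ * deriv (fun s : ℝ => φ.toFun ⟨p, v + s • w⟩) 0

/-- The energy `φ²/2` in the coordinates `(x, v)` of `TM` induced by the chart of `M` at `p₀`. -/
def Metric.chartEnergy (p₀ : M) (x v : EuclideanSpace ℝ (Fin (n + 1))) : ℝ :=
  φ.toFun ((extChartAt (𝓡∂ (n + 1)).tangent
    (⟨p₀, 0⟩ : TangentBundle (𝓡∂ (n + 1)) M)).symm (x, v)) ^ 2 / 2

/-- The Euler-Lagrange equation `d/dt (∂L/∂v) = ∂L/∂x` of the energy `L = φ²/2` holds for `γ` at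
time `s`, in every chart whose domain contains `γ s`. -/
def Metric.EulerLagrangeAt (γ : ℝ → M) (s : ℝ) : Prop :=
  ∀ p₀ : M, γ s ∈ (chartAt (EuclideanHalfSpace (n + 1)) p₀).source →
    HasDerivAt
      (fun τ => fderiv ℝ (fun v => φ.chartEnergy p₀ (extChartAt (𝓡∂ (n + 1)) p₀ (γ τ)) v)
        (deriv (fun σ => extChartAt (𝓡∂ (n + 1)) p₀ (γ σ)) τ))
      (fderivWithin ℝ (fun x => φ.chartEnergy p₀ x
          (deriv (fun σ => extChartAt (𝓡∂ (n + 1)) p₀ (γ σ)) s))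
        (range (𝓡∂ (n + 1))) (extChartAt (𝓡∂ (n + 1)) p₀ (γ s)))
      s

/-- `γ` is, for times in `(0, T)`, a geodesic in the interior of `M`, and it emanates from the base
point of `u` with initial velocity `u`. -/
structure Metric.IsGeodesicFrom (u : TangentBundle (𝓡∂ (n + 1)) M) (T : ℝ) (γ : ℝ → M) :
    Prop where
  interior : ∀ s ∈ Ioo 0 T, γ s ∈ (𝓡∂ (n + 1)).interior M
  smooth : ContMDiffOn 𝓘(ℝ, ℝ) (𝓡∂ (n + 1)) 2 γ (Ioo 0 T)
  velocity_ne : ∀ s ∈ Ioo 0 T, (velocity (n := n) γ s).2 ≠ 0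
  geodesic : ∀ s ∈ Ioo 0 T, φ.EulerLagrangeAt γ s
  initial : Tendsto (velocity (n := n) γ) (𝓝[>] 0) (𝓝 u)

variable {N : Type*} [TopologicalSpace N] [ChartedSpace (EuclideanSpace ℝ (Fin n)) N]

/-- `ι : N → M` identifies the boundaryless manifold `N` with the boundary of `M`. -/
structure IsBoundary (ι : N → M) : Prop where
  smooth : ContMDiff (𝓡 n) (𝓡∂ (n + 1)) ∞ ι
  immersive : ∀ z, Function.Injective (mfderiv (𝓡 n) (𝓡∂ (n + 1)) ι z)
  embedding : IsEmbedding ι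
  range_eq : range ι = (𝓡∂ (n + 1)).boundary M

/-- `X` is the characteristic vector field along `∂M` (presented by `ι : N → M`) of the
Hamilton-Jacobi boundary value problem with boundary data `g`: it is smooth, of unit length, its
dual one-form restricts to `dg` on `∂M`, and it points strictly inwards, that is, its component
along the first coordinate of the half space `{x₀ ≥ 0}` is positive. -/
structure Metric.IsCharacteristicField (ι : N → M) (g : N → ℝ)
    (X : ∀ z : N, TangentSpace (𝓡∂ (n + 1)) (ι z)) : Prop where
  smooth : ContMDiff (𝓡 n) (𝓡∂ (n + 1)).tangent ∞
    (fun z => (⟨ι z, X z⟩ : TangentBundle (𝓡∂ (n + 1)) M))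
  unit : ∀ z, φ.toFun ⟨ι z, X z⟩ = 1
  dual_eq : ∀ (z : N) (w : TangentSpace (𝓡 n) z),
    φ.dual (X z) (mfderiv (𝓡 n) (𝓡∂ (n + 1)) ι z w) = mfderiv (𝓡 n) 𝓘(ℝ, ℝ) g z w
  inward : ∀ z, 0 < (show EuclideanSpace ℝ (Fin (n + 1)) from X z) 0

variable (ι : N → M) (X : ∀ z : N, TangentSpace (𝓡∂ (n + 1)) (ι z))

/-- The set `V` of all `(t, z)`, `t ≥ 0`, such that the characteristic from `z` is defined (and
stays in the interior of `M`) up to and slightly beyond time `t`. -/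
def Metric.domain : Set (ℝ × N) :=
  {x | 0 ≤ x.1 ∧ ∃ T, x.1 < T ∧ ∃ γ : ℝ → M, φ.IsGeodesicFrom ⟨ι x.2, X x.2⟩ T γ}

open Classical in
/-- The exponential map `F (t, z)`: the point at time `t` of the characteristic from `z`
(with the value `ι z` for `t = 0`, and as a dummy value outside `V`). -/
def Metric.expMap (x : ℝ × N) : M :=
  if h : 0 < x.1 ∧ ∃ γ : ℝ → M, ∃ T, x.1 < T ∧ φ.IsGeodesicFrom ⟨ι x.2, X x.2⟩ T γ then
    h.2.choose x.1
  else ι x.2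

/-- The order of conjugacy: the dimension of the kernel of `dF` at `x`. -/
def Metric.order (x : ℝ × N) : ℕ :=
  Module.finrank ℝ (LinearMap.ker (mfderiv (𝓘(ℝ, ℝ).prod (𝓡 n)) (𝓡∂ (n + 1))
    (φ.expMap ι X) x).toLinearMap)

/-- `x = (t, z)` is a conjugate point (there is none at `t = 0`). -/
def Metric.IsConjugate (x : ℝ × N) : Prop :=
  x ∈ φ.domain ι X ∧ 0 < x.1 ∧ 0 < φ.order ι X x

/-- The number of conjugate points `(s, z)` with `s` in a set `A` of positive times, counted with
multiplicity. -/
def Metric.conjugateCount (z : N) (A : Set ℝ) : ℕ∞ :=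
  Set.encard {q : ℝ × ℕ | q.1 ∈ A ∧ φ.IsConjugate ι X (q.1, z) ∧ q.2 < φ.order ι X (q.1, z)}

/-- `t` is the parameter of the `j`-th conjugate point, counted with multiplicity, along the
characteristic from `z`. -/
def Metric.IsJthConjugate (j : ℕ) (z : N) (t : ℝ) : Prop :=
  φ.IsConjugate ι X (t, z) ∧ φ.conjugateCount ι X z (Ioo 0 t) < j ∧
    j ≤ φ.conjugateCount ι X z (Ioc 0 t)

/-- The function `λ_j`: the parameter of the `j`-th conjugate point (there is at most one such
parameter), and `∞` if there is none. -/
def Metric.conjugateTime (j : ℕ) (z : N) : ℝ≥0∞ :=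
  sInf (ENNReal.ofReal '' {t | φ.IsJthConjugate ι X j z t})

end

end Finsler

end

/-! Write F for the exponential map and w for a variation of (t, z). In charts, the variation A w of
the position and the variation B w of the momentum (the derivative of φ²/2 in the velocity) along a
characteristic form a family of pairs indexed by w in an (n+1)-dimensional space. A point is
conjugate exactly when A is singular there, with order dim ker A. Three facts drive the proof. (a)
The space of pairs is isotropic. By the Gauss lemma the momentum pulls back under F to the exact
form d(t + g): at t = 0 this is the defining property of Γ, and the Euler-Lagrange equation together
with constant speed preserves it. (b) The pair (A, B) is injective, because Γ is transverse to the
boundary and the linearized flow is invertible. (c) If A w = 0, then ⟪B w, ∂ₜA w⟫ is the fibre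
Hessian of the energy evaluated on the variation of the velocity, hence positive for w ≠ 0. So the
Lagrangian space can only cross the vertical space in the positive direction. Near a given point one
writes A = U C with C invertible and U symmetric, ker U being isomorphic to ker A, and C can be
chosen so that ∂ₜU is positive definite (`exists_isIndexFor_of_lagrangian`). As U is C¹, the forms
increase along cones t' - t ≥ κ‖ζ' - ζ‖. Hence the number m of negative eigenvalues does not
increase along these cones, drops exactly by the order at each conjugate time, and is locally
constant in z at nonconjugate times. This confines conjugate points to cones, isolates them in time,
and expresses their number in a short time interval as a difference of values of m. There are no
conjugate points close to the boundary, locally uniformly in z (`exists_boundary_flowBox`). Chaining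
short intervals along a characteristic shows that the total count up to a nonconjugate time is
finite and locally constant in z (`IsIndexedFamily.stableAt`). Comparing the counts of z at time t
and of z' at time t + κ‖ζ - ζ'‖ then gives the Lipschitz bound
(`IsIndexedFamily.exists_lipschitz_isJthPoint`). All this needs the characteristics to be a C²
family down to the boundary. Regularity of flows comes from the implicit function theorem
(`exists_contDiffAt_flow`), the geodesic equation is extended across the boundary by a reflection,
and the needed properties are propagated in time by connectedness (`isVariationAt_of_small`). -/

noncomputable section

/-! ### Superposition operators on spaces of continuous curves. -/

namespace ContinuousMap

universe u

variable {K : Type*} [TopologicalSpace K] [CompactSpace K]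
  {X Y : Type*} [NormedAddCommGroup X] [NormedSpace ℝ X] [NormedAddCommGroup Y] [NormedSpace ℝ Y]

/-- Pointwise application of a continuous family of continuous linear maps. -/
def applyFamily (K : Type*) [TopologicalSpace K] [CompactSpace K]
    (X Y : Type*) [NormedAddCommGroup X] [NormedSpace ℝ X] [NormedAddCommGroup Y]
    [NormedSpace ℝ Y] : C(K, X →L[ℝ] Y) →L[ℝ] C(K, X) →L[ℝ] C(K, Y) :=
  LinearMap.mkContinuous₂
    (LinearMap.mk₂ ℝ (fun (T : C(K, X →L[ℝ] Y)) (y : C(K, X)) =>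
        (⟨fun s => T s (y s), by fun_prop⟩ : C(K, Y)))
      (fun _ _ _ => by ext; simp) (fun _ _ _ => by ext; simp)
      (fun _ _ _ => by ext; simp) (fun _ _ _ => by ext; simp)) 1
    (fun T y => by
      rw [one_mul]
      refine (ContinuousMap.norm_le _ (by positivity)).2 fun s => ?_
      exact ((T s).le_opNorm _).trans
        (mul_le_mul (T.norm_coe_le_norm s) (y.norm_coe_le_norm s) (norm_nonneg _) (by positivity)))

/-- The mean value inequality on the segment from `y s` to `y s + h' s` bounds the remainder at each
`s`. The bound is uniform in `s` because post-composition with `f'` is continuous for the uniform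
norm. -/
lemma hasFDerivAt_comp_left {f : X → Y} {f' : X → X →L[ℝ] Y} (hf' : Continuous f')
    (h : ∀ x, HasFDerivAt f (f' x) x) (hf : Continuous f) (y : C(K, X)) :
    HasFDerivAt (fun y : C(K, X) => (⟨f, hf⟩ : C(X, Y)).comp y)
      (applyFamily K X Y ((⟨f', hf'⟩ : C(X, X →L[ℝ] Y)).comp y)) y := by
  rw [hasFDerivAt_iff_isLittleO_nhds_zero, Asymptotics.isLittleO_iff]
  intro c hc
  have hcont : Continuous (fun y : C(K, X) => (⟨f', hf'⟩ : C(X, X →L[ℝ] Y)).comp y) :=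
    ContinuousMap.continuous_postcomp _
  obtain ⟨δ, hδ, hball⟩ := (Metric.tendsto_nhds_nhds (α := C(K, X)) (β := C(K, X →L[ℝ] Y))).1 (hcont.tendsto y) c hc
  filter_upwards [Metric.ball_mem_nhds (0 : C(K, X)) hδ] with h' hh'
  rw [mem_ball_zero_iff] at hh'
  refine (ContinuousMap.norm_le _ (by positivity)).2 fun s => ?_
  have key : ‖f (y s + h' s) - f (y s) - f' (y s) (y s + h' s - y s)‖ ≤
      c * ‖y s + h' s - y s‖ := by
    refine Convex.norm_image_sub_le_of_norm_hasFDerivWithin_le' (s := segment ℝ (y s) (y s + h' s))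
      (f' := f') (fun x _ => (h x).hasFDerivWithinAt) (fun x hx => ?_) (convex_segment _ _)
      (left_mem_segment _ _ _) (right_mem_segment _ _ _)
    rw [segment_eq_image'] at hx
    obtain ⟨θ, hθ, rfl⟩ := hx
    have hd : dist (y + θ • h') y < δ := by
      rw [dist_eq_norm, add_sub_cancel_left, norm_smul, Real.norm_of_nonneg hθ.1]
      nlinarith [hθ.2, norm_nonneg h']
    have := (ContinuousMap.dist_apply_le_dist s).trans_lt (hball hd)
    rw [dist_eq_norm] at this
    simpa using this.le
  rw [add_sub_cancel_left] at key
  exact key.trans (mul_le_mul_of_nonneg_left (h'.norm_coe_le_norm s) hc.le)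

/-- The superposition operator `y ↦ f ∘ y` of a `C^n` map is `C^n` for the uniform norm. -/
lemma contDiff_comp_left {K : Type u} [TopologicalSpace K] [CompactSpace K] {X : Type u}
    [NormedAddCommGroup X] [NormedSpace ℝ X] (n : ℕ) :
    ∀ {Y : Type u} [NormedAddCommGroup Y] [NormedSpace ℝ Y] {f : X → Y} (hf : ContDiff ℝ n f),
    ContDiff ℝ n (fun y : C(K, X) => (⟨f, hf.continuous⟩ : C(X, Y)).comp y) := by
  induction n with
  | zero =>
    intro Y _ _ f hf
    exact contDiff_zero.2 (ContinuousMap.continuous_postcomp _)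
  | succ n ih =>
    intro Y _ _ f hf
    obtain ⟨f', hf', h⟩ := contDiff_succ_iff_hasFDerivAt.1 (by exact_mod_cast hf)
    -- The derivative is the superposition operator of `f'` followed by a bounded linear map, so the
    -- induction hypothesis is applied to `f'`, whose values lie in `X →L[ℝ] Y`. This is why `Y` is
    -- quantified inside the induction.
    have := contDiff_succ_iff_hasFDerivAt.2
      ⟨_, (applyFamily K X Y).contDiff.comp (ih hf'), fun y =>
        hasFDerivAt_comp_left hf'.continuous h hf.continuous y⟩
    exact_mod_cast this

end ContinuousMap

/-! ### Regularity of local flows via the implicit function theorem. -/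

section Flow

variable {X : Type} [NormedAddCommGroup X] [NormedSpace ℝ X] [CompleteSpace X]

/-- The primitive vanishing at `0`, as an operator on continuous curves on `[0, 1]`. -/
def primitive (X : Type) [NormedAddCommGroup X] [NormedSpace ℝ X] [CompleteSpace X] :
    C(Icc (0 : ℝ) 1, X) →L[ℝ] C(Icc (0 : ℝ) 1, X) :=
  LinearMap.mkContinuous
    { toFun := fun y => ⟨fun s => ∫ r in (0 : ℝ)..s, y (projIcc 0 1 zero_le_one r), by
        have h : Continuous fun r => y (projIcc 0 1 zero_le_one r) :=
          y.continuous.comp continuous_projIcc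
        exact (intervalIntegral.continuous_primitive
          (fun a b => h.intervalIntegrable a b) 0).comp continuous_subtype_val⟩
      map_add' := fun y y' => by
        ext s
        have h : ∀ y : C(Icc (0 : ℝ) 1, X), Continuous fun r => y (projIcc 0 1 zero_le_one r) :=
          fun y => y.continuous.comp continuous_projIcc
        exact intervalIntegral.integral_add ((h y).intervalIntegrable _ _)
          ((h y').intervalIntegrable _ _)
      map_smul' := fun c y => by
        ext s
        exact intervalIntegral.integral_smul _ _ } 1
    (fun y => by
      rw [one_mul]
      refine (ContinuousMap.norm_le _ (norm_nonneg _)).2 fun s => ?_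
      have := intervalIntegral.norm_integral_le_of_norm_le_const (a := 0) (b := (s : ℝ))
        (f := fun r => y (projIcc 0 1 zero_le_one r)) (C := ‖y‖)
        (fun r _ => y.norm_coe_le_norm _)
      refine this.trans ?_
      rw [sub_zero, abs_of_nonneg s.2.1]
      exact mul_le_of_le_one_right (norm_nonneg _) s.2.2)

lemma primitive_apply (y : C(Icc (0 : ℝ) 1, X)) (s : Icc (0 : ℝ) 1) :
    primitive X y s = ∫ r in (0 : ℝ)..s, y (projIcc 0 1 zero_le_one r) := rfl

/-- A `C^n` germ of a map is the germ of a globally `C^n` map, in finite dimension. -/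
lemma exists_contDiff_eventuallyEq {n : ℕ} {X : Type*} [NormedAddCommGroup X] [NormedSpace ℝ X]
    [HasContDiffBump X] {Y : Type*}
    [NormedAddCommGroup Y] [NormedSpace ℝ Y] {f : X → Y} {x₀ : X} (hf : ContDiffAt ℝ n f x₀) :
    ∃ g : X → Y, ContDiff ℝ n g ∧ g =ᶠ[𝓝 x₀] f := by
  obtain ⟨u, hu, hfu⟩ := hf.eventually (by simp) |>.exists_mem
  obtain ⟨r, hr, hru⟩ := Metric.mem_nhds_iff.1 hu
  let b : ContDiffBump x₀ := ⟨r / 4, r / 2, by positivity, by linarith⟩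
  refine ⟨fun x => b x • f x, ?_, ?_⟩
  · rw [contDiff_iff_contDiffAt]
    intro x
    by_cases hx : x ∈ Metric.ball x₀ r
    · exact b.contDiffAt.smul (hfu x (hru hx))
    · have hx' : x ∉ tsupport b := by
        rw [b.tsupport_eq]
        simp only [Metric.mem_ball, Metric.mem_closedBall, not_lt, not_le] at hx ⊢
        change r / 2 < _
        linarith
      have : (fun x => b x • f x) =ᶠ[𝓝 x] fun _ => 0 := by
        filter_upwards [(isClosed_tsupport b).isOpen_compl.mem_nhds hx'] with y hy
        rw [image_eq_zero_of_notMem_tsupport hy, zero_smul]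
      exact contDiffAt_const.congr_of_eventuallyEq this
  · filter_upwards [b.eventuallyEq_one] with x hx
    simp [hx]

/-- A vector field of class `C^n`, `n ≥ 1`, near `x₀` has a local flow of class `C^n`. -/
theorem exists_contDiffAt_flow [HasContDiffBump X] {n : ℕ} (hn : n ≠ 0) {f : X → X}
    {x₀ : X} (hf : ContDiffAt ℝ n f x₀) :
    ∃ Φ : ℝ × X → X, ContDiffAt ℝ n Φ (0, x₀) ∧ (∀ᶠ x in 𝓝 x₀, Φ (0, x) = x) ∧
      ∀ᶠ q in 𝓝 ((0 : ℝ), x₀), HasDerivAt (fun t => Φ (t, q.2)) (f (Φ q)) q.1 := by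
  obtain ⟨g, hg, hgf⟩ := exists_contDiff_eventuallyEq hf
  let S := Icc (0 : ℝ) 1
  let G : C(S, X) → C(S, X) := fun y => (⟨g, hg.continuous⟩ : C(X, X)).comp y
  have hG : ContDiff ℝ n G := ContinuousMap.contDiff_comp_left n hg
  let const : X →L[ℝ] C(S, X) := ContinuousLinearMap.const ℝ S
  -- Time is rescaled: a zero `y` of `Ψ ((τ, x), ·)` is the trajectory from `x` run at speed `τ`
  -- over `[0, 1]`. The time `τ` becomes a parameter, and the flow at time `τ` is the value of `y`
  -- at `1`.
  let Ψ : (ℝ × X) × C(S, X) → C(S, X) := fun p => p.2 - const p.1.2 - p.1.1 • primitive X (G p.2)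
  have hΨ : ContDiff ℝ n Ψ := by
    refine (contDiff_snd.sub (const.contDiff.comp (contDiff_snd.comp contDiff_fst))).sub
      ((contDiff_fst.comp contDiff_fst).smul ((primitive X).contDiff.comp (hG.comp contDiff_snd)))
  let u : (ℝ × X) × C(S, X) := ((0, x₀), const x₀)
  have hn' : (n : WithTop ℕ∞) ≠ 0 := by exact_mod_cast hn
  have hu : Ψ u = 0 := by simp [Ψ, u]
  -- At `τ = 0` the integral term disappears, so the partial derivative in `y` is the identity.
  have hinv : (fderiv ℝ Ψ u ∘L .inr ℝ (ℝ × X) C(S, X)).IsInvertible := by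
    have h1 : HasFDerivAt (fun y => Ψ ((0, x₀), y)) (fderiv ℝ Ψ u ∘L .inr ℝ (ℝ × X) C(S, X))
        (const x₀) :=
      ((hΨ.differentiable hn').differentiableAt.hasFDerivAt (x := u)).comp (const x₀)
        (hasFDerivAt_prodMk_right (0, x₀) (const x₀))
    have h2 : HasFDerivAt (fun y => Ψ ((0, x₀), y)) (.id ℝ C(S, X)) (const x₀) := by
      have : (fun y => Ψ ((0, x₀), y)) = fun y => y - const x₀ := by
        ext y; simp [Ψ]
      rw [this]
      exact (hasFDerivAt_id _).sub_const _
    rw [h1.unique h2]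
    exact ⟨ContinuousLinearEquiv.refl ℝ _, rfl⟩
  have hΨu : ContDiffAt ℝ n Ψ u := hΨ.contDiffAt
  let ψ := hΨu.implicitFunction hn' hinv
  have hψ : ContDiffAt ℝ n ψ (0, x₀) := hΨu.contDiffAt_implicitFunction hn' hinv
  have hV := hΨu.eventually_apply_eq_iff_implicitFunction hn' hinv
  have hg1 : ContDiffAt ℝ 1 g x₀ :=
    hg.contDiffAt.of_le (by exact_mod_cast Nat.one_le_iff_ne_zero.2 hn)
  obtain ⟨ε, hε, a, r, L, K, hr, hpl⟩ := IsPicardLindelof.of_contDiffAt_one hg1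
  -- The implicit function is regular in all variables, while the Picard-Lindelöf solution `α`
  -- visibly satisfies the equation in time. The claim `hsol` identifies the two.
  obtain ⟨α, hα, hαc⟩ := (hpl 0).exists_forall_mem_closedBall_eq_hasDerivWithinAt_continuousOn
  simp only [zero_sub, zero_add] at hα hαc
  have hα0 : α (x₀, 0) = x₀ := (hα x₀ (Metric.mem_closedBall_self r.2)).1
  have hαd : ∀ x ∈ Metric.closedBall x₀ r, ∀ t ∈ Ioo (-ε) ε,
      HasDerivAt (fun t => α (x, t)) (g (α (x, t))) t := fun x hx t ht =>
    ((hα x hx).2 t (Ioo_subset_Icc_self ht)).hasDerivAt (Icc_mem_nhds ht.1 ht.2)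
  have hαat : ContinuousAt α (x₀, 0) :=
    hαc.continuousAt (prod_mem_nhds (Metric.closedBall_mem_nhds _ hr)
      (Icc_mem_nhds (by linarith) hε))
  have hsol : ∀ᶠ q in 𝓝 ((0 : ℝ), x₀), ψ q ⟨1, right_mem_Icc.2 zero_le_one⟩ = α (q.2, q.1) := by
    rw [nhds_prod_eq, Filter.eventually_prod_iff] at hV
    obtain ⟨pa, ha, pb, hb, hab⟩ := hV
    obtain ⟨δ, hδ, hδb⟩ := Metric.eventually_nhds_iff.1 hb
    obtain ⟨η, hη, hηα⟩ := Metric.continuousAt_iff.1 hαat δ hδ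
    have e1 : ∀ᶠ q in 𝓝 ((0 : ℝ), x₀), |q.1| < min η ε := by
      have : Continuous fun q : ℝ × X => |q.1| := by fun_prop
      exact this.continuousAt.eventually_lt continuousAt_const (by simpa using ⟨hη, hε⟩)
    have e2 : ∀ᶠ q in 𝓝 ((0 : ℝ), x₀), dist q.2 x₀ < min η r := by
      have : Continuous fun q : ℝ × X => dist q.2 x₀ := by fun_prop
      exact this.continuousAt.eventually_lt continuousAt_const (by simpa using ⟨hη, hr⟩)
    filter_upwards [ha, e1, e2] with ⟨τ, x⟩ hq h1 h2
    simp only [lt_min_iff] at h1 h2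
    have hx : x ∈ Metric.closedBall x₀ r := h2.2.le
    have hts : ∀ s ∈ Icc (0 : ℝ) 1, |τ * s| ≤ |τ| := fun s hs => by
      rw [abs_mul, abs_of_nonneg hs.1]
      exact mul_le_of_le_one_right (abs_nonneg _) hs.2
    have hd : ∀ s ∈ Icc (0 : ℝ) 1, HasDerivAt (fun s => α (x, τ * s)) (τ • g (α (x, τ * s))) s := by
      intro s hs
      have := (hαd x hx (τ * s) (abs_lt.1 ((hts s hs).trans_lt h1.2)))
      have h3 : HasDerivAt (fun s => τ * s) τ s := by simpa using (hasDerivAt_id s).const_mul τ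
      exact this.scomp s h3
    have hcon : ContinuousOn (fun s => α (x, τ * s)) S := fun s hs =>
      (hd s hs).continuousAt.continuousWithinAt
    let y : C(S, X) := ⟨fun s => α (x, τ * s), continuousOn_iff_continuous_domRestrict.1 hcon⟩
    -- The implicit function only captures zeros close to `const x₀`. Continuity of `α` at `(x₀, 0)`
    -- places the rescaled trajectory there.
    have hy : pb y := by
      refine hδb ((ContinuousMap.dist_lt_iff hδ).2 fun s => ?_)
      change dist (α (x, τ * s)) x₀ < δ
      have : dist (x, τ * s) (x₀, (0 : ℝ)) < η := by
        rw [Prod.dist_eq, max_lt_iff, Real.dist_eq, sub_zero]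
        exact ⟨h2.1, (hts s s.2).trans_lt h1.1⟩
      simpa [hα0] using hηα this
    have hzero : Ψ ((τ, x), y) = Ψ u := by
      rw [hu]
      ext ⟨s, hs⟩
      have hint : ∫ r in (0 : ℝ)..s, τ • g (α (x, τ * r)) = α (x, τ * s) - α (x, τ * 0) := by
        have hsub : uIcc 0 s ⊆ S := by
          rw [uIcc_of_le hs.1]; exact Icc_subset_Icc_right hs.2
        refine intervalIntegral.integral_eq_sub_of_hasDerivAt (fun r hr => hd r (hsub hr)) ?_
        exact ((continuousOn_const.smul (hg.continuous.comp_continuousOn hcon)).mono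
          hsub).intervalIntegrable
      have hint2 : primitive X (G y) ⟨s, hs⟩ = ∫ r in (0 : ℝ)..s, g (α (x, τ * r)) := by
        rw [primitive_apply]
        refine intervalIntegral.integral_congr fun r hr => ?_
        rw [uIcc_of_le hs.1] at hr
        have : r ∈ Icc (0 : ℝ) 1 := ⟨hr.1, hr.2.trans hs.2⟩
        simp only [projIcc_of_mem zero_le_one this]
        rfl
      rw [intervalIntegral.integral_smul, mul_zero, (hα x hx).1] at hint
      change α (x, τ * s) - x - τ • primitive X (G y) ⟨s, hs⟩ = 0
      rw [hint2, hint, sub_self]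
    have hψy : ψ (τ, x) = y := (hab hq hy).1 hzero
    rw [hψy]
    change α (x, τ * 1) = _
    rw [mul_one]
  refine ⟨fun q => α (q.2, q.1), ?_, ?_, ?_⟩
  · have : ContDiffAt ℝ n (fun q => ψ q ⟨1, right_mem_Icc.2 zero_le_one⟩) (0, x₀) :=
      ((ContinuousMap.evalCLM (M := X) ℝ (⟨1, right_mem_Icc.2 zero_le_one⟩ : S)).contDiff.contDiffAt
        (x := ψ (0, x₀))).comp (0, x₀) hψ
    exact this.congr_of_eventuallyEq (hsol.mono fun q hq => hq.symm)
  · filter_upwards [Metric.closedBall_mem_nhds x₀ hr] with x hx using (hα x hx).1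
  · have hc : ContinuousAt (fun q : ℝ × X => α (q.2, q.1)) (0, x₀) :=
      ContinuousAt.comp (f := fun q : ℝ × X => (q.2, q.1)) hαat (by fun_prop)
    have h1 := hc.tendsto.eventually (by rw [hα0]; exact hgf)
    have h2 : ∀ᶠ q in 𝓝 ((0 : ℝ), x₀), q.1 ∈ Ioo (-ε) ε :=
      continuousAt_fst.eventually (Ioo_mem_nhds (by simpa using hε) hε)
    have h3 : ∀ᶠ q in 𝓝 ((0 : ℝ), x₀), q.2 ∈ Metric.closedBall x₀ r :=
      continuousAt_snd.eventually (Metric.closedBall_mem_nhds _ hr)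
    filter_upwards [h1, h2, h3] with q h1 h2 h3
    rw [← h1]
    exact hαd q.2 h3 q.1 h2

end Flow
end

noncomputable section

/-! ### Extension of C² maps across a hyperplane by reflection. -/

section HalfSpaceExtension

variable {X F : Type*} [NormedAddCommGroup X] [NormedSpace ℝ X]
  [NormedAddCommGroup F] [NormedSpace ℝ F]

/-- Gluing of two `C^1` maps along a hyperplane. -/
lemma hasFDerivAt_glue {ℓ : X →L[ℝ] ℝ} {v : Set X} (hv : IsOpen v) {f₁ f₂ : X → F}
    {D₁ D₂ : X → X →L[ℝ] F}
    (h₁ : ∀ x ∈ v, 0 ≤ ℓ x → HasFDerivWithinAt f₁ (D₁ x) {x | 0 ≤ ℓ x} x)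
    (h₂ : ∀ x ∈ v, ℓ x ≤ 0 → HasFDerivWithinAt f₂ (D₂ x) {x | ℓ x ≤ 0} x)
    (hf : ∀ x ∈ v, ℓ x = 0 → f₁ x = f₂ x) (hD : ∀ x ∈ v, ℓ x = 0 → D₁ x = D₂ x)
    {x : X} (hx : x ∈ v) :
    HasFDerivAt (fun x => if 0 ≤ ℓ x then f₁ x else f₂ x) (if 0 ≤ ℓ x then D₁ x else D₂ x) x := by
  rcases lt_trichotomy (ℓ x) 0 with h | h | h
  · rw [if_neg (not_le.2 h)]
    have hn : {x | ℓ x < 0} ∈ 𝓝 x := (isOpen_lt ℓ.continuous continuous_const).mem_nhds h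
    refine ((h₂ x hx h.le).hasFDerivAt (mem_of_superset hn fun y hy => show ℓ y ≤ 0 from le_of_lt hy)).congr_of_eventuallyEq
      ?_
    filter_upwards [hn] with y hy
    rw [if_neg (not_le.2 hy)]
  · rw [if_pos h.ge]
    have e₁ : HasFDerivWithinAt (fun x => if 0 ≤ ℓ x then f₁ x else f₂ x) (D₁ x) {x | 0 ≤ ℓ x} x :=
      (h₁ x hx h.ge).congr (fun y hy => if_pos hy) (if_pos h.ge)
    have e₂ : HasFDerivWithinAt (fun x => if 0 ≤ ℓ x then f₁ x else f₂ x) (D₁ x)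
        ({x | ℓ x ≤ 0} ∩ v) x := by
      rw [hD x hx h]
      refine ((h₂ x hx h.le).mono inter_subset_left).congr (fun y hy => ?_) ?_
      · by_cases hy0 : 0 ≤ ℓ y
        · rw [if_pos hy0, hf y hy.2 (le_antisymm hy.1 hy0)]
        · rw [if_neg hy0]
      · rw [if_pos h.ge, hf x hx h]
    refine (e₁.union e₂).hasFDerivAt (mem_of_superset (hv.mem_nhds hx) fun y hy => ?_)
    rcases le_total 0 (ℓ y) with h0 | h0
    · exact Or.inl h0
    · exact Or.inr ⟨h0, hy⟩
  · rw [if_pos h.le]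
    have hn : {x | 0 < ℓ x} ∈ 𝓝 x := (isOpen_lt continuous_const ℓ.continuous).mem_nhds h
    refine ((h₁ x hx h.le).hasFDerivAt (mem_of_superset hn fun y hy => show 0 ≤ ℓ y from le_of_lt hy)).congr_of_eventuallyEq
      ?_
    filter_upwards [hn] with y hy
    rw [if_pos (le_of_lt hy)]

lemma continuousOn_glue {F : Type*} [TopologicalSpace F] {ℓ : X →L[ℝ] ℝ} {v : Set X} {f₁ f₂ : X → F}
    (h₁ : ContinuousOn f₁ (v ∩ {x | 0 ≤ ℓ x})) (h₂ : ContinuousOn f₂ (v ∩ {x | ℓ x ≤ 0}))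
    (hf : ∀ x ∈ v, ℓ x = 0 → f₁ x = f₂ x) :
    ContinuousOn (fun x => if 0 ≤ ℓ x then f₁ x else f₂ x) v := by
  have hcl1 : closure {x | 0 ≤ ℓ x} = {x | 0 ≤ ℓ x} :=
    (isClosed_le continuous_const ℓ.continuous).closure_eq
  have hcl2 : closure {x | ¬ 0 ≤ ℓ x} ⊆ {x | ℓ x ≤ 0} := by
    refine closure_minimal (fun x hx => (not_le.1 hx).le) (isClosed_le ℓ.continuous continuous_const)
  refine ContinuousOn.if (fun x hx => hf x hx.1 ?_) ?_ ?_
  · have := hx.2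
    rw [frontier_eq_closure_inter_closure, hcl1] at this
    exact le_antisymm (hcl2 this.2) this.1
  · rwa [hcl1]
  · exact h₂.mono (inter_subset_inter_right _ hcl2)

/-- The linear map fixing the hyperplane `ℓ = 0` and sending `e` to `-a • e`. -/
def hyperplaneScaling (ℓ : X →L[ℝ] ℝ) (e : X) (a : ℝ) : X →L[ℝ] X :=
  .id ℝ X - (1 + a) • ℓ.smulRight e

lemma hyperplaneScaling_apply (ℓ : X →L[ℝ] ℝ) (e : X) (a : ℝ) (x : X) :
    hyperplaneScaling ℓ e a x = x - ((1 + a) * ℓ x) • e := by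
  simp [hyperplaneScaling, smul_smul]

lemma hyperplaneScaling_of_eq_zero (ℓ : X →L[ℝ] ℝ) (e : X) (a : ℝ) {x : X} (hx : ℓ x = 0) :
    hyperplaneScaling ℓ e a x = x := by simp [hyperplaneScaling_apply, hx]

lemma apply_hyperplaneScaling {ℓ : X →L[ℝ] ℝ} {e : X} (he : ℓ e = 1) (a : ℝ) (x : X) :
    ℓ (hyperplaneScaling ℓ e a x) = -(a * ℓ x) := by
  rw [hyperplaneScaling_apply, map_sub, map_smul, he, smul_eq_mul]; ring

/-- Extension across a boundary point of a map of class `C^2` on a closed half space. -/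
lemma ContDiffWithinAt.exists_extend_halfSpace {ℓ : X →L[ℝ] ℝ} {e : X} (he : ℓ e = 1) {f : X → F}
    {p : X} (hp : 0 ≤ ℓ p) (hf : ContDiffWithinAt ℝ 2 f {x | 0 ≤ ℓ x} p) :
    ∃ g : X → F, ContDiffAt ℝ 2 g p ∧ ∀ x, 0 ≤ ℓ x → g x = f x := by
  set H : Set X := {x | 0 ≤ ℓ x} with hH
  rcases hp.lt_or_eq with hp | hp
  · exact ⟨f, hf.contDiffAt (mem_of_superset
      ((isOpen_lt continuous_const ℓ.continuous).mem_nhds hp) fun x hx => show 0 ≤ ℓ x from le_of_lt hx),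
      fun _ _ => rfl⟩
  have hpH : p ∈ H := hp.le
  obtain ⟨u, hu, hpu, hfu⟩ := hf.contDiffOn' le_rfl (by simp)
  rw [insert_eq_of_mem hpH] at hfu
  have hHu : UniqueDiffOn ℝ H := by
    refine uniqueDiffOn_convex (convex_halfSpace_ge ℓ.isLinear 0) ⟨e, mem_interior.2
      ⟨{x | 0 < ℓ x}, fun x hx => show 0 ≤ ℓ x from le_of_lt hx, isOpen_lt continuous_const ℓ.continuous, ?_⟩⟩
    simp [he]
  have hHuu : UniqueDiffOn ℝ (H ∩ u) := hHu.inter hu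
  set D : X → X →L[ℝ] F := fderivWithin ℝ f (H ∩ u) with hD
  set D' : X → X →L[ℝ] X →L[ℝ] F := fderivWithin ℝ D (H ∩ u) with hD'
  have cD : ContDiffOn ℝ 1 D (H ∩ u) := hfu.fderivWithin hHuu (by norm_num)
  have cD' : ContinuousOn D' (H ∩ u) := cD.continuousOn_fderivWithin hHuu (by norm_num)
  have dD : ∀ x ∈ u, 0 ≤ ℓ x → HasFDerivWithinAt f (D x) H x := fun x hx h0 =>
    (hfu.differentiableOn (by norm_num) x ⟨h0, hx⟩).hasFDerivWithinAt.mono_of_mem_nhdsWithin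
      (inter_mem_nhdsWithin _ (hu.mem_nhds hx))
  have dD' : ∀ x ∈ u, 0 ≤ ℓ x → HasFDerivWithinAt D (D' x) H x := fun x hx h0 =>
    (cD.differentiableOn (by norm_num) x ⟨h0, hx⟩).hasFDerivWithinAt.mono_of_mem_nhdsWithin
      (inter_mem_nhdsWithin _ (hu.mem_nhds hx))
  let T := hyperplaneScaling ℓ e
  let v : Set X := u ∩ (T 1 ⁻¹' u ∩ (T 2 ⁻¹' u ∩ T 3 ⁻¹' u))
  have hv : IsOpen v := hu.inter ((hu.preimage (T 1).continuous).inter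
    ((hu.preimage (T 2).continuous).inter (hu.preimage (T 3).continuous)))
  have hTp : ∀ a, T a p = p := fun a => hyperplaneScaling_of_eq_zero ℓ e a hp.symm
  have hpv : p ∈ v := ⟨hpu, by simpa [hTp] using hpu, by simpa [hTp] using hpu,
    by simpa [hTp] using hpu⟩
  have hmap : ∀ a, 0 ≤ a → MapsTo (T a) {x | ℓ x ≤ 0} H := fun a ha x hx => by
    change 0 ≤ ℓ (hyperplaneScaling ℓ e a x)
    rw [apply_hyperplaneScaling he]
    have : ℓ x ≤ 0 := hx
    nlinarith
  have tu : ∀ x ∈ v, T 1 x ∈ u ∧ T 2 x ∈ u ∧ T 3 x ∈ u := fun x hx => hx.2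
  let pre : ∀ a : ℝ, (X →L[ℝ] F) →L[ℝ] (X →L[ℝ] F) := fun a => (ContinuousLinearMap.compL ℝ X X F).flip (T a)
  -- The map `T a` multiplies the normal coordinate by `-a`. The weights 6, -8, 3 at a = 1, 2, 3
  -- solve ∑ c_a (-a)^k = 1 for k = 0, 1, 2, which matches `f` on the hyperplane to second order.
  let f₂ : X → F := fun x => (6 : ℝ) • f (T 1 x) - (8 : ℝ) • f (T 2 x) + (3 : ℝ) • f (T 3 x)
  let D₂ : X → X →L[ℝ] F := fun x =>
    (6 : ℝ) • pre 1 (D (T 1 x)) - (8 : ℝ) • pre 2 (D (T 2 x)) + (3 : ℝ) • pre 3 (D (T 3 x))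
  let D₂' : X → X →L[ℝ] X →L[ℝ] F := fun x =>
    (6 : ℝ) • (pre 1).comp ((D' (T 1 x)).comp (T 1)) -
    (8 : ℝ) • (pre 2).comp ((D' (T 2 x)).comp (T 2)) +
    (3 : ℝ) • (pre 3).comp ((D' (T 3 x)).comp (T 3))
  have comp1 : ∀ a, 0 ≤ a → ∀ x, T a x ∈ u → ℓ x ≤ 0 →
      HasFDerivWithinAt (fun x => f (T a x)) (pre a (D (T a x))) {x | ℓ x ≤ 0} x :=
    fun a ha x hx h0 => (dD _ hx (hmap a ha h0)).comp x (T a).hasFDerivWithinAt (hmap a ha)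
  have comp2 : ∀ a, 0 ≤ a → ∀ x, T a x ∈ u → ℓ x ≤ 0 →
      HasFDerivWithinAt (fun x => pre a (D (T a x))) ((pre a).comp ((D' (T a x)).comp (T a)))
        {x | ℓ x ≤ 0} x :=
    fun a ha x hx h0 => (pre a).hasFDerivAt.comp_hasFDerivWithinAt x
      ((dD' _ hx (hmap a ha h0)).comp x (T a).hasFDerivWithinAt (hmap a ha))
  have h1 : ∀ x ∈ v, HasFDerivAt (fun x => if 0 ≤ ℓ x then f x else f₂ x)
      (if 0 ≤ ℓ x then D x else D₂ x) x := fun x hx => by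
    refine hasFDerivAt_glue hv (fun y hy h0 => dD y hy.1 h0) (fun y hy h0 => ?_)
      (fun y hy h0 => ?_) (fun y hy h0 => ?_) hx
    · obtain ⟨t1, t2, t3⟩ := tu y hy
      exact (((comp1 1 (by norm_num) y t1 h0).const_smul (6 : ℝ)).sub
        ((comp1 2 (by norm_num) y t2 h0).const_smul (8 : ℝ))).add
        ((comp1 3 (by norm_num) y t3 h0).const_smul (3 : ℝ))
    · simp only [f₂, T, hyperplaneScaling_of_eq_zero ℓ e _ h0]
      module
    · ext w
      simp only [D₂, T, hyperplaneScaling_of_eq_zero ℓ e _ h0, pre]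
      simp only [add_apply, sub_apply,
        smul_apply, ContinuousLinearMap.flip_apply,
        ContinuousLinearMap.compL_apply, ContinuousLinearMap.comp_apply, hyperplaneScaling_apply,
        map_sub, map_smul]
      module
  have h2 : ∀ x ∈ v, HasFDerivAt (fun x => if 0 ≤ ℓ x then D x else D₂ x)
      (if 0 ≤ ℓ x then D' x else D₂' x) x := fun x hx => by
    refine hasFDerivAt_glue hv (fun y hy h0 => dD' y hy.1 h0) (fun y hy h0 => ?_)
      (fun y hy h0 => ?_) (fun y hy h0 => ?_) hx
    · obtain ⟨t1, t2, t3⟩ := tu y hy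
      exact (((comp2 1 (by norm_num) y t1 h0).const_smul (6 : ℝ)).sub
        ((comp2 2 (by norm_num) y t2 h0).const_smul (8 : ℝ))).add
        ((comp2 3 (by norm_num) y t3 h0).const_smul (3 : ℝ))
    · ext w
      simp only [D₂, T, hyperplaneScaling_of_eq_zero ℓ e _ h0, pre]
      simp only [add_apply, sub_apply,
        smul_apply, ContinuousLinearMap.flip_apply,
        ContinuousLinearMap.compL_apply, ContinuousLinearMap.comp_apply, hyperplaneScaling_apply,
        map_sub, map_smul]
      module
    · ext w w'
      simp only [D₂', T, hyperplaneScaling_of_eq_zero ℓ e _ h0, pre]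
      simp only [add_apply, sub_apply,
        smul_apply, ContinuousLinearMap.flip_apply,
        ContinuousLinearMap.compL_apply, ContinuousLinearMap.comp_apply, hyperplaneScaling_apply,
        map_sub, map_smul]
      module
  have h3 : ContinuousOn (fun x => if 0 ≤ ℓ x then D' x else D₂' x) v := by
    have cT : ∀ a, 0 ≤ a → MapsTo (T a) v u →
        ContinuousOn (fun x => (pre a).comp ((D' (T a x)).comp (T a))) (v ∩ {x | ℓ x ≤ 0}) := by
      intro a ha hm
      have : ContinuousOn (fun x => D' (T a x)) (v ∩ {x | ℓ x ≤ 0}) :=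
        ContinuousOn.comp cD' (T a).continuous.continuousOn
          fun x hx => ⟨hmap a ha hx.2, hm hx.1⟩
      exact continuousOn_const.clm_comp (this.clm_comp continuousOn_const)
    refine continuousOn_glue (cD'.mono fun x hx => ⟨hx.2, hx.1.1⟩) ?_ (fun y hy h0 => ?_)
    · exact (((cT 1 (by norm_num) fun x hx => (tu x hx).1).const_smul (6 : ℝ)).sub
        ((cT 2 (by norm_num) fun x hx => (tu x hx).2.1).const_smul (8 : ℝ))).add
        ((cT 3 (by norm_num) fun x hx => (tu x hx).2.2).const_smul (3 : ℝ))
    · ext w w'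
      simp only [D₂', T, hyperplaneScaling_of_eq_zero ℓ e _ h0, pre]
      simp only [add_apply, sub_apply,
        smul_apply, ContinuousLinearMap.flip_apply,
        ContinuousLinearMap.compL_apply, ContinuousLinearMap.comp_apply, hyperplaneScaling_apply,
        map_sub, map_smul]
      module
  refine ⟨fun x => if 0 ≤ ℓ x then f x else f₂ x, ?_, fun x hx => if_pos hx⟩
  have c1 : ContDiffOn ℝ 1 (fun x => if 0 ≤ ℓ x then D x else D₂ x) v := by
    have := (contDiffOn_succ_iff_fderiv_of_isOpen (𝕜 := ℝ) (n := 0) hv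
      (f := fun x => if 0 ≤ ℓ x then D x else D₂ x)).2
      ⟨fun x hx => (h2 x hx).differentiableAt.differentiableWithinAt, by simp,
        contDiffOn_zero.2 (h3.congr fun x hx => (h2 x hx).fderiv)⟩
    simpa using this
  have c2 := (contDiffOn_succ_iff_fderiv_of_isOpen (𝕜 := ℝ) (n := 1) hv
      (f := fun x => if 0 ≤ ℓ x then f x else f₂ x)).2
      ⟨fun x hx => (h1 x hx).differentiableAt.differentiableWithinAt, by simp,
        c1.congr fun x hx => (h1 x hx).fderiv⟩
  exact ((c2.of_le (by norm_num [one_add_one_eq_two])).contDiffAt (hv.mem_nhds hpv))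

end HalfSpaceExtension
end

noncomputable section

/-! ### Index and nullity of symmetric operators. -/

section Index

open Module

variable {E : Type*} [NormedAddCommGroup E] [InnerProductSpace ℝ E]

/-- The quadratic form `x ↦ ⟪U x, x⟫` of an operator. -/
def operatorForm (U : E →L[ℝ] E) : QuadraticForm ℝ E :=
  LinearMap.BilinMap.toQuadraticMap ((innerₗ E).comp U.toLinearMap)

lemma operatorForm_apply (U : E →L[ℝ] E) (x : E) : operatorForm U x = inner ℝ (U x) x := rfl

/-- By symmetry the polar form of `x` and `y` is twice ⟪U x, y⟫; testing an element `x` of the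
radical against `y = U x` forces `U x = 0`. -/
lemma radical_operatorForm {U : E →L[ℝ] E} (hU : U.toLinearMap.IsSymmetric) :
    (operatorForm U).radical = LinearMap.ker U.toLinearMap := by
  ext x
  rw [QuadraticMap.mem_radical_iff', LinearMap.mem_ker]
  constructor
  · rintro ⟨h0, h⟩
    have h1 := h (U x)
    have h2 : inner ℝ (U (U x)) x = inner ℝ (U x) (U x) := hU (U x) x
    simp only [operatorForm_apply, map_add, inner_add_left, inner_add_right] at h0 h1
    have : inner ℝ (U x) (U x) = 0 := by linarith
    exact inner_self_eq_zero.1 this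
  · intro hx
    have hx' : U x = 0 := hx
    refine ⟨by simp [operatorForm_apply, hx'], fun y => ?_⟩
    have : inner ℝ (U y) x = inner ℝ y (U x) := hU y x
    simp [operatorForm_apply, hx', inner_add_right, this]

/-- The number of negative eigenvalues of a symmetric operator, as the maximal dimension of a
negative definite subspace. -/
def negIndex (U : E →L[ℝ] E) : ℕ := sigNeg (operatorForm U)

/-- The dimension of the kernel. -/
def nullity (U : E →L[ℝ] E) : ℕ := finrank ℝ (LinearMap.ker U.toLinearMap)

variable [FiniteDimensional ℝ E]

lemma le_negIndex {U : E →L[ℝ] E} {V : Submodule ℝ E}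
    (h : ∀ x ∈ V, x ≠ 0 → inner ℝ (U x) x < 0) : finrank ℝ V ≤ negIndex U := by
  refine le_sigNeg_of_negDef _ (fun x hx => ?_)
  have := h x x.2 (by simpa using hx)
  simpa [operatorForm_apply] using this

lemma exists_finrank_eq_negIndex (U : E →L[ℝ] E) :
    ∃ V : Submodule ℝ E, finrank ℝ V = negIndex U ∧ ∀ x ∈ V, x ≠ 0 → inner ℝ (U x) x < 0 := by
  obtain ⟨V, hV, h⟩ := exists_finrank_eq_sigNeg_and_negDef (operatorForm U)
  refine ⟨V, hV, fun x hx h0 => ?_⟩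
  have := h ⟨x, hx⟩ (by simpa using h0)
  simpa [operatorForm_apply] using this

lemma negIndex_anti {U V : E →L[ℝ] E} (h : ∀ x, inner ℝ (U x) x ≤ inner ℝ (V x) x) :
    negIndex V ≤ negIndex U := by
  obtain ⟨S, hS, hneg⟩ := exists_finrank_eq_negIndex V
  rw [← hS]
  exact le_negIndex fun x hx h0 => (h x).trans_lt (hneg x hx h0)

/-- On the sum of a maximal negative subspace of `V` and the kernel of `V`, the form of `V` is
nonpositive, so the strictly smaller form of `U` is negative definite there. -/
lemma negIndex_add_nullity_le {U V : E →L[ℝ] E} (hV : V.toLinearMap.IsSymmetric)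
    (h : ∀ x, x ≠ 0 → inner ℝ (U x) x < inner ℝ (V x) x) :
    negIndex V + nullity V ≤ negIndex U := by
  obtain ⟨S, hS, hneg⟩ := exists_finrank_eq_negIndex V
  set N := LinearMap.ker V.toLinearMap with hN
  have hdis : Disjoint S N := by
    rw [Submodule.disjoint_def]
    intro x hx hxN
    by_contra h0
    have h1 := hneg x hx h0
    have : V x = 0 := hxN
    simp [this] at h1
  have hdim : finrank ℝ ↥(S ⊔ N) = negIndex V + nullity V := by
    have := Submodule.finrank_sup_add_finrank_inf_eq S N
    rw [hdis.eq_bot, finrank_bot, add_zero] at this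
    rw [this, hS, nullity]
  rw [← hdim]
  refine le_negIndex fun x hx h0 => (h x h0).trans_le ?_
  obtain ⟨s, hs, k, hk, rfl⟩ := Submodule.mem_sup.1 hx
  have hk' : V k = 0 := hk
  have h1 : inner ℝ (V s) k = inner ℝ s (V k) := hV s k
  rw [map_add, hk', add_zero, inner_add_right, h1, hk', inner_zero_right, add_zero]
  by_cases hs0 : s = 0
  · simp [hs0]
  · exact (hneg s hs hs0).le

/-- Lower semicontinuity of the index. -/
lemma eventually_negIndex_le (U : E →L[ℝ] E) : ∀ᶠ V in 𝓝 U, negIndex U ≤ negIndex V := by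
  obtain ⟨S, hS, hneg⟩ := exists_finrank_eq_negIndex U
  have hcomp : IsCompact (Subtype.val '' (Metric.sphere (0 : S) 1)) :=
    (isCompact_sphere (0 : S) 1).image continuous_subtype_val
  have hev : ∀ᶠ V in 𝓝 U, ∀ x ∈ Subtype.val '' (Metric.sphere (0 : S) 1), inner ℝ (V x) x < 0 := by
    -- Negativity on the compact unit sphere of `S` persists for nearby operators; homogeneity then
    -- covers all of `S`.
    refine hcomp.eventually_forall_of_forall_eventually fun x hx => ?_
    have hc : Continuous fun p : (E →L[ℝ] E) × E => inner ℝ (p.1 p.2) p.2 := by fun_prop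
    refine hc.continuousAt.eventually_lt continuousAt_const ?_
    obtain ⟨s, hs, rfl⟩ := hx
    exact hneg s s.2 fun h0 => by simp [show s = 0 from Subtype.ext h0] at hs
  filter_upwards [hev] with V hV
  rw [← hS]
  refine le_negIndex fun x hx h0 => ?_
  have hn : 0 < ‖x‖ := norm_pos_iff.2 h0
  have h1 := hV (‖x‖⁻¹ • x) ⟨⟨‖x‖⁻¹ • x, S.smul_mem _ hx⟩, by
    simp [norm_smul, hn.ne'], rfl⟩
  rw [map_smul, inner_smul_left, inner_smul_right, ← mul_assoc] at h1
  simp only [conj_trivial] at h1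
  have h2 : 0 < ‖x‖⁻¹ * ‖x‖⁻¹ := by positivity
  by_contra hcon
  exact absurd h1 (not_lt.2 (mul_nonneg h2.le (not_lt.1 hcon)))

lemma negIndex_neg_add {U : E →L[ℝ] E} (hU : U.toLinearMap.IsSymmetric) :
    negIndex (-U) + negIndex U + nullity U = finrank ℝ E := by
  have h := QuadraticForm.sigPos_add_sigNeg_add_radical (Q := operatorForm U)
  rw [radical_operatorForm hU] at h
  have h2 : negIndex (-U) = sigPos (operatorForm U) := by
    have : operatorForm (-U) = -operatorForm U := by
      ext x; simp [operatorForm_apply]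
    rw [negIndex, this, sigNeg_neg]
  rw [h2]
  exact h

/-- Upper semicontinuity of the number of nonpositive eigenvalues. -/
lemma eventually_negIndex_add_nullity_le {U : E →L[ℝ] E} (hU : U.toLinearMap.IsSymmetric) :
    ∀ᶠ V : E →L[ℝ] E in 𝓝 U, V.toLinearMap.IsSymmetric →
      negIndex V + nullity V ≤ negIndex U + nullity U := by
  -- The number of nonpositive eigenvalues is the dimension minus the index of the opposite
  -- operator, whose lower semicontinuity is known.
  have h1 : ∀ᶠ V : E →L[ℝ] E in 𝓝 U, negIndex (-U) ≤ negIndex (-V) :=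
    (continuous_neg.tendsto U).eventually (eventually_negIndex_le (-U))
  filter_upwards [h1] with V hV hVs
  have := negIndex_neg_add hU
  have := negIndex_neg_add hVs
  omega

end Index

/-! ### Families of symmetric operators that increase along cones. -/

section IndexFamily

open Module

variable {E Z : Type*} [NormedAddCommGroup E] [InnerProductSpace ℝ E] [FiniteDimensional ℝ E]
  [NormedAddCommGroup Z]

/-- An integer-valued function `m` on a product `ℝ × Z` controls a multiplicity function `μ` on `s`
with slope `κ`, if it behaves as the index of a family of symmetric operators which increases along
the cones `‖ζ' - ζ‖ * κ ≤ t' - t`, the multiplicity being the dimension of the kernel. -/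
structure IsIndexFor (s : Set (ℝ × Z)) (κ : ℝ) (μ m : ℝ × Z → ℕ) : Prop where
  anti : ∀ q ∈ s, ∀ q' ∈ s, q.1 + κ * ‖q'.2 - q.2‖ ≤ q'.1 → m q' ≤ m q
  anti_strict : ∀ q ∈ s, ∀ q' ∈ s, q.1 + κ * ‖q'.2 - q.2‖ < q'.1 → m q' + μ q' ≤ m q
  lower : ∀ q ∈ s, ∀ᶠ q' in 𝓝 q, m q ≤ m q'
  upper : ∀ q ∈ s, ∀ᶠ q' in 𝓝 q, m q' + μ q' ≤ m q + μ q

/-- The slope `K / c` is where the lower bound for the increment of the form changes sign. Beyond it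
the forms increase, so comparison of forms gives the two monotonicity properties; the other two are
semicontinuity of the index. -/
theorem exists_isIndexFor {U : ℝ × Z → E →L[ℝ] E} {μ : ℝ × Z → ℕ} {q₀ : ℝ × Z}
    (hc : ∀ᶠ q in 𝓝 q₀, ContinuousAt U q) (hs : ∀ᶠ q in 𝓝 q₀, (U q).toLinearMap.IsSymmetric)
    (hμ : ∀ᶠ q in 𝓝 q₀, μ q = nullity (U q)) {c K : ℝ} (hc0 : 0 < c) (hK : 0 ≤ K)
    (hmono : ∀ᶠ p in 𝓝 q₀ ×ˢ 𝓝 q₀, p.1.1 ≤ p.2.1 → ∀ x : E,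
      (c * (p.2.1 - p.1.1) - K * ‖p.2.2 - p.1.2‖) * ‖x‖ ^ 2 ≤
        inner ℝ (U p.2 x) x - inner ℝ (U p.1 x) x) :
    ∃ s ∈ 𝓝 q₀, ∃ κ, 0 ≤ κ ∧ ∃ m, IsIndexFor s κ μ m := by
  obtain ⟨t, ht, htm⟩ := Filter.mem_prod_self_iff.1 hmono
  obtain ⟨s, hs', hso, hqs⟩ := mem_nhds_iff.1 (inter_mem (inter_mem hc hs) (inter_mem hμ ht))
  have form : ∀ q ∈ s, ∀ q' ∈ s, q.1 ≤ q'.1 → ∀ x : E,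
      (c * (q'.1 - q.1) - K * ‖q'.2 - q.2‖) * ‖x‖ ^ 2 ≤
        inner ℝ (U q' x) x - inner ℝ (U q x) x := fun q hq q' hq' =>
    htm (show (q, q') ∈ t ×ˢ t from ⟨(hs' hq).2.2, (hs' hq').2.2⟩)
  refine ⟨s, hso.mem_nhds hqs, K / c, by positivity, fun q => negIndex (U q), ?_, ?_, ?_, ?_⟩
  · intro q hq q' hq' h
    have h0 : 0 ≤ K / c * ‖q'.2 - q.2‖ := by positivity
    refine negIndex_anti fun x => ?_
    have h1 := form q hq q' hq' (by linarith) x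
    have h2 : 0 ≤ c * (q'.1 - q.1) - K * ‖q'.2 - q.2‖ := by
      have : c * (K / c * ‖q'.2 - q.2‖) ≤ c * (q'.1 - q.1) :=
        mul_le_mul_of_nonneg_left (by linarith) hc0.le
      have h3 : c * (K / c * ‖q'.2 - q.2‖) = K * ‖q'.2 - q.2‖ := by field_simp
      linarith
    nlinarith [sq_nonneg ‖x‖]
  · intro q hq q' hq' h
    have h0 : 0 ≤ K / c * ‖q'.2 - q.2‖ := by positivity
    simp only [show μ q' = nullity (U q') from (hs' hq').2.1]
    refine negIndex_add_nullity_le (hs' hq').1.2 fun x hx => ?_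
    have h1 := form q hq q' hq' (by linarith) x
    have h2 : 0 < c * (q'.1 - q.1) - K * ‖q'.2 - q.2‖ := by
      have : c * (K / c * ‖q'.2 - q.2‖) < c * (q'.1 - q.1) :=
        mul_lt_mul_of_pos_left (by linarith) hc0
      have h3 : c * (K / c * ‖q'.2 - q.2‖) = K * ‖q'.2 - q.2‖ := by field_simp
      linarith
    have h3 : 0 < ‖x‖ ^ 2 := by positivity
    nlinarith [mul_pos h2 h3]
  · intro q hq
    have hcq : ContinuousAt U q := (hs' hq).1.1
    exact hcq.tendsto.eventually (eventually_negIndex_le (U q))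
  · intro q hq
    have hcq : ContinuousAt U q := (hs' hq).1.1
    filter_upwards [hcq.tendsto.eventually (eventually_negIndex_add_nullity_le (hs' hq).1.2),
      hso.mem_nhds hq] with q' h h'
    rw [show μ q = nullity (U q) from (hs' hq).2.1, show μ q' = nullity (U q') from (hs' h').2.1]
    exact h (hs' h').1.2

end IndexFamily
end

noncomputable section

/-! ### From Lagrangian subspaces to symmetric operators. -/

section LagrangianFamily

open Module

/-- If `B w = c • A w` had a nonzero solution for every real `c`, the vectors `A w` for different
`c` would be nonzero and, by isotropy, mutually orthogonal: infinitely many in a finite-dimensional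
space. -/
lemma exists_injective_sub_smul {W E : Type*} [AddCommGroup W] [Module ℝ W]
    [NormedAddCommGroup E] [InnerProductSpace ℝ E] [FiniteDimensional ℝ E] {A B : W →ₗ[ℝ] E}
    (hsym : ∀ w w', inner ℝ (A w) (B w') = inner ℝ (A w') (B w))
    (hinj : ∀ w, A w = 0 → B w = 0 → w = 0) :
    ∃ c : ℝ, Function.Injective (B - c • A) := by
  by_contra! hcon
  have h1 : ∀ c : ℝ, ∃ w, w ≠ 0 ∧ B w = c • A w := fun c => by
    have := hcon c
    rw [← LinearMap.ker_eq_bot, Submodule.eq_bot_iff] at this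
    push Not at this
    obtain ⟨w, hw, h0⟩ := this
    exact ⟨w, h0, by simpa [sub_eq_zero] using hw⟩
  choose w hw0 hw using h1
  have hA : ∀ c, A (w c) ≠ 0 := fun c h => hw0 c (hinj _ h (by rw [hw, h, smul_zero]))
  have hli : LinearIndependent ℝ (fun c => A (w c)) := by
    refine linearIndependent_of_ne_zero_of_inner_eq_zero hA fun c c' hcc => ?_
    have := hsym (w c) (w c')
    rw [hw, hw, inner_smul_right, inner_smul_right, real_inner_comm] at this
    have h2 : (c' - c) * inner ℝ (A (w c')) (A (w c)) = 0 := by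
      linarith
    rcases mul_eq_zero.1 h2 with h | h
    · exact absurd (sub_eq_zero.1 h).symm hcc
    · exact (real_inner_comm _ _).trans h
  have := hli.finite
  exact not_finite ℝ

/-- A quadratic form that is positive on ker A becomes positive definite after adding a large
multiple of ‖A w‖². On the unit sphere each vector has a suitable multiple, and compactness makes
one multiple work for all. -/
lemma exists_add_smul_pos {W E : Type*} [NormedAddCommGroup W] [NormedSpace ℝ W]
    [FiniteDimensional ℝ W] [NormedAddCommGroup E] [InnerProductSpace ℝ E]
    {A A' B B' : W →L[ℝ] E} (hpos : ∀ w, w ≠ 0 → A w = 0 → 0 < inner ℝ (B w) (A' w)) :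
    ∃ σ : ℝ, ∀ w, w ≠ 0 →
      0 < inner ℝ (B w) (A' w) - inner ℝ (B' w) (A w) + σ * ‖A w‖ ^ 2 := by
  let Q : W → ℝ := fun w => inner ℝ (B w) (A' w) - inner ℝ (B' w) (A w)
  have hQ : Continuous Q := by fun_prop
  have hcov : Metric.sphere (0 : W) 1 ⊆ ⋃ k : ℕ, {w | 0 < Q w + k * ‖A w‖ ^ 2} := by
    intro w hw
    have hw0 : w ≠ 0 := fun h => by simp [h] at hw
    rw [mem_iUnion]
    by_cases h : A w = 0
    · exact ⟨0, by simpa [Q, h] using hpos w hw0 h⟩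
    · have : 0 < ‖A w‖ ^ 2 := by positivity
      obtain ⟨k, hk⟩ := exists_nat_gt (-Q w / ‖A w‖ ^ 2)
      rw [div_lt_iff₀ this] at hk
      exact ⟨k, show 0 < Q w + k * ‖A w‖ ^ 2 by linarith⟩
  obtain ⟨k, hk⟩ := (isCompact_sphere (0 : W) 1).elim_directed_cover _
    (fun k => isOpen_lt continuous_const (hQ.add (by fun_prop))) hcov
    (directed_of_isDirected_le fun i j hij w hw => by
      change 0 < Q w + j * ‖A w‖ ^ 2
      have h1 : 0 < Q w + i * ‖A w‖ ^ 2 := hw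
      have h2 : (i : ℝ) ≤ j := by exact_mod_cast hij
      nlinarith [sq_nonneg ‖A w‖])
  refine ⟨k, fun w hw => ?_⟩
  have hn : 0 < ‖w‖ := norm_pos_iff.2 hw
  have h1 : 0 < Q (‖w‖⁻¹ • w) + k * ‖A (‖w‖⁻¹ • w)‖ ^ 2 := hk (by simp [norm_smul, hn.ne'])
  have h2 : Q (‖w‖⁻¹ • w) + k * ‖A (‖w‖⁻¹ • w)‖ ^ 2 =
      (‖w‖⁻¹) ^ 2 * (Q w + k * ‖A w‖ ^ 2) := by
    simp only [Q, map_smul, inner_smul_left, inner_smul_right, norm_smul, norm_inv, norm_norm,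
      conj_trivial]
    ring
  rw [h2] at h1
  exact pos_of_mul_pos_right h1 (by positivity)

variable {E Z : Type*} [NormedAddCommGroup E] [InnerProductSpace ℝ E] [FiniteDimensional ℝ E]
  [NormedAddCommGroup Z] [NormedSpace ℝ Z] [FiniteDimensional ℝ Z]

/-- Strict differentiability at `q₀` controls increments between two arbitrary nearby points. The
time derivative contributes at least `c'` times the time increment, half of which absorbs the
remainder; increments in `Z` cost at most `‖U₁‖ + c' / 2` times their norm. -/
lemma eventually_form_le {Z : Type*} [NormedAddCommGroup Z] [NormedSpace ℝ Z]
    {U : ℝ × Z → E →L[ℝ] E} {q₀ : ℝ × Z}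
    (hU : ContDiffAt ℝ 1 U q₀)
    (hpos : ∀ x, x ≠ 0 → 0 < inner ℝ (fderiv ℝ U q₀ (1, 0) x) x) :
    ∃ c K : ℝ, 0 < c ∧ 0 ≤ K ∧ ∀ᶠ p in 𝓝 q₀ ×ˢ 𝓝 q₀, p.1.1 ≤ p.2.1 → ∀ x : E,
      (c * (p.2.1 - p.1.1) - K * ‖p.2.2 - p.1.2‖) * ‖x‖ ^ 2 ≤
        inner ℝ (U p.2 x) x - inner ℝ (U p.1 x) x := by
  set U₁ := fderiv ℝ U q₀ with hU₁
  obtain ⟨c', hc', hle⟩ := (isCompact_sphere (0 : E) 1).exists_forall_le' (a := 0)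
    (f := fun x => inner ℝ (U₁ (1, 0) x) x) (by fun_prop)
    (fun x hx => hpos x fun h => by simp [h] at hx)
  have hle' : ∀ x, c' * ‖x‖ ^ 2 ≤ inner ℝ (U₁ (1, 0) x) x := by
    intro x
    by_cases hx : x = 0
    · simp [hx]
    have hn : 0 < ‖x‖ := norm_pos_iff.2 hx
    have h1 := hle (‖x‖⁻¹ • x) (by simp [norm_smul, hn.ne'])
    simp only [map_smul, inner_smul_left, inner_smul_right, conj_trivial] at h1
    rw [← mul_assoc] at h1
    calc c' * ‖x‖ ^ 2 ≤ (‖x‖⁻¹ * ‖x‖⁻¹ * inner ℝ (U₁ (1, 0) x) x) * ‖x‖ ^ 2 := by gcongr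
      _ = _ := by field_simp
  refine ⟨c' / 2, ‖U₁‖ + c' / 2, by positivity, by positivity, ?_⟩
  have hst := (hU.hasStrictFDerivAt (by norm_num)).isLittleO.bound (half_pos hc')
  rw [nhds_prod_eq] at hst
  have hst' := (Filter.tendsto_prod_swap (f := 𝓝 q₀) (g := 𝓝 q₀)).eventually hst
  filter_upwards [hst'] with p hp hle1 x
  obtain ⟨⟨t, z⟩, ⟨t', z'⟩⟩ := p
  simp only [Prod.swap_prod_mk, Prod.mk_sub_mk] at hp hle1 ⊢
  have hnorm : ‖((t' - t, z' - z) : ℝ × Z)‖ ≤ (t' - t) + ‖z' - z‖ := by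
    rw [Prod.norm_def, Real.norm_of_nonneg (by simpa using hle1)]
    exact max_le (by linarith [norm_nonneg (z' - z)]) (by linarith)
  have hsplit : U₁ (t' - t, z' - z) = (t' - t) • U₁ (1, 0) + U₁ (0, z' - z) := by
    rw [← map_smul, ← map_add]; simp
  have hR := (U (t', z') - U (t, z) - U₁ (t' - t, z' - z)).le_opNorm x
  have hin : |inner ℝ ((U (t', z') - U (t, z) - U₁ (t' - t, z' - z)) x) x| ≤
      (c' / 2 * ((t' - t) + ‖z' - z‖)) * ‖x‖ ^ 2 := by
    refine (abs_real_inner_le_norm _ _).trans ?_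
    calc _ ≤ (‖U (t', z') - U (t, z) - U₁ (t' - t, z' - z)‖ * ‖x‖) * ‖x‖ := by gcongr
      _ = ‖U (t', z') - U (t, z) - U₁ (t' - t, z' - z)‖ * ‖x‖ ^ 2 := by ring
      _ ≤ _ := by
        gcongr
        exact hp.trans (by gcongr)
  have hin2 : |inner ℝ (U₁ (0, z' - z) x) x| ≤ (‖U₁‖ * ‖z' - z‖) * ‖x‖ ^ 2 := by
    refine (abs_real_inner_le_norm _ _).trans ?_
    have h3 : ‖U₁ (0, z' - z)‖ ≤ ‖U₁‖ * ‖z' - z‖ := by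
      refine (U₁.le_opNorm _).trans ?_
      simp [Prod.norm_def]
    calc _ ≤ (‖U₁ (0, z' - z)‖ * ‖x‖) * ‖x‖ := by
          gcongr; exact (U₁ (0, z' - z)).le_opNorm x
      _ = ‖U₁ (0, z' - z)‖ * ‖x‖ ^ 2 := by ring
      _ ≤ _ := by gcongr
  have hmain : inner ℝ ((U (t', z') - U (t, z) - U₁ (t' - t, z' - z)) x) x =
      inner ℝ (U (t', z') x) x - inner ℝ (U (t, z) x) x -
        ((t' - t) * inner ℝ (U₁ (1, 0) x) x + inner ℝ (U₁ (0, z' - z) x) x) := by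
    rw [hsplit]
    simp only [sub_apply, add_apply, smul_apply, inner_sub_left, inner_add_left, inner_smul_left,
      conj_trivial]
  rw [hmain] at hin
  have h4 := mul_le_mul_of_nonneg_left (hle' x) (sub_nonneg.2 hle1)
  have h5 := abs_le.1 hin
  have h6 := abs_le.1 hin2
  nlinarith [h5.1, h6.1]

/-- A family of Lagrangian subspaces, presented by pairs `(A, B)`, which crosses the vertical
subspace `A = 0` positively, has its crossings counted by the index of symmetric operators. -/
theorem exists_isIndexFor_of_lagrangian {A B : ℝ × Z → (ℝ × Z) →L[ℝ] E} {q₀ : ℝ × Z}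
    (hdim : finrank ℝ (ℝ × Z) = finrank ℝ E)
    (hA : ContDiffAt ℝ 1 A q₀) (hB : ContDiffAt ℝ 1 B q₀)
    (hsym : ∀ᶠ q in 𝓝 q₀, ∀ w w', inner ℝ (A q w) (B q w') = inner ℝ (A q w') (B q w))
    (hinj : ∀ w, A q₀ w = 0 → B q₀ w = 0 → w = 0)
    (hpos : ∀ w, w ≠ 0 → A q₀ w = 0 → 0 < inner ℝ (B q₀ w) (fderiv ℝ A q₀ (1, 0) w)) :
    ∃ s ∈ 𝓝 q₀, ∃ κ, 0 ≤ κ ∧ ∃ m,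
      IsIndexFor s κ (fun q => finrank ℝ (LinearMap.ker (A q).toLinearMap)) m := by
  obtain ⟨c, hc⟩ := exists_injective_sub_smul (A := (A q₀).toLinearMap) (B := (B q₀).toLinearMap)
    hsym.self_of_nhds hinj
  obtain ⟨σ, hσ⟩ := exists_add_smul_pos (B' := fderiv ℝ B q₀ (1, 0)) hpos
  -- The constant `c` makes `C q₀` invertible. The part of the shift that is linear in time vanishes
  -- at `q₀`, but adds σ‖A w‖² to the time derivative of the form, turning positivity on ker A into
  -- positive definiteness.
  let C : ℝ × Z → (ℝ × Z) →L[ℝ] E := fun q => B q - (c + σ * (q.1 - q₀.1)) • A q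
  have hC : ContDiffAt ℝ 1 C q₀ := by
    have : ContDiffAt ℝ 1 (fun q : ℝ × Z => c + σ * (q.1 - q₀.1)) q₀ := by fun_prop
    exact hB.sub (this.smul hA)
  have hC0 : C q₀ = B q₀ - c • A q₀ := by simp [C]
  let e₀ : (ℝ × Z) ≃L[ℝ] E :=
    (LinearEquiv.ofInjectiveOfFinrankEq (C q₀).toLinearMap
      (by rw [hC0]; exact hc) hdim).toContinuousLinearEquiv
  have he₀ : (e₀ : (ℝ × Z) →L[ℝ] E) = C q₀ := ContinuousLinearMap.ext fun w => rfl
  have hinv : ∀ᶠ q in 𝓝 q₀, ∃ e : (ℝ × Z) ≃L[ℝ] E, (e : (ℝ × Z) →L[ℝ] E) = C q :=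
    hC.continuousAt.eventually (he₀ ▸ e₀.nhds)
  let U : ℝ × Z → E →L[ℝ] E := fun q => (A q).comp (C q).inverse
  have hU : ContDiffAt ℝ 1 U q₀ := by
    refine hA.clm_comp (ContDiffAt.comp (g := ContinuousLinearMap.inverse) q₀ ?_ hC)
    rw [← he₀]
    exact contDiffAt_map_inverse e₀
  have hUe : ∀ q, ∀ e : (ℝ × Z) ≃L[ℝ] E, (e : (ℝ × Z) →L[ℝ] E) = C q →
      ∀ w, U q (C q w) = A q w := fun q e he w => by
    simp only [U, ← he, ContinuousLinearMap.inverse_equiv, ContinuousLinearMap.comp_apply]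
    simp
  have hUs : ∀ᶠ q in 𝓝 q₀, (U q).toLinearMap.IsSymmetric := by
    filter_upwards [hinv, hsym] with q ⟨e, he⟩ hq y y'
    obtain ⟨w, rfl⟩ := e.surjective y
    obtain ⟨w', rfl⟩ := e.surjective y'
    have h1 : ∀ w, e w = C q w := fun w => by rw [← he]; rfl
    change inner ℝ (U q (e w)) (e w') = inner ℝ (e w) (U q (e w'))
    rw [h1, h1, hUe q e he, hUe q e he]
    simp only [C, sub_apply, smul_apply, inner_sub_left, inner_sub_right, inner_smul_left,
      inner_smul_right, conj_trivial]
    rw [hq w w', real_inner_comm (B q w) (A q w')]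
  have hUk : ∀ᶠ q in 𝓝 q₀, finrank ℝ (LinearMap.ker (A q).toLinearMap) = nullity (U q) := by
    filter_upwards [hinv] with q ⟨e, he⟩
    have h1 : LinearMap.ker (U q).toLinearMap =
        (LinearMap.ker (A q).toLinearMap).map (e.toLinearEquiv : (ℝ × Z) →ₗ[ℝ] E) := by
      ext y
      obtain ⟨w, rfl⟩ := e.surjective y
      have h1 : e w = C q w := by rw [← he]; rfl
      have h2 : U q (e w) = A q w := by rw [h1]; exact hUe q e he w
      rw [LinearMap.mem_ker]
      constructor
      · intro h
        exact ⟨w, by rw [SetLike.mem_coe, LinearMap.mem_ker]; exact h2.symm.trans h, rfl⟩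
      · rintro ⟨w', hw', h⟩
        have : w' = w := e.injective h
        subst this
        exact h2.trans hw'
    rw [nullity, h1, LinearEquiv.finrank_map_eq]
  have hUpos : ∀ x, x ≠ 0 → 0 < inner ℝ (fderiv ℝ U q₀ (1, 0) x) x := by
    intro x hx
    obtain ⟨w, rfl⟩ := e₀.surjective x
    have hw : w ≠ 0 := fun h => hx (by rw [h, map_zero])
    have h1 : ∀ w, e₀ w = C q₀ w := fun w => by rw [← he₀]; rfl
    have hdA := (hA.differentiableAt (by norm_num)).hasFDerivAt
    have hdB := (hB.differentiableAt (by norm_num)).hasFDerivAt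
    have hdU := (hU.differentiableAt (by norm_num)).hasFDerivAt
    have hds : HasFDerivAt (fun q : ℝ × Z => c + σ * (q.1 - q₀.1))
        (σ • ContinuousLinearMap.fst ℝ ℝ Z) q₀ :=
      ((hasFDerivAt_fst.sub_const _).const_mul σ).const_add c
    have hdC : HasFDerivAt C _ q₀ := hdB.sub (hds.smul hdA)
    have hUC : (fun q => (U q).comp (C q)) =ᶠ[𝓝 q₀] A := by
      filter_upwards [hinv] with q ⟨e, he⟩
      exact ContinuousLinearMap.ext fun w => hUe q e he w
    have hd := ((hdU.clm_comp hdC).congr_of_eventuallyEq hUC.symm).unique hdA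
    have hd1 := congrArg (fun T => T (1, 0) w) hd
    simp only [add_apply, ContinuousLinearMap.comp_apply, ContinuousLinearMap.compL_apply,
      ContinuousLinearMap.flip_apply, sub_apply, smul_apply,
      ContinuousLinearMap.smulRight_apply, ContinuousLinearMap.coe_fst', sub_self, mul_zero,
      add_zero, smul_eq_mul, mul_one] at hd1
    have hUw : U q₀ (C q₀ w) = A q₀ w := hUe q₀ e₀ he₀ w
    have hs0 := hUs.self_of_nhds
    set A' := fderiv ℝ A q₀ (1, 0)
    set B' := fderiv ℝ B q₀ (1, 0)
    set U' := fderiv ℝ U q₀ (1, 0)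
    -- This is the time derivative of the identity U C = A, solved for U'.
    have hd2 : U' (C q₀ w) = A' w - U q₀ (B' w - (c • A' w + σ • A q₀ w)) := by
      rw [eq_sub_iff_add_eq]
      refine Eq.trans ?_ hd1
      exact add_comm (U' (C q₀ w)) _
    have hs1 : ∀ y, inner ℝ (U q₀ y) (C q₀ w) = inner ℝ y (A q₀ w) := fun y => by
      rw [← hUw]; exact hs0 y _
    -- Symmetry of `U` moves it onto `C w` and produces `A w`; the terms with `c` cancel, and what
    -- remains is exactly the form made positive by the choice of `σ`.
    rw [h1, hd2, inner_sub_left, hs1]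
    have := hσ w hw
    rw [hC0]
    simp only [sub_apply, smul_apply, inner_sub_left, inner_add_left, inner_sub_right,
      inner_smul_left, inner_smul_right, conj_trivial]
    rw [real_inner_comm (B q₀ w) (A' w), real_inner_self_eq_norm_sq]
    linarith
  obtain ⟨c₁, K, hc₁, hK, hmono⟩ := eventually_form_le hU hUpos
  exact exists_isIndexFor ((hU.eventually (by simp)).mono fun q hq => hq.continuousAt) hUs hUk
    hc₁ hK hmono

end LagrangianFamily
end

noncomputable section

/-! ### Counting points with multiplicity. -/

section Counting

/-- The number of elements of `A`, each being counted with multiplicity `μ`. -/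
def weightedCard (μ : ℝ → ℕ) (A : Set ℝ) : ℕ∞ := Set.encard {q : ℝ × ℕ | q.1 ∈ A ∧ q.2 < μ q.1}

lemma weightedCard_mono (μ : ℝ → ℕ) {A B : Set ℝ} (h : A ⊆ B) :
    weightedCard μ A ≤ weightedCard μ B :=
  Set.encard_le_encard fun _ hq => ⟨h hq.1, hq.2⟩

lemma weightedCard_union (μ : ℝ → ℕ) {A B : Set ℝ} (h : Disjoint A B) :
    weightedCard μ (A ∪ B) = weightedCard μ A + weightedCard μ B := by
  rw [weightedCard, weightedCard, weightedCard, ← Set.encard_union_eq]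
  · congr 1
    ext q
    simp only [mem_ofPred_eq, mem_union]
    tauto
  · rw [Set.disjoint_left] at h ⊢
    exact fun q hq hq' => h hq.1 hq'.1

lemma weightedCard_Ioc_add (μ : ℝ → ℕ) {a b c : ℝ} (hab : a ≤ b) (hbc : b ≤ c) :
    weightedCard μ (Ioc a c) = weightedCard μ (Ioc a b) + weightedCard μ (Ioc b c) := by
  rw [← weightedCard_union, Ioc_union_Ioc_eq_Ioc hab hbc]
  exact Set.disjoint_left.2 fun x hx hx' => not_lt.2 hx.2 hx'.1

lemma weightedCard_eq_zero {μ : ℝ → ℕ} {A : Set ℝ} (h : ∀ t ∈ A, μ t = 0) :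
    weightedCard μ A = 0 := by
  rw [weightedCard, Set.encard_eq_zero, Set.eq_empty_iff_forall_notMem]
  rintro q ⟨hq, hq'⟩
  rw [h _ hq] at hq'
  exact Nat.not_lt_zero _ hq'

lemma weightedCard_eq_self {μ : ℝ → ℕ} {A : Set ℝ} {s : ℝ} (hs : s ∈ A)
    (h : ∀ t ∈ A, t ≠ s → μ t = 0) : weightedCard μ A = μ s := by
  have : {q : ℝ × ℕ | q.1 ∈ A ∧ q.2 < μ q.1} = (fun k => (s, k)) '' (Finset.range (μ s) : Set ℕ) := by
    ext ⟨t, k⟩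
    simp only [mem_ofPred_eq, mem_image, Finset.coe_range, mem_Iio, Prod.mk.injEq]
    constructor
    · rintro ⟨ht, hk⟩
      have : t = s := by
        by_contra hne
        rw [h t ht hne] at hk
        exact Nat.not_lt_zero _ hk
      subst this
      exact ⟨k, hk, rfl, rfl⟩
    · rintro ⟨k, hk, rfl, rfl⟩
      exact ⟨hs, hk⟩
  rw [weightedCard, this, Function.Injective.encard_image (fun _ _ h => (Prod.mk.inj h).2),
    Set.encard_coe_eq_coe_finsetCard, Finset.card_range]

/-- A locally constant function of the time, except for jumps down by `μ`, counts these jumps. -/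
lemma weightedCard_add_eq {μ m : ℝ → ℕ} {a b : ℝ} (hab : a ≤ b)
    (hr : ∀ s ∈ Icc a b, ∀ᶠ t in 𝓝[>] s, m t = m s ∧ μ t = 0)
    (hl : ∀ s ∈ Icc a b, ∀ᶠ t in 𝓝[<] s, m t = m s + μ s ∧ μ t = 0) :
    weightedCard μ (Ioc a b) + m b = m a := by
  -- Induction along the real interval: membership in `S` is constant on both sides of each time.
  -- The value `m s` is the one after the jump at `s`, which is why the count includes the right
  -- endpoint.
  let S : Set ℝ := {t | weightedCard μ (Ioc a t) + m t = m a}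
  have hright : ∀ s ∈ Icc a b, ∀ᶠ t in 𝓝[>] s, t ∈ S ↔ s ∈ S := by
    intro s hs
    obtain ⟨u, hu, hsub⟩ := (mem_nhdsGT_iff_exists_Ioo_subset).1 (hr s hs)
    filter_upwards [Ioo_mem_nhdsGT hu] with t ht
    have h0 : weightedCard μ (Ioc s t) = 0 := weightedCard_eq_zero fun r hr' =>
      (hsub (show r ∈ Ioo s u from ⟨hr'.1, hr'.2.trans_lt ht.2⟩)).2
    have h1 : m t = m s := (hsub ht).1
    simp only [S, mem_ofPred_eq, h1, weightedCard_Ioc_add μ hs.1 ht.1.le, h0, add_zero]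
  have hleft : ∀ s ∈ Icc a b, ∀ᶠ t in 𝓝[<] s, a ≤ t → (t ∈ S ↔ s ∈ S) := by
    intro s hs
    obtain ⟨u, hu, hsub⟩ := (mem_nhdsLT_iff_exists_Ioo_subset).1 (hl s hs)
    filter_upwards [Ioo_mem_nhdsLT hu] with t ht hat
    have h0 : weightedCard μ (Ioc t s) = μ s :=
      weightedCard_eq_self ⟨ht.2, le_rfl⟩ fun r hr' hne =>
        (hsub (show r ∈ Ioo u s from ⟨ht.1.trans hr'.1, lt_of_le_of_ne hr'.2 hne⟩)).2
    have h1 : m t = m s + μ s := (hsub ht).1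
    simp only [S, mem_ofPred_eq, h1, weightedCard_Ioc_add μ hat ht.2.le, h0, Nat.cast_add]
    rw [add_assoc, add_comm (m s : ℕ∞)]
  have hS : Icc a b ⊆ S := by
    refine IsClosed.Icc_subset_of_forall_exists_gt ?_ ?_ ?_
    · rw [← isOpen_compl_iff, isOpen_iff_mem_nhds]
      intro s hs
      by_cases hsI : s ∈ Icc a b
      · have hsS : s ∉ S := fun h => hs ⟨h, hsI⟩
        have h1 : ∀ᶠ t in 𝓝[>] s, t ∈ (S ∩ Icc a b)ᶜ := by
          filter_upwards [hright s hsI] with t ht hts using hsS (ht.1 hts.1)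
        have h2 : ∀ᶠ t in 𝓝[<] s, t ∈ (S ∩ Icc a b)ᶜ := by
          filter_upwards [hleft s hsI] with t ht hts using hsS ((ht hts.2.1).1 hts.1)
        have h3 : (S ∩ Icc a b)ᶜ ∈ 𝓝[≠] s := by
          rw [← Set.Iio_union_Ioi, nhdsWithin_union]
          exact ⟨h2, h1⟩
        exact mem_of_superset (insert_mem_nhds_iff.2 h3) (insert_subset hs subset_rfl)
      · exact mem_of_superset (isClosed_Icc.isOpen_compl.mem_nhds hsI) fun t ht h => ht h.2
    · simp [S, weightedCard_eq_zero]
    · rintro s ⟨hs, hsI⟩ y hy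
      obtain ⟨t, ht, ht'⟩ := ((hright s ⟨hsI.1, hsI.2.le⟩).and (Ioc_mem_nhdsGT hy)).exists
      exact ⟨t, ht.2 hs, ht'⟩
  exact hS ⟨hab, le_rfl⟩

/-- `t` is the `j`-th point of positive time, counted with multiplicity `μ`. -/
def IsJthPoint (μ : ℝ → ℕ) (j : ℕ) (t : ℝ) : Prop :=
  0 < μ t ∧ weightedCard μ (Ioo 0 t) < j ∧ j ≤ weightedCard μ (Ioc 0 t)

/-- Used both to bound a `j`-th point by a time at which the count has reached `j`, and, applied
twice, for its uniqueness. -/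
lemma IsJthPoint.le {μ : ℝ → ℕ} {j : ℕ} {s t : ℝ} (hs : IsJthPoint μ j s)
    (ht : j ≤ weightedCard μ (Ioc 0 t)) : s ≤ t := by
  by_contra! h
  exact absurd hs.2.1 (not_lt.2 (ht.trans (weightedCard_mono μ fun r hr => ⟨hr.1, hr.2.trans_lt h⟩)))

lemma exists_isJthPoint {μ : ℝ → ℕ} {j : ℕ} (hj : 1 ≤ j) {b : ℝ}
    (hfin : weightedCard μ (Ioc 0 b) ≠ ⊤) (hb : j ≤ weightedCard μ (Ioc 0 b)) :
    ∃ t ∈ Ioc 0 b, IsJthPoint μ j t := by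
  classical
  let F : Set ℝ := {t | t ∈ Ioc 0 b ∧ 0 < μ t}
  have hF : F.Finite := by
    have h1 : {q : ℝ × ℕ | q.1 ∈ Ioc 0 b ∧ q.2 < μ q.1}.Finite := Set.encard_ne_top_iff.1 hfin
    refine (h1.image Prod.fst).subset ?_
    rintro t ⟨ht, ht'⟩
    exact ⟨(t, 0), ⟨ht, ht'⟩, rfl⟩
  -- In an initial segment `A`, the largest point of positive multiplicity already carries the whole
  -- count of `A`. The claim is used for `Ioc 0 b`, and for `Ioo 0 t` to contradict the minimality
  -- of `t`.
  have key : ∀ A : Set ℝ, A ⊆ Ioc 0 b → (∀ x ∈ A, Ioc 0 x ⊆ A) → j ≤ weightedCard μ A →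
      ∃ t ∈ A, 0 < μ t ∧ j ≤ weightedCard μ (Ioc 0 t) := by
    intro A hA hA' hjA
    have hFA : (F ∩ A).Finite := hF.subset inter_subset_left
    have hne : (F ∩ A).Nonempty := by
      by_contra hemp
      rw [Set.not_nonempty_iff_eq_empty] at hemp
      have : weightedCard μ A = 0 := weightedCard_eq_zero fun t ht => by
        by_contra h0
        have : t ∈ F ∩ A := ⟨⟨hA ht, Nat.pos_of_ne_zero h0⟩, ht⟩
        rw [hemp] at this
        exact this
      rw [this] at hjA
      have : j ≤ 0 := by exact_mod_cast hjA
      omega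
    obtain ⟨t, ht, htmax⟩ := hFA.exists_maximalFor id _ hne
    refine ⟨t, ht.2, ht.1.2, hjA.trans (le_of_eq ?_)⟩
    have h1 : A = Ioc 0 t ∪ (A \ Ioc 0 t) := (union_sdiff_cancel (hA' t ht.2)).symm
    rw [h1, weightedCard_union μ disjoint_sdiff_self_right, weightedCard_eq_zero (A := A \ _),
      add_zero]
    rintro r ⟨hrA, hr⟩
    by_contra h0
    have hlt : t < r := by
      by_contra! h
      exact hr ⟨(hA hrA).1, h⟩
    have := htmax (j := r) ⟨⟨hA hrA, Nat.pos_of_ne_zero h0⟩, hrA⟩ hlt.le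
    exact absurd hlt (not_lt.2 this)
  let P : Set ℝ := {t ∈ F | j ≤ weightedCard μ (Ioc 0 t)}
  have hP : P.Finite := hF.subset (sep_subset _ _)
  have hPne : P.Nonempty := by
    obtain ⟨t, ht, h0, h1⟩ := key (Ioc 0 b) subset_rfl
      (fun x hx => Ioc_subset_Ioc_right hx.2) hb
    exact ⟨t, ⟨ht, h0⟩, h1⟩
  obtain ⟨t, ht, htmin⟩ := hP.exists_minimalFor id _ hPne
  refine ⟨t, ht.1.1, ht.1.2, ?_, ht.2⟩
  by_contra! hcon
  obtain ⟨r, hr, h0, h1⟩ := key (Ioo 0 t) (fun r hr => ⟨hr.1, hr.2.le.trans ht.1.1.2⟩)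
    (fun x hx y hy => ⟨hy.1, hy.2.trans_lt hx.2⟩) hcon
  have := htmin (j := r) ⟨⟨⟨hr.1, hr.2.le.trans ht.1.1.2⟩, h0⟩, h1⟩ hr.2.le
  exact absurd hr.2 (not_lt.2 this)

end Counting

/-! ### Behaviour of the index in time and across parameters. -/

section IndexCounting

variable {Z : Type*} [NormedAddCommGroup Z]

/-- Strict monotonicity gives m(t) + μ(t) ≤ m(r) for t > r, and lower semicontinuity gives m(r) ≤
m(t). -/
lemma IsIndexFor.eventually_right {s : Set (ℝ × Z)} {κ : ℝ} {μ m : ℝ × Z → ℕ}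
    (h : IsIndexFor s κ μ m) {r : ℝ} {ζ : Z} (hq : (r, ζ) ∈ s)
    (hev : ∀ᶠ t in 𝓝 r, (t, ζ) ∈ s) :
    ∀ᶠ t in 𝓝[>] r, m (t, ζ) = m (r, ζ) ∧ μ (t, ζ) = 0 := by
  have hc : Continuous fun t : ℝ => (t, ζ) := by fun_prop
  have h1 := (hc.tendsto r).eventually (h.lower _ hq)
  filter_upwards [nhdsWithin_le_nhds h1, nhdsWithin_le_nhds hev, self_mem_nhdsWithin] with t h1 h2 h3
  have := h.anti_strict _ hq _ h2 (by simpa using h3)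
  omega

/-- Strict monotonicity gives m(r) + μ(r) ≤ m(t) for t < r, and upper semicontinuity gives m(t) +
μ(t) ≤ m(r) + μ(r). -/
lemma IsIndexFor.eventually_left {s : Set (ℝ × Z)} {κ : ℝ} {μ m : ℝ × Z → ℕ}
    (h : IsIndexFor s κ μ m) {r : ℝ} {ζ : Z} (hq : (r, ζ) ∈ s)
    (hev : ∀ᶠ t in 𝓝 r, (t, ζ) ∈ s) :
    ∀ᶠ t in 𝓝[<] r, m (t, ζ) = m (r, ζ) + μ (r, ζ) ∧ μ (t, ζ) = 0 := by
  have hc : Continuous fun t : ℝ => (t, ζ) := by fun_prop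
  have h1 := (hc.tendsto r).eventually (h.upper _ hq)
  filter_upwards [nhdsWithin_le_nhds h1, nhdsWithin_le_nhds hev, self_mem_nhdsWithin] with t h1 h2 h3
  have := h.anti_strict _ h2 _ hq (by simpa using h3)
  omega

/-- Strictly inside the future cone of `q₀` lower semicontinuity leaves no room for a positive
multiplicity, and strictly inside its past cone upper semicontinuity leaves none. -/
lemma IsIndexFor.eventually_cone {s : Set (ℝ × Z)} {κ : ℝ} {μ m : ℝ × Z → ℕ}
    (h : IsIndexFor s κ μ m) {q₀ : ℝ × Z} (hs : s ∈ 𝓝 q₀) :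
    ∀ᶠ q in 𝓝 q₀, μ q ≠ 0 → |q.1 - q₀.1| ≤ κ * ‖q.2 - q₀.2‖ := by
  have hq₀ := mem_of_mem_nhds hs
  filter_upwards [hs, h.lower _ hq₀, h.upper _ hq₀] with q hq h1 h2 h3
  rw [abs_le]
  constructor
  · by_contra! hlt
    have := h.anti_strict q hq q₀ hq₀ (by rw [norm_sub_rev]; linarith)
    omega
  · by_contra! hlt
    have := h.anti_strict q₀ hq₀ q hq (by linarith)
    omega

end IndexCounting
end

noncomputable section

/-! ### Global counts along a characteristic and their dependence on the parameter. -/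

section IndexedFamily

variable {N Z : Type*} [TopologicalSpace N] [NormedAddCommGroup Z]

/-- A family, parametrized by `z ∈ N`, of multiplicity functions `μ z` of the time, which locally
are controlled by an index in the coordinates `ch z₀`. -/
structure IsIndexedFamily (dom : Set (ℝ × N)) (μ : N → ℝ → ℕ) (ch : N → N → Z) : Prop where
  continuousAt : ∀ z₀, ContinuousAt (ch z₀) z₀
  mem_of_le : ∀ z s t, (t, z) ∈ dom → 0 ≤ s → s ≤ t → (s, z) ∈ dom
  mem_of_ne_zero : ∀ z t, μ z t ≠ 0 → 0 < t ∧ (t, z) ∈ dom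
  start : ∀ z₀, ∃ δ > 0, ∀ᶠ z in 𝓝 z₀, ∀ t ∈ Ioo 0 δ, μ z t = 0
  index : ∀ t₀ z₀, 0 < t₀ → (t₀, z₀) ∈ dom → ∃ s ∈ 𝓝 (t₀, ch z₀ z₀), ∃ κ, 0 ≤ κ ∧ ∃ ν m,
    IsIndexFor s κ ν m ∧ ∀ᶠ q in 𝓝 (t₀, z₀), μ q.2 q.1 = ν (q.1, ch z₀ q.2)

variable {dom : Set (ℝ × N)} {μ : N → ℝ → ℕ} {ch : N → N → Z}

namespace IsIndexedFamily

lemma eventually_cone (h : IsIndexedFamily dom μ ch) {t₀ : ℝ} {z₀ : N} (h0 : μ z₀ t₀ ≠ 0) :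
    ∃ κ, ∀ᶠ q in 𝓝 (t₀, z₀), μ q.2 q.1 ≠ 0 → |q.1 - t₀| ≤ κ * ‖ch z₀ q.2 - ch z₀ z₀‖ := by
  obtain ⟨ht, hd⟩ := h.mem_of_ne_zero _ _ h0
  obtain ⟨s, hs, κ, hκ, ν, m, hi, hν⟩ := h.index t₀ z₀ ht hd
  have hc : ContinuousAt (fun q : ℝ × N => (q.1, ch z₀ q.2)) (t₀, z₀) :=
    continuousAt_fst.prodMk ((h.continuousAt z₀).comp (f := Prod.snd) continuousAt_snd)
  refine ⟨κ, ?_⟩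
  filter_upwards [hc.tendsto.eventually (hi.eventually_cone hs), hν] with q h1 h2 h3
  exact h1 (h2 ▸ h3)

/-- Repackages the local index on a product neighbourhood: monotonicity along cones, counts as
differences of the index, and local constancy in `z` at every time of the box other than `t₀`. -/
lemma exists_box (h : IsIndexedFamily dom μ ch) {t₀ : ℝ} {z₀ : N} (ht : 0 < t₀)
    (hd : (t₀, z₀) ∈ dom) :
    ∃ ε > 0, ε < t₀ ∧ ∃ V ∈ 𝓝 z₀, ∃ κ, 0 ≤ κ ∧ ∃ m : N → ℝ → ℕ,
      (∀ z ∈ V, ∀ z' ∈ V, ∀ t ∈ Ioo (t₀ - ε) (t₀ + ε), ∀ t' ∈ Ioo (t₀ - ε) (t₀ + ε),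
        t + κ * ‖ch z₀ z - ch z₀ z'‖ ≤ t' → m z' t' ≤ m z t) ∧
      (∀ z ∈ V, ∀ a ∈ Ioo (t₀ - ε) (t₀ + ε), ∀ b ∈ Ioo (t₀ - ε) (t₀ + ε), a ≤ b →
        weightedCard (μ z) (Ioc a b) + m z b = m z a) ∧
      ∀ a ∈ Ioo (t₀ - ε) (t₀ + ε), a ≠ t₀ → ∀ᶠ z in 𝓝 z₀, m z a = m z₀ a := by
  obtain ⟨s, hs, κ, hκ, ν, m, hi, hν⟩ := h.index t₀ z₀ ht hd
  have hc : ContinuousAt (fun q : ℝ × N => (q.1, ch z₀ q.2)) (t₀, z₀) :=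
    continuousAt_fst.prodMk ((h.continuousAt z₀).comp (f := Prod.snd) continuousAt_snd)
  have hev := (hc.tendsto.eventually (eventually_mem_set.2 hs)).and
    (hν.and (hc.tendsto.eventually (hi.eventually_cone hs)))
  rw [nhds_prod_eq, Filter.eventually_prod_iff] at hev
  obtain ⟨pa, ha, pb, hb, hab⟩ := hev
  obtain ⟨ε, hε, hball⟩ := Metric.eventually_nhds_iff_ball.1 ha
  have hsub : ∀ t ∈ Ioo (t₀ - min ε (t₀ / 2)) (t₀ + min ε (t₀ / 2)), pa t := fun t ht' => by
    refine hball t ?_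
    rw [Real.ball_eq_Ioo]
    exact ⟨by linarith [ht'.1, min_le_left ε (t₀ / 2)], by linarith [ht'.2, min_le_left ε (t₀ / 2)]⟩
  have hz₀ : pb z₀ := hb.self_of_nhds
  refine ⟨min ε (t₀ / 2), lt_min hε (by linarith), (min_le_right _ _).trans_lt (by linarith),
    {z | pb z}, hb, κ, hκ, fun z t => m (t, ch z₀ z), ?_, ?_, ?_⟩
  · intro z hz z' hz' t ht t' ht' hle
    refine hi.anti _ (hab (hsub t ht) hz).1 _ (hab (hsub t' ht') hz').1 ?_
    rwa [norm_sub_rev]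
  · intro z hz a haJ b hbJ hle
    have hJ : ∀ r ∈ Icc a b, r ∈ Ioo (t₀ - min ε (t₀ / 2)) (t₀ + min ε (t₀ / 2)) :=
      fun r hr => ⟨haJ.1.trans_le hr.1, hr.2.trans_lt hbJ.2⟩
    have hnear : ∀ r ∈ Icc a b, ∀ᶠ t in 𝓝 r, (t, ch z₀ z) ∈ s ∧ μ z t = ν (t, ch z₀ z) := by
      intro r hr
      filter_upwards [isOpen_Ioo.mem_nhds (hJ r hr)] with t ht
      exact ⟨(hab (hsub t ht) hz).1, (hab (hsub t ht) hz).2.1⟩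
    refine weightedCard_add_eq (μ := μ z) (m := fun t => m (t, ch z₀ z)) hle (fun r hr => ?_) (fun r hr => ?_)
    · filter_upwards [hi.eventually_right (hnear r hr).self_of_nhds.1
        ((hnear r hr).mono fun t h => h.1), nhdsWithin_le_nhds (hnear r hr)] with t h1 h2
      exact ⟨h1.1, h2.2.trans h1.2⟩
    · filter_upwards [hi.eventually_left (hnear r hr).self_of_nhds.1
        ((hnear r hr).mono fun t h => h.1), nhdsWithin_le_nhds (hnear r hr)] with t h1 h2
      rw [(hnear r hr).self_of_nhds.2]
      exact ⟨h1.1, h2.2.trans h1.2⟩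
  · intro a haJ hne
    obtain ⟨h1, h2, h3⟩ := hab (hsub a haJ) hz₀
    -- Over `z₀` itself the cone reduces to the time `t₀`, so `a ≠ t₀` has multiplicity zero. There
    -- the lower and the upper bound for the index of nearby `z` coincide.
    have hν0 : ν (a, ch z₀ z₀) = 0 := by
      by_contra hcon
      have := h3 hcon
      simp only [sub_self, norm_zero, mul_zero] at this
      exact hne (sub_eq_zero.1 (abs_nonpos_iff.1 this))
    have hca : ContinuousAt (fun z => (a, ch z₀ z)) z₀ :=
      continuousAt_const.prodMk (h.continuousAt z₀)
    filter_upwards [hca.tendsto.eventually (hi.lower _ h1),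
      hca.tendsto.eventually (hi.upper _ h1)] with z h4 h5
    omega

/-- The count up to a time `b` close to `τ` is finite and locally constant in `z`. -/
def StableAt (μ : N → ℝ → ℕ) (z₀ : N) (τ : ℝ) : Prop :=
  ∃ ε > 0, ∀ b, 0 ≤ b → |b - τ| < ε → b ≠ τ → weightedCard (μ z₀) (Ioc 0 b) ≠ ⊤ ∧
    ∀ᶠ z in 𝓝 z₀, weightedCard (μ z) (Ioc 0 b) = weightedCard (μ z₀) (Ioc 0 b)

lemma stableAt_zero (h : IsIndexedFamily dom μ ch) (z₀ : N) : StableAt μ z₀ 0 := by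
  obtain ⟨δ, hδ, hev⟩ := h.start z₀
  refine ⟨δ, hδ, fun b hb hbδ _ => ?_⟩
  have h1 : ∀ z, (∀ t ∈ Ioo 0 δ, μ z t = 0) → weightedCard (μ z) (Ioc 0 b) = 0 := fun z hz =>
    weightedCard_eq_zero fun t ht => hz t ⟨ht.1, ht.2.trans_lt (by
      rw [sub_zero] at hbδ; exact (le_abs_self b).trans_lt hbδ)⟩
  have h0 := h1 z₀ hev.self_of_nhds
  refine ⟨by simp [h0], ?_⟩
  filter_upwards [hev] with z hz
  rw [h1 z hz, h0]

/-- The count up to `b` is the stable count up to some `a` near `τ`, corrected by the count between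
`a` and `b`, which is a difference of indices. The radius `ε` does not depend on `τ`, so the set of
stable times is closed. -/
lemma stableAt_of_near (h : IsIndexedFamily dom μ ch) {z₀ : N} {t₀ : ℝ} (ht : 0 < t₀)
    (hd : (t₀, z₀) ∈ dom) :
    ∃ ε > 0, ∀ τ, 0 ≤ τ → |τ - t₀| < ε → StableAt μ z₀ τ → StableAt μ z₀ t₀ := by
  obtain ⟨ε, hε, hεt, V, hV, κ, hκ, m, -, hcount, hconst⟩ := h.exists_box ht hd
  refine ⟨ε, hε, fun τ hτ0 hτ ⟨η, hη, hst⟩ => ?_⟩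
  rw [abs_lt] at hτ
  -- The auxiliary time avoids `τ`, where stability asserts nothing, and `t₀`, where the index need
  -- not be locally constant in `z`.
  obtain ⟨a, haτ, hat, ha1, ha2, ha3⟩ : ∃ a, a ≠ τ ∧ a ≠ t₀ ∧ |a - τ| < η ∧
      a ∈ Ioo (t₀ - ε) (t₀ + ε) ∧ 0 ≤ a := by
    have h1 : ∀ᶠ a in 𝓝[>] τ, a ∈ Ioo (t₀ - ε) (t₀ + ε) :=
      nhdsWithin_le_nhds (Ioo_mem_nhds (by linarith) (by linarith))
    have h2 : ∀ᶠ a in 𝓝[>] τ, |a - τ| < η := by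
      refine nhdsWithin_le_nhds ?_
      have : Continuous fun a => |a - τ| := by fun_prop
      exact this.continuousAt.eventually_lt continuousAt_const (by simpa using hη)
    have h3 : ∀ᶠ a in 𝓝[>] τ, a ≠ t₀ := by
      by_cases hc : τ = t₀
      · rw [← hc]
        filter_upwards [self_mem_nhdsWithin] with a ha using ne_of_gt ha
      · exact nhdsWithin_le_nhds (isOpen_ne.mem_nhds hc)
    obtain ⟨a, h1, h2, h3, h4⟩ := (h1.and (h2.and (h3.and self_mem_nhdsWithin))).exists
    have h4' : τ < a := h4
    exact ⟨a, h4'.ne', h3, h2, h1, hτ0.trans h4'.le⟩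
  obtain ⟨hfin, heq⟩ := hst a ha3 ha1 haτ
  refine ⟨ε, hε, fun b hb hbt hne => ?_⟩
  have hbJ : b ∈ Ioo (t₀ - ε) (t₀ + ε) := by
    rw [abs_lt] at hbt
    exact ⟨by linarith, by linarith⟩
  have hz₀ := mem_of_mem_nhds hV
  have hcancel : ∀ {x y : ℕ∞} (k : ℕ), x + k = y + k → x = y := fun k hk =>
    (WithTop.add_right_inj (ENat.natCast_ne_top k)).1 hk
  have hsame : ∀ᶠ z in 𝓝 z₀, ∀ c d, (c = a ∧ d = b ∨ c = b ∧ d = a) → c ≤ d →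
      weightedCard (μ z) (Ioc c d) = weightedCard (μ z₀) (Ioc c d) := by
    filter_upwards [hV, hconst a ha2 hat, hconst b hbJ hne] with z hz hza hzb c d hcd hle
    rcases hcd with ⟨rfl, rfl⟩ | ⟨rfl, rfl⟩
    · refine hcancel (m z d) ?_
      rw [hcount z hz _ ha2 _ hbJ hle, hzb, hcount z₀ hz₀ _ ha2 _ hbJ hle, hza]
    · refine hcancel (m z d) ?_
      rw [hcount z hz _ hbJ _ ha2 hle, hza, hcount z₀ hz₀ _ hbJ _ ha2 hle, hzb]
  rcases le_total a b with hab | hba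
  · have hf : weightedCard (μ z₀) (Ioc a b) ≠ ⊤ := fun htop => by
      have := hcount z₀ hz₀ a ha2 b hbJ hab
      rw [htop, top_add] at this
      exact ENat.natCast_ne_top _ this.symm
    refine ⟨?_, ?_⟩
    · rw [weightedCard_Ioc_add _ ha3 hab]
      exact WithTop.add_ne_top.2 ⟨hfin, hf⟩
    · filter_upwards [heq, hsame] with z h1 h2
      rw [weightedCard_Ioc_add _ ha3 hab, weightedCard_Ioc_add _ ha3 hab, h1,
        h2 a b (Or.inl ⟨rfl, rfl⟩) hab]
  · have hf : weightedCard (μ z₀) (Ioc 0 b) ≠ ⊤ := ne_top_of_le_ne_top hfin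
      (weightedCard_mono _ (Ioc_subset_Ioc_right hba))
    refine ⟨hf, ?_⟩
    filter_upwards [heq, hsame] with z h1 h2
    have h3 := h2 b a (Or.inr ⟨rfl, rfl⟩) hba
    rw [weightedCard_Ioc_add _ hb hba, weightedCard_Ioc_add _ hb hba, h3] at h1
    rw [weightedCard_Ioc_add _ hb hba] at hfin
    exact (WithTop.add_right_inj (WithTop.add_ne_top.1 hfin).2).1 h1

/-- Stability propagates from time 0 along `[0, T]`: stable times form a closed set by
`stableAt_of_near`, and stability at `x` directly gives it at times slightly after `x`. -/
lemma stableAt (h : IsIndexedFamily dom μ ch) {z₀ : N} {T : ℝ} (hT : 0 ≤ T)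
    (hd : (T, z₀) ∈ dom) : StableAt μ z₀ T := by
  have hsub : Icc 0 T ⊆ {τ | 0 ≤ τ ∧ StableAt μ z₀ τ} := by
    refine IsClosed.Icc_subset_of_forall_exists_gt ?_ ⟨le_rfl, h.stableAt_zero z₀⟩ ?_
    · refine isClosed_of_closure_subset fun t₀ ht₀ => ?_
      have htI : t₀ ∈ Icc 0 T :=
        closure_minimal inter_subset_right isClosed_Icc ht₀
      rcases htI.1.eq_or_lt with h0 | h0
      · exact ⟨⟨htI.1, h0 ▸ h.stableAt_zero z₀⟩, htI⟩
      · obtain ⟨ε, hε, hnear⟩ := h.stableAt_of_near h0 (h.mem_of_le z₀ t₀ T hd h0.le htI.2)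
        obtain ⟨τ, hτ, hdist⟩ := Metric.mem_closure_iff.1 ht₀ ε hε
        rw [dist_comm, Real.dist_eq] at hdist
        exact ⟨⟨htI.1, hnear τ hτ.1.1 hdist hτ.1.2⟩, htI⟩
    · rintro x ⟨⟨hx0, ε, hε, hst⟩, hxI⟩ y hy
      have hy' : x < y := hy
      refine ⟨min y (x + ε / 2), (show _ ∧ _ from ⟨?_, ?_⟩), lt_min hy' (by linarith), min_le_left _ _⟩
      · exact hx0.trans (lt_min hy' (by linarith)).le
      · set w := min y (x + ε / 2) with hw
        have hxw : x < w := lt_min hy' (by linarith)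
        have hwe : w ≤ x + ε / 2 := min_le_right _ _
        refine ⟨min (w - x) (ε / 2), lt_min (by linarith) (by linarith), fun b hb hbw _ => ?_⟩
        have h1 := abs_lt.1 (hbw.trans_le (min_le_left _ _))
        have h2 := abs_lt.1 (hbw.trans_le (min_le_right _ _))
        refine hst b hb ?_ (by linarith : x < b).ne'
        rw [abs_lt]
        constructor <;> linarith
  exact (hsub ⟨hT, le_rfl⟩).2

/-- Slightly after `t` the count for `z₀` is finite and, as no `j`-th point exists, less than `j`;
by stability nearby `z` have the same count. The later time is needed because stability at `t` says
nothing about the count up to `t` itself. -/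
lemma lt_of_forall_not_isJthPoint (h : IsIndexedFamily dom μ ch) {j : ℕ} (hj : 1 ≤ j) {z₀ : N}
    (hz₀ : ∀ t, ¬ IsJthPoint (μ z₀) j t) {t : ℝ} (ht : 0 ≤ t) (hd : (t, z₀) ∈ dom) :
    ∀ᶠ z in 𝓝 z₀, ∀ s, IsJthPoint (μ z) j s → t < s := by
  obtain ⟨ε, hε, hst⟩ := h.stableAt ht hd
  obtain ⟨hfin, hev⟩ := hst (t + ε / 2) (by linarith) (by
    rw [add_sub_cancel_left, abs_of_pos (by linarith)]; linarith) (by linarith)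
  have hlt : weightedCard (μ z₀) (Ioc 0 (t + ε / 2)) < j := by
    by_contra! hcon
    obtain ⟨s, -, hs⟩ := exists_isJthPoint hj hfin hcon
    exact hz₀ s hs
  filter_upwards [hev] with z hz s hs
  by_contra! hle
  have := hs.2.2.trans (weightedCard_mono (μ z) (Ioc_subset_Ioc_right (by linarith : s ≤ t + ε / 2)))
  rw [hz] at this
  exact absurd hlt (not_lt.2 this)

/-- The `j`-th point depends on the parameter in a Lipschitz way. -/
theorem exists_lipschitz_isJthPoint (h : IsIndexedFamily dom μ ch) {j : ℕ} (hj : 1 ≤ j) {z₀ : N}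
    {t₀ : ℝ} (ht₀ : IsJthPoint (μ z₀) j t₀) :
    ∃ V ∈ 𝓝 z₀, ∃ κ : ℝ, (∀ z ∈ V, ∃ t, IsJthPoint (μ z) j t) ∧
      ∀ z ∈ V, ∀ z' ∈ V, ∀ t t', IsJthPoint (μ z) j t → IsJthPoint (μ z') j t' →
        |t - t'| ≤ κ * ‖ch z₀ z - ch z₀ z'‖ := by
  obtain ⟨hpos, hd⟩ := h.mem_of_ne_zero z₀ t₀ ht₀.1.ne'
  obtain ⟨ε, hε, hεt, V, hV, κ, hκ, m, hanti, hcount, hconst⟩ := h.exists_box hpos hd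
  obtain ⟨η, hη, hst⟩ := h.stableAt hpos.le hd
  set r := min ε η / 2 with hr
  have hr0 : 0 < r := by rw [hr]; have := lt_min hε hη; linarith
  have hrε : r < ε := by rw [hr]; have := lt_min hε hη; linarith [min_le_left ε η]
  have hrη : r < η := by rw [hr]; have := lt_min hε hη; linarith [min_le_right ε η]
  have haJ : t₀ - r ∈ Ioo (t₀ - ε) (t₀ + ε) := ⟨by linarith, by linarith⟩
  have hbJ : t₀ + r ∈ Ioo (t₀ - ε) (t₀ + ε) := ⟨by linarith, by linarith⟩
  have ha0 : 0 ≤ t₀ - r := by linarith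
  obtain ⟨hafin, haev⟩ := hst (t₀ - r) ha0 (by
    rw [sub_sub_cancel_left, abs_neg, abs_of_pos hr0]; exact hrη) (by linarith)
  obtain ⟨hbfin, hbev⟩ := hst (t₀ + r) (by linarith) (by
    rw [add_sub_cancel_left, abs_of_pos hr0]; exact hrη) (by linarith)
  have hma := hconst _ haJ (by linarith)
  have hca : weightedCard (μ z₀) (Ioc 0 (t₀ - r)) < j :=
    (weightedCard_mono _ (show Ioc 0 (t₀ - r) ⊆ Ioo 0 t₀ from fun s hs => ⟨hs.1, by linarith [hs.2]⟩)).trans_lt ht₀.2.1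
  have hcb : j ≤ weightedCard (μ z₀) (Ioc 0 (t₀ + r)) :=
    ht₀.2.2.trans (weightedCard_mono _ (Ioc_subset_Ioc_right (by linarith)))
  have hex : ∀ z, weightedCard (μ z) (Ioc 0 (t₀ + r)) = weightedCard (μ z₀) (Ioc 0 (t₀ + r)) →
      ∃ t, IsJthPoint (μ z) j t := fun z hz => by
    obtain ⟨t, -, ht⟩ := exists_isJthPoint hj (hz ▸ hbfin) (hz ▸ hcb)
    exact ⟨t, ht⟩
  refine ⟨_, Filter.inter_mem (Filter.inter_mem hV haev) (Filter.inter_mem hbev hma), κ, fun z hz => hex z hz.2.1, ?_⟩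
  -- One-sided estimate, later applied with the roles of `z` and `z'` exchanged. The common time `t₀
  -- - r` serves as the origin of the local counts: count and index there are the same for both
  -- parameters.
  have hone : ∀ z ∈ V, ∀ z' ∈ V,
      weightedCard (μ z) (Ioc 0 (t₀ - r)) = weightedCard (μ z₀) (Ioc 0 (t₀ - r)) →
      weightedCard (μ z') (Ioc 0 (t₀ - r)) = weightedCard (μ z₀) (Ioc 0 (t₀ - r)) →
      weightedCard (μ z') (Ioc 0 (t₀ + r)) = weightedCard (μ z₀) (Ioc 0 (t₀ + r)) →
      m z (t₀ - r) = m z₀ (t₀ - r) → m z' (t₀ - r) = m z₀ (t₀ - r) →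
      ∀ t t', IsJthPoint (μ z) j t → IsJthPoint (μ z') j t' →
        t' ≤ t + κ * ‖ch z₀ z - ch z₀ z'‖ := by
    intro z hz z' hz' e1 e2 e3 e4 e5 t t' ht ht'
    by_contra! hlt
    have hκ0 : 0 ≤ κ * ‖ch z₀ z - ch z₀ z'‖ := by positivity
    have hat : t₀ - r < t := by
      by_contra! hle
      have := ht.2.2.trans (weightedCard_mono _ (Ioc_subset_Ioc_right hle))
      rw [e1] at this
      exact absurd hca (not_lt.2 this)
    have htb : t' ≤ t₀ + r := ht'.le (e3 ▸ hcb)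
    set c := t + κ * ‖ch z₀ z - ch z₀ z'‖ with hc
    have hcJ : c ∈ Ioo (t₀ - ε) (t₀ + ε) := ⟨by linarith, by linarith⟩
    have htJ : t ∈ Ioo (t₀ - ε) (t₀ + ε) := ⟨by linarith, by linarith⟩
    -- The point `(c, z')` lies on the boundary of the future cone of `(t, z)`, so at least as many
    -- points of `z'` have occurred by time `c` as points of `z` by time `t`.
    have hm := hanti z hz z' hz' t htJ c hcJ le_rfl
    have c1 := hcount z hz _ haJ t htJ hat.le
    have c2 := hcount z' hz' _ haJ c hcJ (by linarith)
    have hle : weightedCard (μ z) (Ioc (t₀ - r) t) ≤ weightedCard (μ z') (Ioc (t₀ - r) c) := by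
      rw [e4, ← e5, ← c2] at c1
      refine (ENat.add_le_add_iff_right (ENat.natCast_ne_top (m z' c))).1 ?_
      rw [← c1]
      gcongr
    have hj' : j ≤ weightedCard (μ z') (Ioc 0 c) := by
      refine ht.2.2.trans ?_
      rw [weightedCard_Ioc_add _ ha0 hat.le, weightedCard_Ioc_add _ ha0 (by linarith : t₀ - r ≤ c),
        e1, e2]
      gcongr
    exact absurd (ht'.le hj') (not_le.2 hlt)
  intro z hz z' hz' t t' ht ht'
  rw [abs_le]
  have h1 := hone z hz.1.1 z' hz'.1.1 hz.1.2 hz'.1.2 hz'.2.1 hz.2.2 hz'.2.2 t t' ht ht'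
  have h2 := hone z' hz'.1.1 z hz.1.1 hz'.1.2 hz.1.2 hz.2.1 hz'.2.2 hz.2.2 t' t ht' ht
  rw [norm_sub_rev] at h2
  constructor <;> linarith

end IsIndexedFamily

end IndexedFamily
end

noncomputable section

namespace Finsler

/-! ### Charts of the tangent bundle and changes of coordinates. -/

section TangentChart

variable {n : ℕ} {M : Type*} [TopologicalSpace M]
  [ChartedSpace (EuclideanHalfSpace (n + 1)) M] [IsManifold (𝓡∂ (n + 1)) ∞ M]

local notation "E" => EuclideanSpace ℝ (Fin (n + 1))

/-- The chart of the tangent bundle induced by the chart of `M` at `p`. -/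
def tchart (p : M) : PartialEquiv (TangentBundle (𝓡∂ (n + 1)) M) (E × E) :=
  extChartAt (𝓡∂ (n + 1)).tangent (⟨p, 0⟩ : TangentBundle (𝓡∂ (n + 1)) M)

lemma tchart_eq (p : M) : tchart (n := n) p =
    (trivializationAt E (TangentSpace (𝓡∂ (n + 1)) : M → Type _) p).toPartialEquiv ≫
      (extChartAt (𝓡∂ (n + 1)) p).prod (PartialEquiv.refl E) :=
  FiberBundle.extChartAt (IB := 𝓡∂ (n + 1)) _

lemma mem_tchart_source {p : M} {u : TangentBundle (𝓡∂ (n + 1)) M} :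
    u ∈ (tchart p).source ↔ u.proj ∈ (chartAt (EuclideanHalfSpace (n + 1)) p).source := by
  rw [tchart, extChartAt_source]
  exact TangentBundle.mem_chart_source_iff _ _

lemma tchart_target (p : M) : (tchart (n := n) p).target =
    (extChartAt (𝓡∂ (n + 1)) p).target ×ˢ univ := by
  rw [tchart]
  refine (FiberBundle.extChartAt_target (IB := 𝓡∂ (n + 1)) _).trans ?_
  congr 1
  refine inter_eq_left.2 fun x hx => ?_
  have := (extChartAt (𝓡∂ (n + 1)) p).map_target hx
  rwa [extChartAt_source] at this

lemma tchart_fst (p : M) (u : TangentBundle (𝓡∂ (n + 1)) M) :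
    (tchart p u).1 = extChartAt (𝓡∂ (n + 1)) p u.proj := by
  rw [tchart_eq]
  rfl

lemma tchart_snd {p : M} {u : TangentBundle (𝓡∂ (n + 1)) M}
    (h : u.proj ∈ (chartAt (EuclideanHalfSpace (n + 1)) p).source) :
    (tchart p u).2 = mfderiv (𝓡∂ (n + 1)) 𝓘(ℝ, E) (extChartAt (𝓡∂ (n + 1)) p) u.proj u.2 := by
  rw [← TangentBundle.continuousLinearMapAt_trivializationAt h, tchart_eq]
  exact (congrFun (Bundle.Trivialization.coe_linearMapAt_of_mem (R := ℝ)
    (trivializationAt E (TangentSpace (𝓡∂ (n + 1)) : M → Type _) p) (b := u.proj) h) u.2).symm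

lemma tchart_symm_proj {p : M} {q : E × E} (h : q.1 ∈ (extChartAt (𝓡∂ (n + 1)) p).target) :
    ((tchart p).symm q).proj = (extChartAt (𝓡∂ (n + 1)) p).symm q.1 := by
  have hq : q ∈ (tchart p).target := by
    rw [tchart_target]; exact ⟨h, mem_univ _⟩
  have h1 := tchart_fst p ((tchart p).symm q)
  rw [(tchart p).right_inv hq] at h1
  rw [h1, (extChartAt (𝓡∂ (n + 1)) p).left_inv]
  rw [extChartAt_source]
  exact mem_tchart_source.1 ((tchart p).map_target hq)

lemma tchart_snd_eq_zero_iff {p : M} {u : TangentBundle (𝓡∂ (n + 1)) M}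
    (h : u.proj ∈ (chartAt (EuclideanHalfSpace (n + 1)) p).source) :
    (tchart p u).2 = 0 ↔ u.2 = 0 := by
  rw [tchart_snd h]
  have hinv := isInvertible_mfderiv_extChartAt (I := 𝓡∂ (n + 1)) (x := p) (y := u.proj)
    (by rwa [extChartAt_source])
  obtain ⟨e, he⟩ := hinv
  rw [← he]
  exact e.map_eq_zero_iff

lemma tchart_velocity {p : M} {γ : ℝ → M} {s : ℝ}
    (hγ : MDifferentiableAt 𝓘(ℝ, ℝ) (𝓡∂ (n + 1)) γ s)
    (h : γ s ∈ (chartAt (EuclideanHalfSpace (n + 1)) p).source) :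
    tchart p (velocity (n := n) γ s) = (extChartAt (𝓡∂ (n + 1)) p (γ s),
      deriv (fun σ => extChartAt (𝓡∂ (n + 1)) p (γ σ)) s) := by
  refine Prod.ext (tchart_fst _ _) ?_
  rw [tchart_snd h]
  have h1 := mfderiv_comp s (mdifferentiableAt_extChartAt (I := 𝓡∂ (n + 1)) h) hγ
  have h2 : deriv (fun σ => extChartAt (𝓡∂ (n + 1)) p (γ σ)) s =
      mfderiv 𝓘(ℝ, ℝ) 𝓘(ℝ, E) (extChartAt (𝓡∂ (n + 1)) p ∘ γ) s (1 : ℝ) := by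
    rw [mfderiv_eq_fderiv]
    rfl
  rw [h2, h1]
  rfl

lemma isOpen_tchart_source (p : M) : IsOpen (tchart (n := n) p).source :=
  isOpen_extChartAt_source _

lemma continuousAt_tchart {p : M} {u : TangentBundle (𝓡∂ (n + 1)) M}
    (h : u.proj ∈ (chartAt (EuclideanHalfSpace (n + 1)) p).source) :
    ContinuousAt (tchart p) u :=
  continuousAt_extChartAt' (mem_tchart_source.2 h)

lemma continuousOn_tchart_symm (p : M) :
    ContinuousOn (tchart (n := n) p).symm (tchart p).target :=
  continuousOn_extChartAt_symm _

/-- The interior of the domain of a chart. -/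
def chartInterior (p : M) : Set E := interior (extChartAt (𝓡∂ (n + 1)) p).target

lemma mem_interior_iff {p q : M} (h : q ∈ (chartAt (EuclideanHalfSpace (n + 1)) p).source) :
    q ∈ (𝓡∂ (n + 1)).interior M ↔ extChartAt (𝓡∂ (n + 1)) p q ∈ chartInterior (n := n) p :=
  ModelWithCorners.isInteriorPoint_iff_of_mem_atlas (n := ∞) (by simp) (chart_mem_atlas _ p) h

lemma chartInterior_subset (p : M) :
    chartInterior (n := n) p ⊆ (extChartAt (𝓡∂ (n + 1)) p).target := interior_subset

lemma isOpen_chartInterior (p : M) : IsOpen (chartInterior (n := n) p) := isOpen_interior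

/-- The change of coordinates between two charts. -/
def transition (p p' : M) (x : E) : E :=
  extChartAt (𝓡∂ (n + 1)) p' ((extChartAt (𝓡∂ (n + 1)) p).symm x)

/-- The part of the interior of the chart at `p` which is covered by the chart at `p'`. -/
def overlap (p p' : M) : Set E :=
  {x | x ∈ chartInterior (n := n) p ∧
    (extChartAt (𝓡∂ (n + 1)) p).symm x ∈ (chartAt (EuclideanHalfSpace (n + 1)) p').source}

lemma isOpen_overlap (p p' : M) : IsOpen (overlap (n := n) p p') := by
  have h := (continuousOn_extChartAt_symm (I := 𝓡∂ (n + 1)) p).mono (chartInterior_subset p)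
  exact h.isOpen_inter_preimage (isOpen_chartInterior p)
    (chartAt (EuclideanHalfSpace (n + 1)) p').open_source

lemma symm_mem_source {p : M} {x : E} (hx : x ∈ (extChartAt (𝓡∂ (n + 1)) p).target) :
    (extChartAt (𝓡∂ (n + 1)) p).symm x ∈ (chartAt (EuclideanHalfSpace (n + 1)) p).source := by
  rw [← extChartAt_source (I := 𝓡∂ (n + 1))]
  exact (extChartAt (𝓡∂ (n + 1)) p).map_target hx

lemma transition_mem_overlap {p p' : M} {x : E} (hx : x ∈ overlap (n := n) p p') :
    transition p p' x ∈ overlap (n := n) p' p := by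
  have hs := symm_mem_source (chartInterior_subset p hx.1)
  have hint : (extChartAt (𝓡∂ (n + 1)) p).symm x ∈ (𝓡∂ (n + 1)).interior M := by
    rw [mem_interior_iff hs, (extChartAt (𝓡∂ (n + 1)) p).right_inv (chartInterior_subset p hx.1)]
    exact hx.1
  refine ⟨(mem_interior_iff hx.2).1 hint, ?_⟩
  rw [transition, (extChartAt (𝓡∂ (n + 1)) p').left_inv (by rw [extChartAt_source]; exact hx.2)]
  exact hs

lemma contDiffAt_transition {p p' : M} {x : E} (hx : x ∈ overlap (n := n) p p') :
    ContDiffAt ℝ ∞ (transition (n := n) p p') x := by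
  have hs : (extChartAt (𝓡∂ (n + 1)) p).symm x ∈ (extChartAt (𝓡∂ (n + 1)) p').source := by
    rw [extChartAt_source]; exact hx.2
  have h := contDiffWithinAt_ext_coord_change (I := 𝓡∂ (n + 1)) (n := ∞) p' p (y := x)
    (by
      rw [PartialEquiv.trans_source]
      exact ⟨chartInterior_subset p hx.1, hs⟩)
  refine h.contDiffAt ?_
  exact mem_of_superset ((isOpen_chartInterior p).mem_nhds hx.1)
    ((chartInterior_subset p).trans (extChartAt_target_subset_range p))

/-- The fibre part of `tchart` is the derivative of the chart of `M`, so this is the chain rule for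
the change of coordinates. -/
lemma tchart_tchart_symm {p p' : M} {x v : E} (hx : x ∈ overlap (n := n) p p') :
    tchart p' ((tchart p).symm (x, v)) =
      (transition p p' x, fderiv ℝ (transition (n := n) p p') x v) := by
  set u := (tchart p).symm (x, v) with hu
  have hxt := chartInterior_subset p hx.1
  have hmem : (x, v) ∈ (tchart (n := n) p).target := by
    rw [tchart_target]; exact ⟨hxt, mem_univ _⟩
  have hproj : u.proj = (extChartAt (𝓡∂ (n + 1)) p).symm x := tchart_symm_proj hxt
  have hs : u.proj ∈ (chartAt (EuclideanHalfSpace (n + 1)) p).source := by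
    rw [hproj]; exact symm_mem_source hxt
  have hs' : u.proj ∈ (chartAt (EuclideanHalfSpace (n + 1)) p').source := by
    rw [hproj]; exact hx.2
  have heu : tchart p u = (x, v) := (tchart p).right_inv hmem
  have hex : extChartAt (𝓡∂ (n + 1)) p u.proj = x := by
    rw [← tchart_fst, heu]
  refine Prod.ext ?_ ?_
  · rw [tchart_fst, hproj]; rfl
  rw [tchart_snd hs']
  have hv : mfderiv (𝓡∂ (n + 1)) 𝓘(ℝ, E) (extChartAt (𝓡∂ (n + 1)) p) u.proj u.2 = v := by
    rw [← tchart_snd hs, heu]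
  have hev : extChartAt (𝓡∂ (n + 1)) p' =ᶠ[𝓝 u.proj]
      transition p p' ∘ extChartAt (𝓡∂ (n + 1)) p := by
    filter_upwards [(chartAt (EuclideanHalfSpace (n + 1)) p).open_source.mem_nhds hs] with y hy
    simp only [Function.comp, transition]
    rw [(extChartAt (𝓡∂ (n + 1)) p).left_inv (by rw [extChartAt_source]; exact hy)]
  have hd : MDifferentiableAt 𝓘(ℝ, E) 𝓘(ℝ, E) (transition (n := n) p p')
      (extChartAt (𝓡∂ (n + 1)) p u.proj) := by
    rw [hex]
    exact ((contDiffAt_transition hx).differentiableAt (by simp)).mdifferentiableAt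
  rw [hev.mfderiv_eq, mfderiv_comp u.proj hd (mdifferentiableAt_extChartAt hs), mfderiv_eq_fderiv]
  rw [← hv, ← hex]
  rfl

end TangentChart

end Finsler
end

noncomputable section

/-! ### Lagrangian mechanics in one chart, with positions in a half space. -/

namespace Lagrangian

variable {E : Type*} [NormedAddCommGroup E] [NormedSpace ℝ E]

/-- The derivative of `L (x, v)` in `v`, where `x` ranges over `H`. -/
def momentum (H : Set E) (L : E × E → ℝ) (q : E × E) : E →L[ℝ] ℝ :=
  (fderivWithin ℝ L (H ×ˢ univ) q).comp (ContinuousLinearMap.inr ℝ E E)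

/-- The derivative of `L (x, v)` in `x`, where `x` ranges over `H`. -/
def force (H : Set E) (L : E × E → ℝ) (q : E × E) : E →L[ℝ] ℝ :=
  (fderivWithin ℝ L (H ×ˢ univ) q).comp (ContinuousLinearMap.inl ℝ E E)

/-- The second derivative of `L (x, v)` in `v`. -/
def fiberHessian (H : Set E) (L : E × E → ℝ) (q : E × E) : E →L[ℝ] E →L[ℝ] ℝ :=
  (fderivWithin ℝ (momentum H L) (H ×ˢ univ) q).comp (ContinuousLinearMap.inr ℝ E E)

/-- The acceleration of the solutions of the Euler-Lagrange equation. -/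
def spray (H : Set E) (L : E × E → ℝ) (q : E × E) : E :=
  (fiberHessian H L q).inverse
    (force H L q - fderivWithin ℝ (momentum H L) (H ×ˢ univ) q (q.2, 0))

/-- The Euler-Lagrange equation as a vector field on the tangent space. -/
def sprayField (H : Set E) (L : E × E → ℝ) (q : E × E) : E × E := (q.2, spray H L q)

variable {H : Set E} {L : E × E → ℝ} {q : E × E}

lemma fderivWithin_apply_prod (a : E × E) :
    fderivWithin ℝ L (H ×ˢ univ) q a = force H L q a.1 + momentum H L q a.2 := by
  rw [force, momentum, ContinuousLinearMap.comp_apply, ContinuousLinearMap.comp_apply, ← map_add]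
  simp

lemma fderivWithin_momentum_apply (a : E × E) :
    fderivWithin ℝ (momentum H L) (H ×ˢ univ) q a =
      fderivWithin ℝ (momentum H L) (H ×ˢ univ) q (a.1, 0) + fiberHessian H L q a.2 := by
  rw [fiberHessian, ContinuousLinearMap.comp_apply, ← map_add]
  simp

lemma contDiffWithinAt_momentum (hH : UniqueDiffOn ℝ H) (hq : q.1 ∈ H)
    (hL : ContDiffWithinAt ℝ ∞ L (H ×ˢ univ) q) :
    ContDiffWithinAt ℝ ∞ (momentum H L) (H ×ˢ univ) q :=
  (hL.fderivWithin_right (hH.prod uniqueDiffOn_univ) (by simp) ⟨hq, mem_univ _⟩).clm_comp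
    contDiffWithinAt_const

lemma contDiffWithinAt_force (hH : UniqueDiffOn ℝ H) (hq : q.1 ∈ H)
    (hL : ContDiffWithinAt ℝ ∞ L (H ×ˢ univ) q) :
    ContDiffWithinAt ℝ ∞ (force H L) (H ×ˢ univ) q :=
  (hL.fderivWithin_right (hH.prod uniqueDiffOn_univ) (by simp) ⟨hq, mem_univ _⟩).clm_comp
    contDiffWithinAt_const

lemma isInvertible_fiberHessian [FiniteDimensional ℝ E]
    (hpos : ∀ a : E, a ≠ 0 → 0 < fiberHessian H L q a a) :
    (fiberHessian H L q).IsInvertible := by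
  have hinj : Function.Injective (fiberHessian H L q) := by
    rw [injective_iff_map_eq_zero]
    intro a ha
    by_contra h
    have := hpos a h
    rw [ha] at this
    simp at this
  let e₁ : (E →L[ℝ] ℝ) ≃ₗ[ℝ] (E →ₗ[ℝ] ℝ) := LinearMap.toContinuousLinearMap.symm
  have hdim : Module.finrank ℝ E = Module.finrank ℝ (E →L[ℝ] ℝ) := by
    rw [e₁.finrank_eq]
    exact (Subspace.dual_finrank_eq (K := ℝ) (V := E)).symm
  let e := (LinearEquiv.ofInjectiveOfFinrankEq (fiberHessian H L q).toLinearMap hinj hdim)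
  exact ⟨e.toContinuousLinearEquiv, by ext; rfl⟩

lemma contDiffWithinAt_sprayField [FiniteDimensional ℝ E] (hH : UniqueDiffOn ℝ H) (hq : q.1 ∈ H)
    (hL : ContDiffWithinAt ℝ ∞ L (H ×ˢ univ) q)
    (hpos : ∀ a : E, a ≠ 0 → 0 < fiberHessian H L q a a) :
    ContDiffWithinAt ℝ ∞ (sprayField H L) (H ×ˢ univ) q := by
  have hP := (contDiffWithinAt_momentum hH hq hL).fderivWithin_right
    (hH.prod uniqueDiffOn_univ) (m := ∞) (by simp) ⟨hq, mem_univ _⟩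
  have hinv : ContDiffWithinAt ℝ ∞ (fun q => (fiberHessian H L q).inverse) (H ×ˢ univ) q :=
    (isInvertible_fiberHessian hpos).contDiffAt_map_inverse.comp_contDiffWithinAt q
      (hP.clm_comp contDiffWithinAt_const)
  exact contDiffWithinAt_snd.prodMk (hinv.clm_apply ((contDiffWithinAt_force hH hq hL).sub
    (hP.clm_apply (contDiffWithinAt_snd.prodMk contDiffWithinAt_const))))

lemma hasFDerivAt_right (hq : q.1 ∈ H) (hL : DifferentiableWithinAt ℝ L (H ×ˢ univ) q) :
    HasFDerivAt (fun v => L (q.1, v)) (momentum H L q) q.2 := by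
  have h1 : HasFDerivAt (fun v : E => (q.1, v)) (ContinuousLinearMap.inr ℝ E E) q.2 :=
    (hasFDerivAt_const q.1 q.2).prodMk (hasFDerivAt_id q.2)
  exact hL.hasFDerivWithinAt.comp_hasFDerivAt q.2 h1 (Eventually.of_forall fun v => mk_mem_prod hq (mem_univ v))

lemma hasFDerivWithinAt_left (hL : DifferentiableWithinAt ℝ L (H ×ˢ univ) q) :
    HasFDerivWithinAt (fun x => L (x, q.2)) (force H L q) H q.1 := by
  have h1 : HasFDerivWithinAt (fun x : E => (x, q.2)) (ContinuousLinearMap.inl ℝ E E) H q.1 :=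
    ((hasFDerivAt_id q.1).prodMk (hasFDerivAt_const q.2 q.1)).hasFDerivWithinAt
  exact hL.hasFDerivWithinAt.comp q.1 h1 fun x hx => mk_mem_prod hx (mem_univ _)

lemma hasFDerivAt_momentum_right (hH : UniqueDiffOn ℝ H) (hq : q.1 ∈ H)
    (hL : ContDiffWithinAt ℝ ∞ L (H ×ˢ univ) q) :
    HasFDerivAt (fun v => momentum H L (q.1, v)) (fiberHessian H L q) q.2 := by
  have h1 : HasFDerivAt (fun v : E => (q.1, v)) (ContinuousLinearMap.inr ℝ E E) q.2 :=
    (hasFDerivAt_const q.1 q.2).prodMk (hasFDerivAt_id q.2)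
  exact ((contDiffWithinAt_momentum hH hq hL).differentiableWithinAt
    (by simp)).hasFDerivWithinAt.comp_hasFDerivAt q.2 h1
      (Eventually.of_forall fun v => mk_mem_prod hq (mem_univ v))

/-- Connects the convexity axiom of a Finsler metric, which is stated along lines in the fibre, with
the Hessian as a bilinear form. -/
lemma iteratedDeriv_two_eq (hH : UniqueDiffOn ℝ H) (hq : q.1 ∈ H)
    (hL : ∀ᶠ v in 𝓝 q.2, ContDiffWithinAt ℝ ∞ L (H ×ˢ univ) (q.1, v)) (a : E) :
    iteratedDeriv 2 (fun s : ℝ => L (q.1, q.2 + s • a)) 0 = fiberHessian H L q a a := by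
  have hline : ∀ s : ℝ, HasDerivAt (fun s : ℝ => q.2 + s • a) a s := fun s => by
    simpa using ((hasDerivAt_id s).smul_const a).const_add q.2
  have htend : Tendsto (fun s : ℝ => q.2 + s • a) (𝓝 0) (𝓝 q.2) := by
    simpa using (hline 0).continuousAt.tendsto
  have h1 : deriv (fun s : ℝ => L (q.1, q.2 + s • a)) =ᶠ[𝓝 0]
      fun s => momentum H L (q.1, q.2 + s • a) a := by
    filter_upwards [htend.eventually hL] with s hs
    exact ((hasFDerivAt_right (q := (q.1, q.2 + s • a)) hq
      (hs.differentiableWithinAt (by simp))).comp_hasDerivAt s (hline s)).deriv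
  rw [iteratedDeriv_succ, iteratedDeriv_one, h1.deriv_eq]
  have h2 := (hasFDerivAt_momentum_right hH hq hL.self_of_nhds).comp_hasDerivAt_of_eq
    (0 : ℝ) (hline 0) (by simp)
  have h3 := h2.clm_apply (hasDerivAt_const (0 : ℝ) a)
  simpa using h3.deriv

lemma prod_univ_mem_nhds (hq : q.1 ∈ interior H) : H ×ˢ (univ : Set E) ∈ 𝓝 q :=
  prod_mem_nhds (mem_interior_iff_mem_nhds.1 hq) univ_mem

lemma hasFDerivAt_of_mem_interior (hq : q.1 ∈ interior H)
    (hL : ContDiffWithinAt ℝ ∞ L (H ×ˢ univ) q) :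
    HasFDerivAt L (fderivWithin ℝ L (H ×ˢ univ) q) q :=
  ((hL.differentiableWithinAt (by simp)).hasFDerivWithinAt).hasFDerivAt (prod_univ_mem_nhds hq)

lemma hasFDerivAt_momentum (hH : UniqueDiffOn ℝ H) (hq : q.1 ∈ interior H)
    (hL : ContDiffWithinAt ℝ ∞ L (H ×ˢ univ) q) :
    HasFDerivAt (momentum H L) (fderivWithin ℝ (momentum H L) (H ×ˢ univ) q) q :=
  (((contDiffWithinAt_momentum hH (interior_subset hq) hL).differentiableWithinAt
    (by simp)).hasFDerivWithinAt).hasFDerivAt (prod_univ_mem_nhds hq)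

/-- The Euler-Lagrange equation, solved for the second derivative. -/
lemma hasDerivAt_momentum_iff [FiniteDimensional ℝ E] (hH : UniqueDiffOn ℝ H) {c : ℝ → E × E}
    {s : ℝ} {a : E} (hc : HasDerivAt c ((c s).2, a) s) (hs : (c s).1 ∈ interior H)
    (hL : ContDiffWithinAt ℝ ∞ L (H ×ˢ univ) (c s))
    (hpos : ∀ a : E, a ≠ 0 → 0 < fiberHessian H L (c s) a a) :
    HasDerivAt (fun τ => momentum H L (c τ)) (force H L (c s)) s ↔ a = spray H L (c s) := by
  have h1 : HasDerivAt (fun τ => momentum H L (c τ))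
      (fderivWithin ℝ (momentum H L) (H ×ˢ univ) (c s) ((c s).2, a)) s :=
    (hasFDerivAt_momentum hH hs hL).comp_hasDerivAt s hc
  rw [fderivWithin_momentum_apply] at h1
  have hinv := isInvertible_fiberHessian hpos
  have h2 : HasDerivAt (fun τ => momentum H L (c τ)) (force H L (c s)) s ↔
      fiberHessian H L (c s) a = force H L (c s) -
        fderivWithin ℝ (momentum H L) (H ×ˢ univ) (c s) ((c s).2, 0) := by
    rw [eq_sub_iff_add_eq']
    exact ⟨fun h => h1.unique h, fun h => h ▸ h1⟩
  rw [h2, spray]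
  obtain ⟨e, he⟩ := hinv
  rw [← he, ContinuousLinearMap.inverse_equiv]
  exact e.eq_symm_apply.symm

/-- Along a solution the derivative of momentum · velocity equals the derivative of `L`, while
homogeneity says that this pairing is 2 L. So the derivative of `L` equals its own double. -/
lemma hasDerivAt_energy_of_homogeneous {c : ℝ → E × E} {s : ℝ}
    (hc : HasDerivAt c (sprayField H L (c s)) s) (hs : (c s).1 ∈ interior H)
    (hL : ContDiffWithinAt ℝ ∞ L (H ×ˢ univ) (c s))
    (hEL : HasDerivAt (fun τ => momentum H L (c τ)) (force H L (c s)) s)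
    (hhom : ∀ᶠ τ in 𝓝 s, momentum H L (c τ) (c τ).2 = 2 * L (c τ)) :
    HasDerivAt (fun τ => L (c τ)) 0 s := by
  have h1 : HasDerivAt (fun τ => L (c τ)) (fderivWithin ℝ L (H ×ˢ univ) (c s)
      (sprayField H L (c s))) s := (hasFDerivAt_of_mem_interior hs hL).comp_hasDerivAt s hc
  have h2 : HasDerivAt (fun τ => momentum H L (c τ) (c τ).2)
      (force H L (c s) (c s).2 + momentum H L (c s) (spray H L (c s))) s := by
    have h3 : HasDerivAt (fun τ => (c τ).2) (spray H L (c s)) s := hc.snd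
    exact hEL.clm_apply h3
  have h3 : HasDerivAt (fun τ => 2 * L (c τ)) (2 * fderivWithin ℝ L (H ×ˢ univ) (c s)
      (sprayField H L (c s))) s := h1.const_mul 2
  have h4 := (h2.congr_of_eventuallyEq (hhom.mono fun _ h => h.symm)).unique h3
  rw [fderivWithin_apply_prod] at h4 h1
  simp only [sprayField] at h4 h1
  convert h1 using 1
  linarith

variable {Z : Type*} [NormedAddCommGroup Z] [NormedSpace ℝ Z] {ξ : ℝ × Z → E × E} {p : ℝ × Z}

/-- The time derivative of the position part of a variation field is its velocity part. -/
lemma hasDerivAt_fderiv_fst (hξ : ContDiffAt ℝ 2 ξ p)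
    (hvel : ∀ᶠ q in 𝓝 p, (fderiv ℝ ξ q (1, 0)).1 = (ξ q).2) (w : ℝ × Z) :
    HasDerivAt (fun t => (fderiv ℝ ξ (t, p.2) w).1) (fderiv ℝ ξ p w).2 p.1 := by
  have hline : HasDerivAt (fun t : ℝ => (t, p.2)) ((1, 0) : ℝ × Z) p.1 :=
    (hasDerivAt_id p.1).prodMk (hasDerivAt_const p.1 p.2)
  have hd : HasFDerivAt (fderiv ℝ ξ) (fderiv ℝ (fderiv ℝ ξ) p) p :=
    ((hξ.fderiv_right (m := 1) (by norm_num)).differentiableAt one_ne_zero).hasFDerivAt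
  -- Mixed derivatives commute, which exchanges the time derivative with the variation along `w`.
  have hsym : fderiv ℝ (fderiv ℝ ξ) p (1, 0) w = fderiv ℝ (fderiv ℝ ξ) p w (1, 0) :=
    (hξ.isSymmSndFDerivAt (by simp)).eq _ _
  let ev (w : ℝ × Z) : ((ℝ × Z) →L[ℝ] E × E) →L[ℝ] E :=
    (ContinuousLinearMap.fst ℝ E E).comp (ContinuousLinearMap.apply ℝ (E × E) w)
  have h1 : HasFDerivAt (fun q => ev (1, 0) (fderiv ℝ ξ q))
      ((ev (1, 0)).comp (fderiv ℝ (fderiv ℝ ξ) p)) p :=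
    (ev (1, 0)).hasFDerivAt.comp p hd
  have h2 : HasFDerivAt (fun q => ContinuousLinearMap.snd ℝ E E (ξ q))
      ((ContinuousLinearMap.snd ℝ E E).comp (fderiv ℝ ξ p)) p :=
    (ContinuousLinearMap.snd ℝ E E).hasFDerivAt.comp p
      (hξ.differentiableAt (by norm_num)).hasFDerivAt
  have h3 := DFunLike.congr_fun (h2.unique (h1.congr_of_eventuallyEq
    (hvel.mono fun _ h => h.symm))) w
  have h4 : HasDerivAt (fun t : ℝ => fderiv ℝ ξ (t, p.2)) (fderiv ℝ (fderiv ℝ ξ) p (1, 0)) p.1 :=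
    HasFDerivAt.comp_hasDerivAt (f := fun t : ℝ => (t, p.2)) p.1 hd hline
  have h5 : HasDerivAt (fun t : ℝ => ev w (fderiv ℝ ξ (t, p.2)))
      (ev w (fderiv ℝ (fderiv ℝ ξ) p (1, 0))) p.1 :=
    (ev w).hasFDerivAt.comp_hasDerivAt p.1 h4
  have h6 : ev w (fderiv ℝ (fderiv ℝ ξ) p (1, 0)) = (fderiv ℝ ξ p w).2 := by
    refine Eq.trans ?_ h3.symm
    exact congrArg Prod.fst hsym
  rw [h6] at h5
  exact h5

/-- Along a family of solutions of constant energy, the pairing of the momentum with a variation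
field is constant in time. -/
lemma hasDerivAt_momentum_fderiv (hξ : ContDiffAt ℝ 2 ξ p)
    (hvel : ∀ᶠ q in 𝓝 p, (fderiv ℝ ξ q (1, 0)).1 = (ξ q).2) (hint : (ξ p).1 ∈ interior H)
    (hL : ContDiffWithinAt ℝ ∞ L (H ×ˢ univ) (ξ p))
    (hEL : HasDerivAt (fun t => momentum H L (ξ (t, p.2))) (force H L (ξ p)) p.1)
    {k : ℝ} (hE : ∀ᶠ q in 𝓝 p, L (ξ q) = k) (w : ℝ × Z) :
    HasDerivAt (fun t => momentum H L (ξ (t, p.2)) (fderiv ℝ ξ (t, p.2) w).1) 0 p.1 := by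
  have h5 := hEL.clm_apply (hasDerivAt_fderiv_fst hξ hvel w)
  -- By the Euler-Lagrange equation the derivative is force · δx + momentum · δv, the variation of
  -- the energy along `w`, and the energy is constant.
  refine h5.congr_deriv ?_
  have h6 : HasFDerivAt (fun q => L (ξ q))
      ((fderivWithin ℝ L (H ×ˢ univ) (ξ p)).comp (fderiv ℝ ξ p)) p :=
    (hasFDerivAt_of_mem_interior hint hL).comp p
      (hξ.differentiableAt (by norm_num)).hasFDerivAt
  have h7 := DFunLike.congr_fun (h6.unique ((hasFDerivAt_const k p).congr_of_eventuallyEq hE)) w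
  rw [ContinuousLinearMap.comp_apply, fderivWithin_apply_prod] at h7
  exact h7

/-- If the momentum pulls back to an exact form, then the variations of position and momentum
span an isotropic space. -/
lemma fderiv_momentum_symm {x : ℝ × Z → E} {P : ℝ × Z → E →L[ℝ] ℝ} {h : ℝ × Z → ℝ}
    (hx : ContDiffAt ℝ 2 x p) (hP : DifferentiableAt ℝ P p) (hh : ContDiffAt ℝ 2 h p)
    (hG : ∀ᶠ q in 𝓝 p, ∀ w, P q (fderiv ℝ x q w) = fderiv ℝ h q w) (w w' : ℝ × Z) :
    fderiv ℝ P p w (fderiv ℝ x p w') = fderiv ℝ P p w' (fderiv ℝ x p w) := by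
  have hdx : HasFDerivAt (fderiv ℝ x) (fderiv ℝ (fderiv ℝ x) p) p :=
    ((hx.fderiv_right (m := 1) (by norm_num)).differentiableAt one_ne_zero).hasFDerivAt
  have hdh : HasFDerivAt (fderiv ℝ h) (fderiv ℝ (fderiv ℝ h) p) p :=
    ((hh.fderiv_right (m := 1) (by norm_num)).differentiableAt one_ne_zero).hasFDerivAt
  have hsx : fderiv ℝ (fderiv ℝ x) p w w' = fderiv ℝ (fderiv ℝ x) p w' w :=
    (hx.isSymmSndFDerivAt (by simp)).eq _ _
  have hsh : fderiv ℝ (fderiv ℝ h) p w w' = fderiv ℝ (fderiv ℝ h) p w' w :=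
    (hh.isSymmSndFDerivAt (by simp)).eq _ _
  -- This is the derivative of P · dx = dh. The second derivatives of `x` and `h` are symmetric and
  -- cancel upon exchanging `a` and `b`.
  have key : ∀ a b : ℝ × Z, P p (fderiv ℝ (fderiv ℝ x) p a b) + fderiv ℝ P p a (fderiv ℝ x p b) =
      fderiv ℝ (fderiv ℝ h) p a b := fun a b => by
    have h1 := hP.hasFDerivAt.clm_apply (hdx.clm_apply (hasFDerivAt_const b p))
    have h2 := hdh.clm_apply (hasFDerivAt_const b p)
    have h3 := (h1.congr_of_eventuallyEq (hG.mono fun q hq => (hq b).symm)).unique h2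
    simpa using DFunLike.congr_fun h3 a
  have h1 := key w w'
  have h2 := key w' w
  rw [hsx] at h1
  rw [hsh] at h1
  linarith

end Lagrangian
end

noncomputable section

namespace Finsler

open Lagrangian

/-! ### The energy of a Finsler metric in charts. -/

section Energy

variable {n : ℕ} {M : Type*} [TopologicalSpace M]
  [ChartedSpace (EuclideanHalfSpace (n + 1)) M] [IsManifold (𝓡∂ (n + 1)) ∞ M] (φ : Metric n M)

local notation "E" => EuclideanSpace ℝ (Fin (n + 1))

local notation "𝓗" => range (𝓡∂ (n + 1))

/-- The energy `φ²/2` in the chart of the tangent bundle at `p`. -/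
def Metric.energy (p : M) (q : E × E) : ℝ := φ.chartEnergy p q.1 q.2

/-- The coordinates of nonzero tangent vectors in the chart at `p`. -/
def stateDomain (p : M) : Set (E × E) := (extChartAt (𝓡∂ (n + 1)) p).target ×ˢ {0}ᶜ

variable {φ} {p : M} {q : EuclideanSpace ℝ (Fin (n + 1)) × EuclideanSpace ℝ (Fin (n + 1))}

lemma uniqueDiffOn_halfSpace : UniqueDiffOn ℝ (𝓗 : Set E) := (𝓡∂ (n + 1)).uniqueDiffOn

lemma target_subset_halfSpace (p : M) : (extChartAt (𝓡∂ (n + 1)) p).target ⊆ (𝓗 : Set E) :=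
  extChartAt_target_subset_range p

lemma chartInterior_subset_interior (p : M) :
    chartInterior (n := n) p ⊆ interior (𝓗 : Set E) :=
  interior_mono (target_subset_halfSpace p)

lemma tchart_mem_stateDomain {u : TangentBundle (𝓡∂ (n + 1)) M}
    (h : u.proj ∈ (chartAt (EuclideanHalfSpace (n + 1)) p).source) (h0 : u.2 ≠ 0) :
    tchart p u ∈ stateDomain (n := n) p := by
  refine ⟨?_, fun h' => h0 ((tchart_snd_eq_zero_iff h).1 h')⟩
  rw [tchart_fst]
  exact (extChartAt (𝓡∂ (n + 1)) p).map_source (by rwa [extChartAt_source])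

lemma stateDomain_subset_target : stateDomain (n := n) p ⊆ (tchart (n := n) p).target := by
  rw [tchart_target]
  exact fun q hq => ⟨hq.1, mem_univ _⟩

lemma tchart_symm_source (hq : q ∈ stateDomain (n := n) p) :
    ((tchart p).symm q).proj ∈ (chartAt (EuclideanHalfSpace (n + 1)) p).source :=
  (mem_tchart_source (n := n)).1 ((tchart p).map_target (stateDomain_subset_target hq))

lemma tchart_symm_ne_zero (hq : q ∈ stateDomain (n := n) p) : ((tchart p).symm q).2 ≠ 0 := by
  intro h
  rw [← tchart_snd_eq_zero_iff (tchart_symm_source hq),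
    (tchart p).right_inv (stateDomain_subset_target hq)] at h
  exact hq.2 h

lemma stateDomain_mem_nhdsWithin (hq : q ∈ stateDomain (n := n) p) :
    stateDomain (n := n) p ∈ 𝓝[𝓗 ×ˢ univ] q := by
  rw [stateDomain, nhdsWithin_prod_eq]
  refine prod_mem_prod (extChartAt_target_mem_nhdsWithin_of_mem hq.1) ?_
  rw [nhdsWithin_univ]
  exact isOpen_compl_singleton.mem_nhds hq.2

lemma energy_tchart {u : TangentBundle (𝓡∂ (n + 1)) M}
    (h : u.proj ∈ (chartAt (EuclideanHalfSpace (n + 1)) p).source) :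
    φ.energy p (tchart p u) = φ.toFun u ^ 2 / 2 := by
  have := (tchart p).left_inv (mem_tchart_source.2 h)
  rw [Metric.energy, Metric.chartEnergy]
  exact congrArg (fun u => φ.toFun u ^ 2 / 2) this

lemma contDiffWithinAt_energy (hq : q ∈ stateDomain (n := n) p) :
    ContDiffWithinAt ℝ ∞ (φ.energy p) (𝓗 ×ˢ univ) q := by
  have h1 : ContMDiffOn 𝓘(ℝ, E × E) (𝓡∂ (n + 1)).tangent ∞ (tchart p).symm (tchart p).target :=
    contMDiffOn_extChartAt_symm _
  have h2 : ContMDiffOn 𝓘(ℝ, E × E) 𝓘(ℝ, ℝ) ∞ (φ.toFun ∘ (tchart p).symm)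
      (stateDomain (n := n) p) :=
    φ.smooth.comp (h1.mono stateDomain_subset_target) fun q hq => tchart_symm_ne_zero hq
  have h3 := (contMDiffOn_iff_contDiffOn.1 h2) q hq
  have h4 : ContDiffWithinAt ℝ ∞ (φ.energy p) (stateDomain (n := n) p) q :=
    (h3.pow 2).div_const 2
  exact h4.mono_of_mem_nhdsWithin (stateDomain_mem_nhdsWithin hq)

/-- The chart of the tangent bundle is linear on the fibres. -/
lemma exists_tchart_symm_eq {x : E} (hx : x ∈ (extChartAt (𝓡∂ (n + 1)) p).target) :
    ∃ A : E ≃L[ℝ] TangentSpace (𝓡∂ (n + 1)) ((extChartAt (𝓡∂ (n + 1)) p).symm x),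
      ∀ v, (tchart p).symm (x, v) = ⟨(extChartAt (𝓡∂ (n + 1)) p).symm x, A v⟩ := by
  have hs := symm_mem_source hx
  obtain ⟨e, he⟩ := isInvertible_mfderiv_extChartAt (I := 𝓡∂ (n + 1)) (x := p)
    (y := (extChartAt (𝓡∂ (n + 1)) p).symm x) (by rwa [extChartAt_source])
  refine ⟨e.symm, fun v => ?_⟩
  set u : TangentBundle (𝓡∂ (n + 1)) M := ⟨(extChartAt (𝓡∂ (n + 1)) p).symm x, e.symm v⟩ with hu
  have h1 : tchart p u = (x, v) := by
    refine Prod.ext ?_ ?_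
    · rw [tchart_fst]
      exact (extChartAt (𝓡∂ (n + 1)) p).right_inv hx
    · rw [tchart_snd (by exact hs), ← he]
      exact e.apply_symm_apply v
  rw [← h1, (tchart p).left_inv (mem_tchart_source.2 hs), hu]
  rfl

lemma energy_smul {x v : E} (hx : x ∈ (extChartAt (𝓡∂ (n + 1)) p).target) {c : ℝ} (hc : 0 ≤ c) :
    φ.energy p (x, c • v) = c ^ 2 * φ.energy p (x, v) := by
  obtain ⟨A, hA⟩ := exists_tchart_symm_eq hx
  have h : ∀ v, φ.energy p (x, v) =
      φ.toFun ⟨(extChartAt (𝓡∂ (n + 1)) p).symm x, A v⟩ ^ 2 / 2 := fun v => by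
    rw [← hA]; rfl
  rw [h, h, map_smul, φ.homog _ _ _ hc]
  ring

lemma fiberHessian_pos (hq : q ∈ stateDomain (n := n) p) (a : E) (ha : a ≠ 0) :
    0 < fiberHessian 𝓗 (φ.energy p) q a a := by
  obtain ⟨A, hA⟩ := exists_tchart_symm_eq hq.1
  have h : ∀ v, φ.energy p (q.1, v) =
      φ.toFun ⟨(extChartAt (𝓡∂ (n + 1)) p).symm q.1, A v⟩ ^ 2 / 2 := fun v => by
    rw [← hA]; rfl
  have hev : ∀ᶠ v in 𝓝 q.2, ContDiffWithinAt ℝ ∞ (φ.energy p) (𝓗 ×ˢ univ) (q.1, v) := by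
    filter_upwards [isOpen_compl_singleton.mem_nhds hq.2] with v hv
    exact contDiffWithinAt_energy (show (q.1, v) ∈ stateDomain (n := n) p from ⟨hq.1, hv⟩)
  rw [← iteratedDeriv_two_eq uniqueDiffOn_halfSpace (target_subset_halfSpace p hq.1) hev]
  have h1 : (fun s : ℝ => φ.energy p (q.1, q.2 + s • a)) = fun s : ℝ => (1 / 2 : ℝ) *
      φ.toFun ⟨(extChartAt (𝓡∂ (n + 1)) p).symm q.1, A q.2 + s • A a⟩ ^ 2 := by
    funext s
    rw [h, map_add, map_smul]
    ring
  have h2 := φ.convex _ (A q.2) (A a) (fun h => hq.2 (A.map_eq_zero_iff.1 h))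
    (fun h => ha (A.map_eq_zero_iff.1 h))
  rw [h1]
  rw [iteratedDeriv_succ, iteratedDeriv_one] at h2 ⊢
  have h3 : (deriv fun s : ℝ => (1 / 2 : ℝ) *
      φ.toFun ⟨(extChartAt (𝓡∂ (n + 1)) p).symm q.1, A q.2 + s • A a⟩ ^ 2) = fun s =>
      (1 / 2 : ℝ) * deriv (fun s : ℝ =>
        φ.toFun ⟨(extChartAt (𝓡∂ (n + 1)) p).symm q.1, A q.2 + s • A a⟩ ^ 2) s := by
    funext s
    exact deriv_const_mul_field _
  rw [h3, deriv_const_mul_field]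
  positivity

/-- Euler's relation for a function homogeneous of degree two on the fibre. -/
lemma momentum_self (hq : q ∈ stateDomain (n := n) p) :
    momentum 𝓗 (φ.energy p) q q.2 = 2 * φ.energy p q := by
  have h1 : HasDerivAt (fun c : ℝ => c • q.2) q.2 1 := by
    simpa using (hasDerivAt_id (1 : ℝ)).smul_const q.2
  have h2 : HasDerivAt (fun c : ℝ => φ.energy p (q.1, c • q.2))
      (momentum 𝓗 (φ.energy p) q q.2) 1 :=
    (hasFDerivAt_right (target_subset_halfSpace p hq.1)
      ((contDiffWithinAt_energy hq).differentiableWithinAt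
        (by simp))).comp_hasDerivAt_of_eq (1 : ℝ) h1 (by simp)
  have h3 : HasDerivAt (fun c : ℝ => c ^ 2 * φ.energy p q) (2 * φ.energy p q) 1 := by
    simpa using (hasDerivAt_pow 2 (1 : ℝ)).mul_const (φ.energy p q)
  refine (h2.congr_of_eventuallyEq ?_).unique h3 |>.symm ▸ rfl
  filter_upwards [lt_mem_nhds (zero_lt_one' ℝ)] with c hc
  exact (energy_smul hq.1 hc.le).symm

/-- The coordinates of tangent vectors at `b` in the chart at `p`. -/
def tangentCoord (p b : M) : TangentSpace (𝓡∂ (n + 1)) b →L[ℝ] E :=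
  mfderiv (𝓡∂ (n + 1)) 𝓘(ℝ, E) (extChartAt (𝓡∂ (n + 1)) p) b

lemma tchart_mk {b : M} (hb : b ∈ (chartAt (EuclideanHalfSpace (n + 1)) p).source)
    (u : TangentSpace (𝓡∂ (n + 1)) b) :
    tchart p ⟨b, u⟩ = (extChartAt (𝓡∂ (n + 1)) p b, tangentCoord p b u) :=
  Prod.ext (tchart_fst _ _) (tchart_snd (u := ⟨b, u⟩) hb)

/-- With L = φ²/2 this is dL = φ dφ. The metric is recovered along the line as the square root of 2
L, which yields its differentiability as well as its derivative. -/
lemma dual_eq_momentum {b : M} (hb : b ∈ (chartAt (EuclideanHalfSpace (n + 1)) p).source)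
    {v : TangentSpace (𝓡∂ (n + 1)) b} (hv : v ≠ 0) (w : TangentSpace (𝓡∂ (n + 1)) b) :
    φ.dual v w = momentum 𝓗 (φ.energy p) (tchart p ⟨b, v⟩)
      (tangentCoord p b w) := by
  set x := extChartAt (𝓡∂ (n + 1)) p b with hx
  set D := tangentCoord (n := n) p b with hD
  have ht : ∀ u : TangentSpace (𝓡∂ (n + 1)) b, tchart p ⟨b, u⟩ = (x, D u) := tchart_mk hb
  have hmem : (x, D v) ∈ stateDomain (n := n) p := by
    rw [← ht]; exact tchart_mem_stateDomain (u := ⟨b, v⟩) hb hv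
  have hen : ∀ u : TangentSpace (𝓡∂ (n + 1)) b,
      φ.energy p (x, D u) = φ.toFun ⟨b, u⟩ ^ 2 / 2 := fun u => by
    rw [← ht]; exact energy_tchart (u := ⟨b, u⟩) hb
  have hline : HasDerivAt (fun s : ℝ => D v + s • D w) (D w) 0 := by
    simpa using ((hasDerivAt_id (0 : ℝ)).smul_const (D w)).const_add (D v)
  have h2 : HasDerivAt (fun s : ℝ => φ.energy p (x, D v + s • D w))
      (momentum 𝓗 (φ.energy p) (x, D v) (D w)) 0 :=
    (hasFDerivAt_right (q := (x, D v)) (target_subset_halfSpace p hmem.1)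
      ((contDiffWithinAt_energy hmem).differentiableWithinAt
        (by simp))).comp_hasDerivAt_of_eq (0 : ℝ) hline (by simp)
  have h3 : ∀ s : ℝ, φ.energy p (x, D v + s • D w) =
      φ.toFun ⟨b, v + s • w⟩ ^ 2 / 2 := fun s => by
    rw [← hen, map_add, map_smul]
  have hpos : 0 < φ.toFun ⟨b, v⟩ := φ.pos b v hv
  have hnn : ∀ u : TangentSpace (𝓡∂ (n + 1)) b, 0 ≤ φ.toFun ⟨b, u⟩ := fun u => by
    by_cases hu : u = 0
    · have := φ.homog b u 0 le_rfl
      rw [hu, smul_zero, zero_mul] at this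
      rw [hu, this]
    · exact (φ.pos b u hu).le
  have h4 : HasDerivAt (fun s : ℝ => φ.toFun ⟨b, v + s • w⟩)
      (2 * momentum 𝓗 (φ.energy p) (x, D v) (D w) / (2 * φ.toFun ⟨b, v⟩)) 0 := by
    have h5 := (h2.const_mul 2).sqrt (by
      rw [h3, zero_smul, add_zero]; positivity)
    have h6 : (fun s : ℝ => Real.sqrt (2 * φ.energy p (x, D v + s • D w))) =
        fun s => φ.toFun ⟨b, v + s • w⟩ := by
      funext s
      rw [h3, mul_div_cancel₀ _ two_ne_zero, Real.sqrt_sq (hnn _)]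
    rw [h6] at h5
    refine h5.congr_deriv ?_
    have h7 := congrFun h6 0
    rw [h7, zero_smul, add_zero]
  rw [Metric.dual, h4.deriv, ht]
  field_simp

lemma contDiffWithinAt_sprayField_energy (hq : q ∈ stateDomain (n := n) p) :
    ContDiffWithinAt ℝ ∞ (sprayField 𝓗 (φ.energy p)) (𝓗 ×ˢ univ) q :=
  contDiffWithinAt_sprayField uniqueDiffOn_halfSpace (target_subset_halfSpace p hq.1)
    (contDiffWithinAt_energy hq) (fiberHessian_pos hq)

end Energy

end Finsler
end

noncomputable section

namespace Finsler

open Lagrangian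

/-! ### Invariance of the Euler-Lagrange equation under changes of charts. -/

section ChartChange

variable {n : ℕ} {M : Type*} [TopologicalSpace M]
  [ChartedSpace (EuclideanHalfSpace (n + 1)) M] [IsManifold (𝓡∂ (n + 1)) ∞ M] {φ : Metric n M}

local notation "E" => EuclideanSpace ℝ (Fin (n + 1))

local notation "𝓗" => range (𝓡∂ (n + 1))

/-- The coordinates of nonzero tangent vectors at interior points in the chart at `p`. -/
def interiorState (p : M) : Set (E × E) := chartInterior (n := n) p ×ˢ {0}ᶜ

lemma isOpen_interiorState (p : M) : IsOpen (interiorState (n := n) p) :=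
  (isOpen_chartInterior p).prod isOpen_compl_singleton

lemma interiorState_subset (p : M) : interiorState (n := n) p ⊆ stateDomain (n := n) p :=
  prod_mono_left (chartInterior_subset p)

lemma fst_mem_interior {p : M} {q : E × E} (hq : q ∈ interiorState (n := n) p) :
    q.1 ∈ interior (𝓗 : Set E) := chartInterior_subset_interior p hq.1

lemma contDiffAt_sprayField_energy {p : M} {q : E × E} (hq : q ∈ interiorState (n := n) p) :
    ContDiffAt ℝ ∞ (sprayField 𝓗 (φ.energy p)) q :=
  (contDiffWithinAt_sprayField_energy (interiorState_subset p hq)).contDiffAt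
    (prod_univ_mem_nhds (fst_mem_interior hq))

lemma energy_transition {p p' : M} {x v : E} (hx : x ∈ overlap (n := n) p p') :
    φ.energy p (x, v) =
      φ.energy p' (transition p p' x, fderiv ℝ (transition (n := n) p p') x v) := by
  have hmem : (x, v) ∈ (tchart (n := n) p).target := by
    rw [tchart_target]; exact ⟨chartInterior_subset p hx.1, mem_univ _⟩
  have h1 : ((tchart p).symm (x, v)).proj ∈
      (chartAt (EuclideanHalfSpace (n + 1)) p').source := by
    rw [tchart_symm_proj (chartInterior_subset p hx.1)]; exact hx.2
  rw [← tchart_tchart_symm hx, energy_tchart h1]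
  rfl

lemma fderiv_transition_ne_zero {p p' : M} {x v : E} (hx : x ∈ overlap (n := n) p p')
    (hv : v ≠ 0) : fderiv ℝ (transition (n := n) p p') x v ≠ 0 := by
  intro h
  have hmem : (x, v) ∈ stateDomain (n := n) p := ⟨chartInterior_subset p hx.1, hv⟩
  have h1 : ((tchart p).symm (x, v)).proj ∈
      (chartAt (EuclideanHalfSpace (n + 1)) p').source := by
    rw [tchart_symm_proj (chartInterior_subset p hx.1)]; exact hx.2
  refine tchart_symm_ne_zero hmem ((tchart_snd_eq_zero_iff h1).1 ?_)
  rw [tchart_tchart_symm hx, h]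

/-- The lift of the change of coordinates to tangent vectors. -/
def tangentTransition (p p' : M) (q : E × E) : E × E :=
  (transition p p' q.1, fderiv ℝ (transition (n := n) p p') q.1 q.2)

lemma contDiffAt_tangentTransition {p p' : M} {q : E × E} (hq : q.1 ∈ overlap (n := n) p p') :
    ContDiffAt ℝ ∞ (tangentTransition (n := n) p p') q :=
  ((contDiffAt_transition hq).comp q contDiffAt_fst).prodMk
    ((((contDiffAt_transition hq).fderiv_right (m := ∞) (by simp)).comp q
      contDiffAt_fst).clm_apply contDiffAt_snd)

lemma tangentTransition_mem {p p' : M} {q : E × E} (hq : q ∈ interiorState (n := n) p)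
    (hx : q.1 ∈ overlap (n := n) p p') :
    tangentTransition p p' q ∈ interiorState (n := n) p' :=
  ⟨(transition_mem_overlap hx).1, fderiv_transition_ne_zero hx hq.2⟩

lemma fderiv_tangentTransition {p p' : M} {q : E × E} (hq : q.1 ∈ overlap (n := n) p p')
    (a b : E) : fderiv ℝ (tangentTransition (n := n) p p') q (a, b) =
      (fderiv ℝ (transition (n := n) p p') q.1 a,
        fderiv ℝ (fderiv ℝ (transition (n := n) p p')) q.1 a q.2 +
          fderiv ℝ (transition (n := n) p p') q.1 b) := by
  have h1 : HasFDerivAt (fun q : E × E => transition p p' q.1)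
      ((fderiv ℝ (transition (n := n) p p') q.1).comp (ContinuousLinearMap.fst ℝ E E)) q :=
    ((contDiffAt_transition hq).differentiableAt (by simp)).hasFDerivAt.comp q hasFDerivAt_fst
  have h2 : HasFDerivAt (fun q : E × E => fderiv ℝ (transition (n := n) p p') q.1)
      ((fderiv ℝ (fderiv ℝ (transition (n := n) p p')) q.1).comp
        (ContinuousLinearMap.fst ℝ E E)) q :=
    (((contDiffAt_transition hq).fderiv_right (m := ∞) (by simp)).differentiableAt
      (by simp)).hasFDerivAt.comp q hasFDerivAt_fst
  have h3 := h1.prodMk (h2.clm_apply (hasFDerivAt_snd (p := q)))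
  have h4 : fderiv ℝ (tangentTransition (n := n) p p') q = _ := h3.fderiv
  rw [h4]
  simp [add_comm]

/-- Derivative of `energy_transition`. Setting `a` or `b` to zero yields the transformation laws of
momentum and force. -/
lemma momentum_force_transition {p p' : M} {q : E × E} (hq : q ∈ interiorState (n := n) p)
    (hx : q.1 ∈ overlap (n := n) p p') (a b : E) :
    force 𝓗 (φ.energy p) q a + momentum 𝓗 (φ.energy p) q b =
      force 𝓗 (φ.energy p') (tangentTransition p p' q)
        (fderiv ℝ (transition (n := n) p p') q.1 a) +
      momentum 𝓗 (φ.energy p') (tangentTransition p p' q)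
        (fderiv ℝ (fderiv ℝ (transition (n := n) p p')) q.1 a q.2 +
          fderiv ℝ (transition (n := n) p p') q.1 b) := by
  have hq' := tangentTransition_mem hq hx
  have h1 := hasFDerivAt_of_mem_interior (fst_mem_interior hq)
    (contDiffWithinAt_energy (φ := φ) (interiorState_subset p hq))
  have h2 := (hasFDerivAt_of_mem_interior (fst_mem_interior hq')
    (contDiffWithinAt_energy (φ := φ) (interiorState_subset p' hq'))).comp q
      ((contDiffAt_tangentTransition hx).differentiableAt (by simp)).hasFDerivAt
  have hev : φ.energy p =ᶠ[𝓝 q] φ.energy p' ∘ tangentTransition (n := n) p p' := by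
    filter_upwards [continuous_fst.continuousAt.preimage_mem_nhds
      ((isOpen_overlap p p').mem_nhds hx)] with r hr
    exact energy_transition hr
  have h3 := DFunLike.congr_fun (h1.unique (h2.congr_of_eventuallyEq hev)) (a, b)
  rw [ContinuousLinearMap.comp_apply, fderiv_tangentTransition hx, fderivWithin_apply_prod,
    fderivWithin_apply_prod] at h3
  exact h3

lemma momentum_transition {p p' : M} {q : E × E} (hq : q ∈ interiorState (n := n) p)
    (hx : q.1 ∈ overlap (n := n) p p') :
    momentum 𝓗 (φ.energy p) q = (momentum 𝓗 (φ.energy p') (tangentTransition p p' q)).comp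
      (fderiv ℝ (transition (n := n) p p') q.1) := by
  refine ContinuousLinearMap.ext fun b => ?_
  have := momentum_force_transition (φ := φ) hq hx 0 b
  simpa using this

/-- The force is not a covector: the extra term with the second derivative of the change of
coordinates is the one produced by the product rule when the transformed momentum is differentiated
in time. -/
lemma force_transition {p p' : M} {q : E × E} (hq : q ∈ interiorState (n := n) p)
    (hx : q.1 ∈ overlap (n := n) p p') :
    force 𝓗 (φ.energy p) q = (force 𝓗 (φ.energy p') (tangentTransition p p' q)).comp
        (fderiv ℝ (transition (n := n) p p') q.1) +
      (momentum 𝓗 (φ.energy p') (tangentTransition p p' q)).comp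
        (fderiv ℝ (fderiv ℝ (transition (n := n) p p')) q.1 q.2) := by
  have hsym : ∀ a, fderiv ℝ (fderiv ℝ (transition (n := n) p p')) q.1 a q.2 =
      fderiv ℝ (fderiv ℝ (transition (n := n) p p')) q.1 q.2 a := fun a =>
    ((contDiffAt_transition hx).isSymmSndFDerivAt (by
      rw [minSmoothness_of_isRCLikeNormedField]; exact WithTop.coe_le_coe.2 le_top)).eq _ _
  refine ContinuousLinearMap.ext fun a => ?_
  have := momentum_force_transition (φ := φ) hq hx a 0
  simpa [hsym] using this

/-- The Euler-Lagrange equation does not depend on the chart. -/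
lemma hasDerivAt_momentum_transition {p p' : M} {c : ℝ → E × E} {s : ℝ}
    (hc : ∀ᶠ τ in 𝓝 s, c τ ∈ interiorState (n := n) p ∧ (c τ).1 ∈ overlap (n := n) p p')
    (hvel : HasDerivAt (fun τ => (c τ).1) (c s).2 s)
    (hEL : HasDerivAt (fun τ => momentum 𝓗 (φ.energy p') (tangentTransition p p' (c τ)))
      (force 𝓗 (φ.energy p') (tangentTransition p p' (c s))) s) :
    HasDerivAt (fun τ => momentum 𝓗 (φ.energy p) (c τ)) (force 𝓗 (φ.energy p) (c s)) s := by
  obtain ⟨hs, hx⟩ := hc.self_of_nhds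
  have h1 : HasDerivAt (fun τ => fderiv ℝ (transition (n := n) p p') (c τ).1)
      (fderiv ℝ (fderiv ℝ (transition (n := n) p p')) (c s).1 (c s).2) s :=
    (((contDiffAt_transition hx).fderiv_right (m := ∞) (by simp)).differentiableAt
      (by simp)).hasFDerivAt.comp_hasDerivAt s hvel
  have h2 := hEL.clm_comp h1
  rw [force_transition hs hx]
  exact h2.congr_of_eventuallyEq (hc.mono fun τ hτ => momentum_transition hτ.1 hτ.2)

end ChartChange

end Finsler
end

noncomputable section

namespace Finsler

open Lagrangian

/-! ### Geodesics as solutions of the spray equation. -/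

section Geodesics

variable {n : ℕ} {M : Type*} [TopologicalSpace M]
  [ChartedSpace (EuclideanHalfSpace (n + 1)) M]

local notation "E" => EuclideanSpace ℝ (Fin (n + 1))

local notation "𝓗" => range (𝓡∂ (n + 1))

lemma velocity_congr {γ γ' : ℝ → M} {s : ℝ} (h : γ =ᶠ[𝓝 s] γ') :
    velocity (n := n) γ s = velocity γ' s := by
  have h1 : ∀ (x y : M) (v w : E), x = y → v = w →
      (⟨x, v⟩ : TangentBundle (𝓡∂ (n + 1)) M) = ⟨y, w⟩ := by
    rintro x y v w rfl rfl; rfl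
  exact h1 _ _ _ _ h.self_of_nhds (congrArg (fun f : ℝ →L[ℝ] E => f 1)
    (h.mfderiv_eq (I := 𝓘(ℝ, ℝ)) (I' := 𝓡∂ (n + 1))))

/-- `γ` is twice differentiable with nonzero velocity at the time `s`, and in the interior. -/
structure IsRegularAt (γ : ℝ → M) (s : ℝ) : Prop where
  contMDiffAt : ContMDiffAt 𝓘(ℝ, ℝ) (𝓡∂ (n + 1)) 2 γ s
  interior : γ s ∈ (𝓡∂ (n + 1)).interior M
  velocity_ne : (velocity (n := n) γ s).2 ≠ 0

variable [IsManifold (𝓡∂ (n + 1)) ∞ M] {φ : Metric n M}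

/-- Position and velocity of `γ` in the chart at `p`. -/
def coordCurve (p : M) (γ : ℝ → M) (s : ℝ) : E × E := tchart p (velocity (n := n) γ s)

lemma IsRegularAt.coordCurve_mem {γ : ℝ → M} {s : ℝ} {p : M} (h : IsRegularAt (n := n) γ s)
    (hp : γ s ∈ (chartAt (EuclideanHalfSpace (n + 1)) p).source) :
    coordCurve p γ s ∈ interiorState (n := n) p := by
  refine ⟨?_, fun h0 => h.velocity_ne ((tchart_snd_eq_zero_iff hp).1 h0)⟩
  rw [coordCurve, tchart_fst]
  exact (mem_interior_iff hp).1 h.interior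

lemma IsRegularAt.eventually_mem_source {γ : ℝ → M} {s : ℝ} {p : M}
    (h : IsRegularAt (n := n) γ s)
    (hp : γ s ∈ (chartAt (EuclideanHalfSpace (n + 1)) p).source) :
    ∀ᶠ τ in 𝓝 s, γ τ ∈ (chartAt (EuclideanHalfSpace (n + 1)) p).source :=
  h.contMDiffAt.continuousAt.preimage_mem_nhds
    ((chartAt (EuclideanHalfSpace (n + 1)) p).open_source.mem_nhds hp)

lemma IsRegularAt.eventually_contMDiffAt {γ : ℝ → M} {s : ℝ} (h : IsRegularAt (n := n) γ s) :
    ∀ᶠ τ in 𝓝 s, ContMDiffAt 𝓘(ℝ, ℝ) (𝓡∂ (n + 1)) 2 γ τ := by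
  have : IsManifold (𝓡∂ (n + 1)) 2 M := IsManifold.of_le (n := ∞) (WithTop.coe_le_coe.2 le_top)
  exact (contMDiffAt_iff_contMDiffAt_nhds (by simp)).1 h.contMDiffAt

lemma IsRegularAt.coordCurve_eq {γ : ℝ → M} {s : ℝ} {p : M} (h : IsRegularAt (n := n) γ s)
    (hp : γ s ∈ (chartAt (EuclideanHalfSpace (n + 1)) p).source) :
    ∀ᶠ τ in 𝓝 s, coordCurve (n := n) p γ τ = (extChartAt (𝓡∂ (n + 1)) p (γ τ),
      deriv (fun σ => extChartAt (𝓡∂ (n + 1)) p (γ σ)) τ) := by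
  filter_upwards [h.eventually_contMDiffAt, h.eventually_mem_source hp] with τ h1 h2
  exact tchart_velocity (h1.mdifferentiableAt (by simp)) h2

lemma IsRegularAt.exists_hasDerivAt {γ : ℝ → M} {s : ℝ} {p : M} (h : IsRegularAt (n := n) γ s)
    (hp : γ s ∈ (chartAt (EuclideanHalfSpace (n + 1)) p).source) :
    ∃ a, HasDerivAt (coordCurve (n := n) p γ) ((coordCurve p γ s).2, a) s := by
  set y : ℝ → E := fun σ => extChartAt (𝓡∂ (n + 1)) p (γ σ) with hy
  have h1 : ContDiffAt ℝ 2 y s := by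
    have h2 : ContMDiffAt (𝓡∂ (n + 1)) 𝓘(ℝ, E) 2 (extChartAt (𝓡∂ (n + 1)) p) (γ s) :=
      (contMDiffAt_extChartAt' (n := ∞) hp).of_le (WithTop.coe_le_coe.2 le_top)
    exact (h2.comp s h.contMDiffAt).contDiffAt
  have h2 : HasDerivAt y (deriv y s) s := (h1.differentiableAt (by simp)).hasDerivAt
  have h3 : DifferentiableAt ℝ (deriv y) s :=
    (((h1.fderiv_right (m := 1) (by norm_num)).differentiableAt one_ne_zero).clm_apply
      (differentiableAt_const (1 : ℝ)))
  have heq := h.coordCurve_eq hp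
  refine ⟨deriv (deriv y) s, ?_⟩
  rw [heq.self_of_nhds]
  exact (h2.prodMk h3.hasDerivAt).congr_of_eventuallyEq heq

lemma IsRegularAt.eventually_coordCurve_mem {γ : ℝ → M} {s : ℝ} {p : M}
    (h : IsRegularAt (n := n) γ s)
    (hp : γ s ∈ (chartAt (EuclideanHalfSpace (n + 1)) p).source) :
    ∀ᶠ τ in 𝓝 s, coordCurve p γ τ ∈ interiorState (n := n) p :=
  (h.exists_hasDerivAt hp).choose_spec.continuousAt.preimage_mem_nhds
    ((isOpen_interiorState p).mem_nhds (h.coordCurve_mem hp))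

/-- The Euler-Lagrange equation in the chart at `p`, in terms of momentum and force. -/
lemma IsRegularAt.eulerLagrange_chart_iff {γ : ℝ → M} {s : ℝ} {p : M}
    (h : IsRegularAt (n := n) γ s)
    (hp : γ s ∈ (chartAt (EuclideanHalfSpace (n + 1)) p).source) :
    HasDerivAt
      (fun τ => fderiv ℝ (fun v => φ.chartEnergy p (extChartAt (𝓡∂ (n + 1)) p (γ τ)) v)
        (deriv (fun σ => extChartAt (𝓡∂ (n + 1)) p (γ σ)) τ))
      (fderivWithin ℝ (fun x => φ.chartEnergy p x
          (deriv (fun σ => extChartAt (𝓡∂ (n + 1)) p (γ σ)) s)) 𝓗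
        (extChartAt (𝓡∂ (n + 1)) p (γ s))) s ↔
    HasDerivAt (fun τ => momentum 𝓗 (φ.energy p) (coordCurve p γ τ))
      (force 𝓗 (φ.energy p) (coordCurve p γ s)) s := by
  have heq := h.coordCurve_eq hp
  have hmem := h.eventually_coordCurve_mem hp
  have hev : (fun τ => fderiv ℝ (fun v => φ.chartEnergy p (extChartAt (𝓡∂ (n + 1)) p (γ τ)) v)
        (deriv (fun σ => extChartAt (𝓡∂ (n + 1)) p (γ σ)) τ)) =ᶠ[𝓝 s]
      fun τ => momentum 𝓗 (φ.energy p) (coordCurve p γ τ) := by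
    filter_upwards [heq, hmem] with τ h1 h2
    have h3 := hasFDerivAt_right (L := φ.energy p) (interior_subset (fst_mem_interior h2))
      ((contDiffWithinAt_energy (interiorState_subset p h2)).differentiableWithinAt (by simp))
    rw [h1] at h3
    rw [h1]
    exact h3.fderiv
  have hforce : fderivWithin ℝ (fun x => φ.chartEnergy p x
          (deriv (fun σ => extChartAt (𝓡∂ (n + 1)) p (γ σ)) s)) 𝓗
        (extChartAt (𝓡∂ (n + 1)) p (γ s)) = force 𝓗 (φ.energy p) (coordCurve p γ s) := by
    have h2 := hmem.self_of_nhds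
    have h3 := hasFDerivWithinAt_left (L := φ.energy p)
      ((contDiffWithinAt_energy (interiorState_subset p h2)).differentiableWithinAt (by simp))
    have h4 : UniqueDiffWithinAt ℝ (𝓗 : Set E) (coordCurve p γ s).1 :=
      uniqueDiffOn_halfSpace _ (interior_subset (fst_mem_interior h2))
    have h1 := heq.self_of_nhds
    rw [h1] at h3 h4
    rw [h1]
    exact h3.fderivWithin h4
  rw [hforce]
  exact hev.hasDerivAt_iff

lemma IsRegularAt.momentum_iff {γ : ℝ → M} {s : ℝ} {p : M} (h : IsRegularAt (n := n) γ s)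
    (hp : γ s ∈ (chartAt (EuclideanHalfSpace (n + 1)) p).source) :
    HasDerivAt (fun τ => momentum 𝓗 (φ.energy p) (coordCurve p γ τ))
      (force 𝓗 (φ.energy p) (coordCurve p γ s)) s ↔
    HasDerivAt (coordCurve p γ) (sprayField 𝓗 (φ.energy p) (coordCurve p γ s)) s := by
  obtain ⟨a, ha⟩ := h.exists_hasDerivAt hp
  have hmem := h.coordCurve_mem hp
  rw [hasDerivAt_momentum_iff uniqueDiffOn_halfSpace ha (fst_mem_interior hmem)
    (contDiffWithinAt_energy (interiorState_subset p hmem))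
    (fiberHessian_pos (interiorState_subset p hmem)), sprayField]
  exact ⟨fun h => h ▸ ha, fun h => (Prod.ext_iff.1 (ha.unique h)).2⟩

lemma IsRegularAt.momentum_transition {γ : ℝ → M} {s : ℝ} {p p' : M}
    (h : IsRegularAt (n := n) γ s)
    (hp : γ s ∈ (chartAt (EuclideanHalfSpace (n + 1)) p).source)
    (hp' : γ s ∈ (chartAt (EuclideanHalfSpace (n + 1)) p').source)
    (hEL : HasDerivAt (fun τ => momentum 𝓗 (φ.energy p') (coordCurve p' γ τ))
      (force 𝓗 (φ.energy p') (coordCurve p' γ s)) s) :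
    HasDerivAt (fun τ => momentum 𝓗 (φ.energy p) (coordCurve p γ τ))
      (force 𝓗 (φ.energy p) (coordCurve p γ s)) s := by
  have hc : ∀ᶠ τ in 𝓝 s, coordCurve p γ τ ∈ interiorState (n := n) p ∧
      (coordCurve p γ τ).1 ∈ overlap (n := n) p p' ∧
      coordCurve p' γ τ = tangentTransition p p' (coordCurve (n := n) p γ τ) := by
    filter_upwards [h.eventually_coordCurve_mem hp, h.eventually_mem_source hp,
      h.eventually_mem_source hp'] with τ h1 h2 h3
    have h4 : (tchart p).symm (coordCurve p γ τ) = velocity (n := n) γ τ :=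
      (tchart p).left_inv (mem_tchart_source.2 h2)
    have h5 : (coordCurve p γ τ).1 ∈ overlap (n := n) p p' := by
      refine ⟨h1.1, ?_⟩
      rw [← tchart_symm_proj (q := coordCurve p γ τ) (chartInterior_subset p h1.1), h4]
      exact h3
    refine ⟨h1, h5, ?_⟩
    have h6 := tchart_tchart_symm (v := (coordCurve p γ τ).2) h5
    rw [Prod.mk.eta, h4] at h6
    exact h6
  obtain ⟨a, ha⟩ := h.exists_hasDerivAt hp
  have hvel : HasDerivAt (fun τ => (coordCurve p γ τ).1) (coordCurve p γ s).2 s := ha.fst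
  refine hasDerivAt_momentum_transition (p' := p') (hc.mono fun τ h => ⟨h.1, h.2.1⟩) hvel ?_
  rw [hc.self_of_nhds.2.2] at hEL
  refine hEL.congr_of_eventuallyEq ?_
  filter_upwards [hc] with τ hτ
  rw [hτ.2.2]

/-- Reduces a condition in all charts to a first order differential equation in a single chart, to
which the theory of ordinary differential equations applies. -/
lemma IsRegularAt.eulerLagrangeAt_iff {γ : ℝ → M} {s : ℝ} {p : M} (h : IsRegularAt (n := n) γ s)
    (hp : γ s ∈ (chartAt (EuclideanHalfSpace (n + 1)) p).source) :
    φ.EulerLagrangeAt γ s ↔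
      HasDerivAt (coordCurve p γ) (sprayField 𝓗 (φ.energy p) (coordCurve p γ s)) s := by
  rw [← h.momentum_iff hp]
  exact ⟨fun hEL => (h.eulerLagrange_chart_iff hp).1 (hEL p hp), fun hEL p' hp' =>
    (h.eulerLagrange_chart_iff hp').2 (h.momentum_transition hp' hp hEL)⟩

end Geodesics

end Finsler
end

noncomputable section

namespace Finsler

open Lagrangian

/-! ### Uniqueness of geodesics, in the interior and from the boundary. -/

section Uniqueness

variable {n : ℕ} {M : Type*} [TopologicalSpace M]
  [ChartedSpace (EuclideanHalfSpace (n + 1)) M] [IsManifold (𝓡∂ (n + 1)) ∞ M] {φ : Metric n M}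

local notation "E" => EuclideanSpace ℝ (Fin (n + 1))

local notation "𝓗" => range (𝓡∂ (n + 1))

variable (φ) in
/-- `γ` is a geodesic in the interior of `M` at the times in `J`. -/
def Metric.IsGeodesicOn (γ : ℝ → M) (J : Set ℝ) : Prop :=
  ∀ s ∈ J, IsRegularAt (n := n) γ s ∧ φ.EulerLagrangeAt γ s

lemma IsRegularAt.congr {γ γ' : ℝ → M} {s : ℝ} (h : IsRegularAt (n := n) γ s)
    (he : γ' =ᶠ[𝓝 s] γ) : IsRegularAt (n := n) γ' s :=
  ⟨h.contMDiffAt.congr_of_eventuallyEq he, he.self_of_nhds ▸ h.interior,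
    by rw [velocity_congr he]; exact h.velocity_ne⟩

lemma coordCurve_congr {γ γ' : ℝ → M} {s : ℝ} (p : M) (he : γ' =ᶠ[𝓝 s] γ) :
    coordCurve (n := n) p γ' =ᶠ[𝓝 s] coordCurve p γ := by
  filter_upwards [he.eventually_nhds] with τ hτ
  rw [coordCurve, coordCurve, velocity_congr hτ]

lemma eulerLagrangeAt_congr {γ γ' : ℝ → M} {s : ℝ} (h : IsRegularAt (n := n) γ s)
    (hEL : φ.EulerLagrangeAt γ s) (he : γ' =ᶠ[𝓝 s] γ) : φ.EulerLagrangeAt γ' s := by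
  have hp := mem_chart_source (EuclideanHalfSpace (n + 1)) (γ s)
  have hp' : γ' s ∈ (chartAt (EuclideanHalfSpace (n + 1)) (γ s)).source := by
    rw [he.self_of_nhds]; exact hp
  have hc := coordCurve_congr (n := n) (γ s) he
  rw [(h.congr he).eulerLagrangeAt_iff hp', hc.self_of_nhds]
  exact ((h.eulerLagrangeAt_iff hp).1 hEL).congr_of_eventuallyEq hc

lemma Metric.IsGeodesicOn.congr {γ γ' : ℝ → M} {J : Set ℝ} (hJ : IsOpen J)
    (h : φ.IsGeodesicOn γ J) (he : EqOn γ' γ J) : φ.IsGeodesicOn γ' J := fun s hs =>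
  have he' : γ' =ᶠ[𝓝 s] γ := he.eventuallyEq_of_mem (hJ.mem_nhds hs)
  ⟨(h s hs).1.congr he', eulerLagrangeAt_congr (h s hs).1 (h s hs).2 he'⟩

lemma Metric.IsGeodesicOn.hasDerivAt {γ : ℝ → M} {J : Set ℝ} (h : φ.IsGeodesicOn γ J) {s : ℝ}
    (hs : s ∈ J) {p : M} (hp : γ s ∈ (chartAt (EuclideanHalfSpace (n + 1)) p).source) :
    HasDerivAt (coordCurve p γ) (sprayField 𝓗 (φ.energy p) (coordCurve p γ s)) s :=
  ((h s hs).1.eulerLagrangeAt_iff hp).1 (h s hs).2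

lemma Metric.IsGeodesicFrom.isGeodesicOn {u : TangentBundle (𝓡∂ (n + 1)) M} {T : ℝ} {γ : ℝ → M}
    (h : φ.IsGeodesicFrom u T γ) : φ.IsGeodesicOn γ (Ioo 0 T) := fun s hs =>
  ⟨⟨h.smooth.contMDiffAt (isOpen_Ioo.mem_nhds hs), h.interior s hs, h.velocity_ne s hs⟩,
    h.geodesic s hs⟩

lemma Metric.IsGeodesicOn.isGeodesicFrom {u : TangentBundle (𝓡∂ (n + 1)) M} {T : ℝ} {γ : ℝ → M}
    (h : φ.IsGeodesicOn γ (Ioo 0 T)) (h0 : Tendsto (velocity (n := n) γ) (𝓝[>] 0) (𝓝 u)) :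
    φ.IsGeodesicFrom u T γ :=
  ⟨fun s hs => (h s hs).1.interior, fun s hs => (h s hs).1.contMDiffAt.contMDiffWithinAt,
    fun s hs => (h s hs).1.velocity_ne, fun s hs => (h s hs).2, h0⟩

/-- A solution of the spray equation in a chart is a geodesic. -/
lemma isGeodesicOn_of_chart {p : M} {c : ℝ → E × E} {J : Set ℝ} (hJ : IsOpen J)
    (hc : ∀ s ∈ J, HasDerivAt c (sprayField 𝓗 (φ.energy p) (c s)) s ∧
      c s ∈ interiorState (n := n) p) :
    φ.IsGeodesicOn (fun s => (extChartAt (𝓡∂ (n + 1)) p).symm (c s).1) J ∧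
      ∀ s ∈ J, velocity (n := n) (fun s => (extChartAt (𝓡∂ (n + 1)) p).symm (c s).1) s =
        (tchart p).symm (c s) := by
  set γ : ℝ → M := fun s => (extChartAt (𝓡∂ (n + 1)) p).symm (c s).1 with hγ
  have hderiv : ∀ s ∈ J, deriv c s = sprayField 𝓗 (φ.energy p) (c s) := fun s hs =>
    (hc s hs).1.deriv
  have hcd : ContDiffOn ℝ 1 c J := by
    rw [show (1 : WithTop ℕ∞) = 0 + 1 by norm_num, contDiffOn_succ_iff_deriv_of_isOpen hJ]
    refine ⟨fun s hs => (hc s hs).1.differentiableAt.differentiableWithinAt, by simp, ?_⟩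
    rw [contDiffOn_zero]
    refine ContinuousOn.congr (f := fun s => sprayField 𝓗 (φ.energy p) (c s)) ?_ hderiv
    exact fun s hs => ((contDiffAt_sprayField_energy (hc s hs).2).continuousAt.comp
      (hc s hs).1.continuousAt).continuousWithinAt
  have hcd2 : ContDiffOn ℝ 2 (fun s => (c s).1) J := by
    rw [show (2 : WithTop ℕ∞) = 1 + 1 by norm_num, contDiffOn_succ_iff_deriv_of_isOpen hJ]
    have h1 : ∀ s ∈ J, HasDerivAt (fun s => (c s).1) (c s).2 s := fun s hs => (hc s hs).1.fst
    refine ⟨fun s hs => (h1 s hs).differentiableAt.differentiableWithinAt, by simp, ?_⟩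
    exact (contDiff_snd.comp_contDiffOn hcd).congr fun s hs => (h1 s hs).deriv
  have hsrc : ∀ s ∈ J, γ s ∈ (chartAt (EuclideanHalfSpace (n + 1)) p).source := fun s hs =>
    symm_mem_source (chartInterior_subset p (hc s hs).2.1)
  have hcm : ∀ s ∈ J, ContMDiffAt 𝓘(ℝ, ℝ) (𝓡∂ (n + 1)) 2 γ s := fun s hs => by
    have h1 : ContMDiffAt 𝓘(ℝ, ℝ) 𝓘(ℝ, E) 2 (fun s => (c s).1) s :=
      (hcd2.contDiffAt (hJ.mem_nhds hs)).contMDiffAt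
    have h2 : ContMDiffAt 𝓘(ℝ, E) (𝓡∂ (n + 1)) 2 (extChartAt (𝓡∂ (n + 1)) p).symm (c s).1 := by
      have h3 := (contMDiffOn_extChartAt_symm (I := 𝓡∂ (n + 1)) (n := ∞) p).of_le
        (m := 2) (WithTop.coe_le_coe.2 le_top)
      exact (h3.mono (chartInterior_subset p)).contMDiffAt
        ((isOpen_chartInterior p).mem_nhds (hc s hs).2.1)
    exact h2.comp s h1
  have hy : ∀ s ∈ J, extChartAt (𝓡∂ (n + 1)) p (γ s) = (c s).1 := fun s hs =>
    (extChartAt (𝓡∂ (n + 1)) p).right_inv (chartInterior_subset p (hc s hs).2.1)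
  have hcoord : ∀ s ∈ J, coordCurve p γ s = c s := fun s hs => by
    rw [coordCurve, tchart_velocity ((hcm s hs).mdifferentiableAt (by simp)) (hsrc s hs), hy s hs]
    have h1 : (fun σ => extChartAt (𝓡∂ (n + 1)) p (γ σ)) =ᶠ[𝓝 s] fun σ => (c σ).1 := by
      filter_upwards [hJ.mem_nhds hs] with σ hσ using hy σ hσ
    have h2 : HasDerivAt (fun s => (c s).1) (c s).2 s := (hc s hs).1.fst
    rw [h1.deriv_eq, h2.deriv]
  have hvel : ∀ s ∈ J, velocity (n := n) γ s = (tchart p).symm (c s) := fun s hs => by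
    rw [← hcoord s hs]
    exact ((tchart p).left_inv (mem_tchart_source.2 (hsrc s hs))).symm
  have hreg : ∀ s ∈ J, IsRegularAt (n := n) γ s := fun s hs => by
    refine ⟨hcm s hs, ?_, ?_⟩
    · rw [mem_interior_iff (hsrc s hs), hy s hs]
      exact (hc s hs).2.1
    · rw [hvel s hs]
      exact tchart_symm_ne_zero (interiorState_subset p (hc s hs).2)
  refine ⟨fun s hs => ⟨hreg s hs, ?_⟩, hvel⟩
  rw [(hreg s hs).eulerLagrangeAt_iff (hsrc s hs), hcoord s hs]
  refine (hc s hs).1.congr_of_eventuallyEq ?_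
  filter_upwards [hJ.mem_nhds hs] with σ hσ using hcoord σ hσ

lemma velocity_eq_of_coordCurve_eq {γ γ' : ℝ → M} {s : ℝ} {p : M}
    (hp : γ s ∈ (chartAt (EuclideanHalfSpace (n + 1)) p).source)
    (hp' : γ' s ∈ (chartAt (EuclideanHalfSpace (n + 1)) p).source)
    (h : coordCurve (n := n) p γ s = coordCurve p γ' s) :
    velocity (n := n) γ s = velocity γ' s :=
  (tchart p).injOn (mem_tchart_source.2 hp) (mem_tchart_source.2 hp') h

lemma eventuallyEq_of_velocity_eq {γ γ' : ℝ → M} {J : Set ℝ} (hJ : IsOpen J)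
    (h : φ.IsGeodesicOn γ J) (h' : φ.IsGeodesicOn γ' J) {s : ℝ} (hs : s ∈ J)
    (heq : velocity (n := n) γ s = velocity γ' s) : γ =ᶠ[𝓝 s] γ' := by
  have hp := mem_chart_source (EuclideanHalfSpace (n + 1)) (γ s)
  have hbase : γ' s = γ s := (congrArg Bundle.TotalSpace.proj heq).symm
  have hp' : γ' s ∈ (chartAt (EuclideanHalfSpace (n + 1)) (γ s)).source := by
    rw [hbase]; exact hp
  have hmem := (h s hs).1.coordCurve_mem hp
  obtain ⟨K, W, hW, hK⟩ := ((contDiffAt_sprayField_energy (φ := φ) hmem).of_le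
    (m := 1) (WithTop.coe_le_coe.2 le_top)).exists_lipschitzOnWith
  have hcs : coordCurve (n := n) (γ s) γ s = coordCurve (γ s) γ' s := by
    rw [coordCurve, coordCurve, heq]
  have key := ODE_solution_unique_of_eventually (t₀ := s)
    (v := fun _ => sprayField 𝓗 (φ.energy (γ s))) (s := fun _ => W) (K := K)
    (f := coordCurve (γ s) γ) (g := coordCurve (γ s) γ') (Eventually.of_forall fun _ => hK)
    (by
      filter_upwards [hJ.mem_nhds hs, (h s hs).1.eventually_mem_source hp,
        (h.hasDerivAt hs hp).continuousAt.preimage_mem_nhds hW] with τ h1 h2 h3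
      exact ⟨h.hasDerivAt h1 h2, h3⟩)
    (by
      filter_upwards [hJ.mem_nhds hs, (h' s hs).1.eventually_mem_source hp',
        (h'.hasDerivAt hs hp').continuousAt.preimage_mem_nhds (by rwa [← hcs])] with τ h1 h2 h3
      exact ⟨h'.hasDerivAt h1 h2, h3⟩) hcs
  filter_upwards [key, (h s hs).1.eventually_mem_source hp,
    (h' s hs).1.eventually_mem_source hp'] with τ h1 h2 h3
  exact congrArg Bundle.TotalSpace.proj (velocity_eq_of_coordCurve_eq h2 h3 h1)

/-- Two geodesics which have the same velocity at one time agree. -/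
lemma Metric.IsGeodesicOn.eqOn [T2Space M] {γ γ' : ℝ → M} {a b : ℝ}
    (h : φ.IsGeodesicOn γ (Ioo a b)) (h' : φ.IsGeodesicOn γ' (Ioo a b)) {s : ℝ}
    (hs : s ∈ Ioo a b) (heq : velocity (n := n) γ s = velocity γ' s) : EqOn γ γ' (Ioo a b) := by
  have hu : IsOpen {s | γ =ᶠ[𝓝 s] γ'} := isOpen_setOf_eventually_nhds
  refine fun t ht => (show γ =ᶠ[𝓝 t] γ' from ?_).self_of_nhds
  refine isPreconnected_Ioo.subset_of_closure_inter_subset hu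
    ⟨s, hs, eventuallyEq_of_velocity_eq isOpen_Ioo h h' hs heq⟩ ?_ ht
  -- At a limit of times near which the curves agree, position and velocity agree by continuity, and
  -- local uniqueness applies there.
  rintro t ⟨htc, ht⟩
  have hfreq : ∃ᶠ τ in 𝓝 t, γ =ᶠ[𝓝 τ] γ' := mem_closure_iff_frequently.1 htc
  have hbase : γ t = γ' t := tendsto_nhds_unique_of_frequently_eq
    (h t ht).1.contMDiffAt.continuousAt (h' t ht).1.contMDiffAt.continuousAt
    (hfreq.mono fun τ hτ => hτ.self_of_nhds)
  have hp := mem_chart_source (EuclideanHalfSpace (n + 1)) (γ t)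
  have hp' : γ' t ∈ (chartAt (EuclideanHalfSpace (n + 1)) (γ t)).source := by
    rw [← hbase]; exact hp
  have hc : coordCurve (n := n) (γ t) γ t = coordCurve (γ t) γ' t :=
    tendsto_nhds_unique_of_frequently_eq
      (h.hasDerivAt ht hp).continuousAt (h'.hasDerivAt ht hp').continuousAt
      (hfreq.mono fun τ hτ => by rw [coordCurve, coordCurve, velocity_congr hτ])
  exact eventuallyEq_of_velocity_eq isOpen_Ioo h h' ht (velocity_eq_of_coordCurve_eq hp hp' hc)

lemma Metric.IsGeodesicOn.mono {γ : ℝ → M} {J J' : Set ℝ} (h : φ.IsGeodesicOn γ J)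
    (hJ : J' ⊆ J) : φ.IsGeodesicOn γ J' := fun s hs => h s (hJ hs)

/-- A vector field which is twice differentiable near a boundary point and extends the spray. -/
lemma exists_extend_sprayField {p : M} {q₀ : E × E} (hq : q₀ ∈ stateDomain (n := n) p) :
    ∃ G : E × E → E × E, ContDiffAt ℝ 2 G q₀ ∧
      ∀ q : E × E, q.1 ∈ (𝓗 : Set E) → G q = sprayField 𝓗 (φ.energy p) q := by
  let ℓ : (E × E) →L[ℝ] ℝ := (EuclideanSpace.proj (0 : Fin (n + 1))).comp
    (ContinuousLinearMap.fst ℝ E E)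
  have hset : ∀ q : E × E, q.1 ∈ (𝓗 : Set E) ↔ 0 ≤ ℓ q := fun q => by
    rw [range_modelWithCornersEuclideanHalfSpace]
    rfl
  have hS : (𝓗 ×ˢ univ : Set (E × E)) = {q | 0 ≤ ℓ q} := by
    ext q
    exact ⟨fun h => (hset q).1 h.1, fun h => ⟨(hset q).2 h, mem_univ _⟩⟩
  have h1 := (contDiffWithinAt_sprayField_energy (φ := φ) hq).of_le
    (m := 2) (WithTop.coe_le_coe.2 le_top)
  rw [hS] at h1
  have he : ℓ ((EuclideanSpace.single (0 : Fin (n + 1)) (1 : ℝ) : E), (0 : E)) = 1 := by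
    simp [ℓ]
  obtain ⟨G, hG, hG'⟩ := ContDiffWithinAt.exists_extend_halfSpace he
    ((hset q₀).1 (target_subset_halfSpace p hq.1)) h1
  exact ⟨G, hG, fun q hq => hG' q ((hset q).1 hq)⟩

/-- Geodesics are determined by their initial velocity. -/
lemma Metric.IsGeodesicFrom.eqOn [T2Space M] {u : TangentBundle (𝓡∂ (n + 1)) M} (hu : u.2 ≠ 0)
    {T T' : ℝ} {γ γ' : ℝ → M} (h : φ.IsGeodesicFrom u T γ) (h' : φ.IsGeodesicFrom u T' γ') :
    EqOn γ γ' (Ioo 0 (min T T')) := by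
  rcases le_or_gt (min T T') 0 with hT | hT
  · rw [Ioo_eq_empty (not_lt.2 hT)]
    exact eqOn_empty _ _
  have hg := h.isGeodesicOn.mono (Ioo_subset_Ioo_right (min_le_left T T'))
  have hg' := h'.isGeodesicOn.mono (Ioo_subset_Ioo_right (min_le_right T T'))
  have hp := mem_chart_source (EuclideanHalfSpace (n + 1)) u.proj
  have hq := tchart_mem_stateDomain hp hu
  obtain ⟨G, hG, hGs⟩ := exists_extend_sprayField (φ := φ) hq
  obtain ⟨K, W, hW, hK⟩ := (hG.of_le (m := 1) (by norm_num)).exists_lipschitzOnWith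
  have near : ∀ γ : ℝ → M, Tendsto (velocity (n := n) γ) (𝓝[>] 0) (𝓝 u) →
      ∀ᶠ s in 𝓝[>] (0 : ℝ), γ s ∈ (chartAt (EuclideanHalfSpace (n + 1)) u.proj).source ∧
        coordCurve (n := n) u.proj γ s ∈ W := fun γ hγ => by
    have h1 := hγ.eventually ((isOpen_tchart_source u.proj).mem_nhds (mem_tchart_source.2 hp))
    have h2 := ((continuousAt_tchart hp).tendsto.comp hγ).eventually hW
    filter_upwards [h1, h2] with s hs hs'
    exact ⟨mem_tchart_source.1 hs, hs'⟩
  obtain ⟨δ, hδ, hmem⟩ := mem_nhdsGT_iff_exists_Ioo_subset.1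
    ((near γ h.initial).and ((near γ' h'.initial).and (Ioo_mem_nhdsGT hT)))
  have hδ0 : (0 : ℝ) < δ := hδ
  set c := coordCurve (n := n) u.proj γ with hc
  set c' := coordCurve (n := n) u.proj γ' with hc'
  have hd : ∀ s ∈ Ioo 0 δ, HasDerivAt c (G (c s)) s ∧ HasDerivAt c' (G (c' s)) s := fun s hs => by
    obtain ⟨h1, h2, h3⟩ := hmem hs
    have h4 := (hg s h3).1.coordCurve_mem h1.1
    have h5 := (hg' s h3).1.coordCurve_mem h2.1
    rw [hGs _ (interior_subset (fst_mem_interior h4)), hGs _ (interior_subset (fst_mem_interior h5))]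
    exact ⟨hg.hasDerivAt h3 h1.1, hg'.hasDerivAt h3 h2.1⟩
  have hlim : Tendsto (fun ε => dist (c ε) (c' ε)) (𝓝[>] 0) (𝓝 0) := by
    have h1 := ((continuousAt_tchart hp).tendsto.comp h.initial).dist
      ((continuousAt_tchart hp).tendsto.comp h'.initial)
    rwa [dist_self] at h1
  have ht : δ / 2 ∈ Ioo 0 δ := ⟨by linarith, by linarith⟩
  -- The initial velocity is only a limit for s → 0+, possibly at a boundary point, so Grönwall's
  -- inequality for the extended field is used on `[ε, δ / 2]` and `ε` tends to 0.
  have hzero : dist (c (δ / 2)) (c' (δ / 2)) ≤ 0 * Real.exp (K * (δ / 2)) := by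
    refine ge_of_tendsto (hlim.mul_const _) ?_
    filter_upwards [Ioo_mem_nhdsGT ht.1] with ε hε
    have hsub : Icc ε (δ / 2) ⊆ Ioo 0 δ := fun s hs => ⟨hε.1.trans_le hs.1, hs.2.trans_lt ht.2⟩
    have h1 := dist_le_of_trajectories_ODE_of_mem (v := fun _ => G) (s := fun _ => W) (K := K)
      (f := c) (g := c') (a := ε) (b := δ / 2) (fun _ _ => hK)
      (fun s hs => (hd s (hsub hs)).1.continuousAt.continuousWithinAt)
      (fun s hs => (hd s (hsub (Ico_subset_Icc_self hs))).1.hasDerivWithinAt)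
      (fun s hs => (hmem (hsub (Ico_subset_Icc_self hs))).1.2)
      (fun s hs => (hd s (hsub hs)).2.continuousAt.continuousWithinAt)
      (fun s hs => (hd s (hsub (Ico_subset_Icc_self hs))).2.hasDerivWithinAt)
      (fun s hs => (hmem (hsub (Ico_subset_Icc_self hs))).2.1.2) le_rfl (δ / 2)
      ⟨hε.2.le, le_rfl⟩
    refine h1.trans (mul_le_mul_of_nonneg_left (Real.exp_le_exp.2 ?_) dist_nonneg)
    exact mul_le_mul_of_nonneg_left (by linarith [hε.1]) K.2
  rw [zero_mul] at hzero
  obtain ⟨h1, h2, h3⟩ := hmem ht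
  exact hg.eqOn hg' h3 (velocity_eq_of_coordCurve_eq h1.1 h2.1 (dist_le_zero.1 hzero))

end Uniqueness

end Finsler
end

noncomputable section

/-! ### Local flows as one-parameter groups. -/

section LocalFlow

variable {Y : Type} [NormedAddCommGroup Y] [NormedSpace ℝ Y] [FiniteDimensional ℝ Y]

/-- The local flow of a vector field, with the properties of a one-parameter group. -/
theorem exists_local_flow {G : Y → Y} {x₀ : Y} (hG : ContDiffAt ℝ 2 G x₀) {W : Set Y}
    (hW : W ∈ 𝓝 x₀) : ∃ (Φ : ℝ × Y → Y) (ε : ℝ) (B : Set Y), 0 < ε ∧ IsOpen B ∧ x₀ ∈ B ∧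
      (∀ x ∈ B, Φ (0, x) = x) ∧
      (∀ t ∈ Ioo (-ε) ε, ∀ x ∈ B, ContDiffAt ℝ 2 Φ (t, x) ∧ Φ (t, x) ∈ W ∧
        HasDerivAt (fun t => Φ (t, x)) (G (Φ (t, x))) t ∧
        ∀ v, fderiv ℝ Φ (t, x) (0, v) = 0 → v = 0) ∧
      ∀ x ∈ B, ∀ t ∈ Ioo (-ε) ε, ∀ s ∈ Ioo (-ε) ε, t + s ∈ Ioo (-ε) ε → Φ (t, x) ∈ B →
        Φ (s, Φ (t, x)) = Φ (t + s, x) := by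
  have : CompleteSpace Y := FiniteDimensional.complete ℝ Y
  obtain ⟨Φ, hΦ, h0, hd⟩ := exists_contDiffAt_flow (n := 2) two_ne_zero hG
  obtain ⟨K, W', hW', hK⟩ := (hG.of_le (m := 1) (by norm_num)).exists_lipschitzOnWith
  have hval : Φ (0, x₀) = x₀ := h0.self_of_nhds
  have hmemW : ∀ᶠ q in 𝓝 ((0 : ℝ), x₀), Φ q ∈ W ∩ W' :=
    hΦ.continuousAt.preimage_mem_nhds (by rw [hval]; exact inter_mem hW hW')
  -- At time 0 the derivative in the initial value is the identity, and invertibility is an open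
  -- condition.
  have hinj : ∀ᶠ q in 𝓝 ((0 : ℝ), x₀), ∀ v, fderiv ℝ Φ q (0, v) = 0 → v = 0 := by
    have h1 : ContinuousAt (fun q => (fderiv ℝ Φ q).comp (ContinuousLinearMap.inr ℝ ℝ Y))
        (0, x₀) :=
      ((hΦ.fderiv_right (m := 1) (by norm_num)).continuousAt).clm_comp continuousAt_const
    have h2 : (fderiv ℝ Φ (0, x₀)).comp (ContinuousLinearMap.inr ℝ ℝ Y) =
        ((ContinuousLinearEquiv.refl ℝ Y : Y ≃L[ℝ] Y) : Y →L[ℝ] Y) := by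
      have h3 : HasFDerivAt (fun x : Y => Φ (0, x))
          ((fderiv ℝ Φ (0, x₀)).comp (ContinuousLinearMap.inr ℝ ℝ Y)) x₀ :=
        (hΦ.differentiableAt (by norm_num)).hasFDerivAt.comp x₀
          (hasFDerivAt_prodMk_right (0 : ℝ) x₀)
      exact h3.unique ((hasFDerivAt_id x₀).congr_of_eventuallyEq h0)
    have h4 := h1.preimage_mem_nhds (by
      rw [h2]
      exact ContinuousLinearEquiv.nhds (ContinuousLinearEquiv.refl ℝ Y))
    filter_upwards [h4] with q hq v hv
    obtain ⟨e, he⟩ := hq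
    have h5 : e v = 0 := (DFunLike.congr_fun he v).trans hv
    exact e.map_eq_zero_iff.1 h5
  have hall := (hΦ.eventually (by simp)).and (hmemW.and (hd.and hinj))
  rw [nhds_prod_eq] at hall
  obtain ⟨I, hI, B', hB', hsub⟩ := mem_prod_iff.1 hall
  obtain ⟨ε, hε, hIε⟩ := Metric.mem_nhds_iff.1 hI
  rw [Real.ball_eq_Ioo, zero_sub, zero_add] at hIε
  obtain ⟨B, hBsub, hBo, hB0⟩ := mem_nhds_iff.1 (inter_mem hB' h0)
  have hgood : ∀ t ∈ Ioo (-ε) ε, ∀ x ∈ B, _ := fun t ht x hx =>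
    hsub (mk_mem_prod (hIε ht) (hBsub hx).1)
  refine ⟨Φ, ε, B, hε, hBo, hB0, fun x hx => (hBsub hx).2, fun t ht x hx => ?_, ?_⟩
  · obtain ⟨h1, h2, h3, h4⟩ := hgood t ht x hx
    exact ⟨h1, h2.1, h3, h4⟩
  intro x hx t ht s hs hts hb
  -- On this interval both σ and t + σ stay in (-ε, ε), so both sides of the group law are defined
  -- and solve the same equation.
  have h0' : (0 : ℝ) ∈ Ioo (max (-ε) (-ε - t)) (min ε (ε - t)) :=
    ⟨max_lt (by linarith [hε]) (by linarith [ht.1]), lt_min hε (by linarith [ht.2])⟩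
  have hs' : s ∈ Ioo (max (-ε) (-ε - t)) (min ε (ε - t)) :=
    ⟨max_lt hs.1 (by linarith [hts.1]), lt_min hs.2 (by linarith [hts.2])⟩
  have key := ODE_solution_unique_of_mem_Ioo (v := fun _ => G) (s := fun _ => W') (K := K)
    (f := fun σ => Φ (σ, Φ (t, x))) (g := fun σ => Φ (t + σ, x)) (fun _ _ => hK) h0'
    (fun σ hσ => by
      obtain ⟨_, h2, h3, _⟩ := hgood σ ⟨(le_max_left _ _).trans_lt hσ.1,
        hσ.2.trans_le (min_le_left _ _)⟩ _ hb
      exact ⟨h3, h2.2⟩)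
    (fun σ hσ => by
      obtain ⟨_, h2, h3, _⟩ := hgood (t + σ)
        ⟨by linarith [(le_max_right _ _).trans_lt hσ.1], by
          linarith [hσ.2.trans_le (min_le_right _ _)]⟩ x hx
      exact ⟨HasDerivAt.comp_const_add t σ h3, h2.2⟩)
    (by simp only [add_zero]; exact (hBsub hb).2)
  exact key hs'

end LocalFlow

namespace Finsler

open Lagrangian

/-! ### Constant speed, continuation of geodesics, and the exponential map. -/

section Characteristics

variable {n : ℕ} {M : Type*} [TopologicalSpace M]
  [ChartedSpace (EuclideanHalfSpace (n + 1)) M] [IsManifold (𝓡∂ (n + 1)) ∞ M] {φ : Metric n M}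

local notation "E" => EuclideanSpace ℝ (Fin (n + 1))

local notation "𝓗" => range (𝓡∂ (n + 1))

/-- The speed of a geodesic is constant. -/
lemma Metric.IsGeodesicFrom.toFun_velocity {u : TangentBundle (𝓡∂ (n + 1)) M} (hu : u.2 ≠ 0)
    {T : ℝ} {γ : ℝ → M} (h : φ.IsGeodesicFrom u T γ) {s : ℝ} (hs : s ∈ Ioo 0 T) :
    φ.toFun (velocity γ s) ^ 2 / 2 = φ.toFun u ^ 2 / 2 := by
  have hg := h.isGeodesicOn
  have hd : ∀ s ∈ Ioo 0 T, HasDerivAt (fun τ => φ.toFun (velocity γ τ) ^ 2 / 2) 0 s := by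
    intro s hs
    have hp := mem_chart_source (EuclideanHalfSpace (n + 1)) (γ s)
    have hr := (hg s hs).1
    have hmem := hr.coordCurve_mem hp
    have h1 := hasDerivAt_energy_of_homogeneous (hg.hasDerivAt hs hp) (fst_mem_interior hmem)
      (contDiffWithinAt_energy (interiorState_subset _ hmem))
      ((hr.momentum_iff hp).2 (hg.hasDerivAt hs hp))
      ((hr.eventually_coordCurve_mem hp).mono fun τ hτ =>
        momentum_self (interiorState_subset _ hτ))
    refine h1.congr_of_eventuallyEq ?_
    filter_upwards [hr.eventually_mem_source hp] with τ hτ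
    exact (energy_tchart hτ).symm
  have hconst : ∀ r ∈ Ioo 0 T,
      φ.toFun (velocity γ r) ^ 2 / 2 = φ.toFun (velocity γ s) ^ 2 / 2 := fun r hr =>
    isOpen_Ioo.is_const_of_deriv_eq_zero isPreconnected_Ioo
      (fun τ hτ => (hd τ hτ).differentiableAt.differentiableWithinAt)
      (fun τ hτ => (hd τ hτ).deriv) hr hs
  have hT : 0 < T := hs.1.trans hs.2
  have hlim : Tendsto (fun τ => φ.toFun (velocity γ τ) ^ 2 / 2) (𝓝[>] 0)
      (𝓝 (φ.toFun u ^ 2 / 2)) := by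
    have h1 : Tendsto (velocity (n := n) γ) (𝓝[>] 0) (𝓝[{v | v.2 ≠ 0}] u) := by
      refine tendsto_nhdsWithin_iff.2 ⟨h.initial, ?_⟩
      filter_upwards [Ioo_mem_nhdsGT hT] with τ hτ using h.velocity_ne τ hτ
    exact (((φ.smooth.continuousOn u hu).tendsto.comp h1).pow 2).div_const 2
  refine tendsto_nhds_unique (Tendsto.congr' ?_ tendsto_const_nhds) hlim
  filter_upwards [Ioo_mem_nhdsGT hT] with τ hτ using (hconst τ hτ).symm

/-- A geodesic can be continued by another one with which it shares a tangent vector. -/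
lemma Metric.IsGeodesicFrom.exists_glue [T2Space M] {u : TangentBundle (𝓡∂ (n + 1)) M} {T : ℝ}
    {γ η : ℝ → M} (h : φ.IsGeodesicFrom u T γ) {a b t : ℝ} (hη : φ.IsGeodesicOn η (Ioo a b))
    (ha : 0 ≤ a) (ht : t ∈ Ioo a b) (hT : t < T) (heq : velocity (n := n) γ t = velocity η t) :
    ∃ γ', φ.IsGeodesicFrom u b γ' ∧ EqOn γ' η (Ioo a b) := by
  have htm : t < min T b := lt_min hT ht.2
  have hg := h.isGeodesicOn
  have he : EqOn γ η (Ioo a (min T b)) :=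
    (hg.mono (Ioo_subset_Ioo ha (min_le_left _ _))).eqOn
      (hη.mono (Ioo_subset_Ioo_right (min_le_right _ _))) ⟨ht.1, htm⟩ heq
  set γ' : ℝ → M := fun s => if s ≤ t then γ s else η s with hγ'
  have h1 : EqOn γ' γ (Ioo 0 (min T b)) := fun s hs => by
    by_cases hst : s ≤ t
    · simp [hγ', hst]
    · simp only [hγ', hst, if_false]
      exact (he ⟨ht.1.trans (not_le.1 hst), hs.2⟩).symm
  have h2 : EqOn γ' η (Ioo a b) := fun s hs => by
    by_cases hst : s ≤ t
    · simp only [hγ', hst, if_true]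
      exact he ⟨hs.1, hst.trans_lt htm⟩
    · simp [hγ', hst]
  have h3 := (hg.mono (Ioo_subset_Ioo_right (min_le_left T b))).congr isOpen_Ioo h1
  have h4 := hη.congr isOpen_Ioo h2
  have h0 : (0 : ℝ) < min T b := (ha.trans_lt ht.1).trans htm
  refine ⟨γ', Metric.IsGeodesicOn.isGeodesicFrom (fun s hs => ?_) ?_, h2⟩
  · rcases lt_or_ge s (min T b) with hsm | hsm
    · exact h3 s ⟨hs.1, hsm⟩
    · exact h4 s ⟨ht.1.trans (htm.trans_le hsm), hs.2⟩
  · refine h.initial.congr' ?_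
    filter_upwards [Ioo_mem_nhdsGT h0] with s hs
    exact velocity_congr (h1.eventuallyEq_of_mem (isOpen_Ioo.mem_nhds hs)).symm

variable {N : Type*} {ι : N → M} {X : ∀ z : N, TangentSpace (𝓡∂ (n + 1)) (ι z)}

lemma vector_ne_zero_of_unit (hu : ∀ z, φ.toFun ⟨ι z, X z⟩ = 1) (z : N) : X z ≠ 0 := by
  intro h
  have h1 := φ.homog (ι z) (X z) 0 le_rfl
  rw [zero_smul, zero_mul, ← h, hu z] at h1
  exact one_ne_zero h1

/-- The definition of `expMap` chooses a geodesic anew for each time; by uniqueness all choices lie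
on one curve. -/
lemma expMap_eq [T2Space M] (hu : ∀ z, φ.toFun ⟨ι z, X z⟩ = 1) {z : N} {T : ℝ} {γ : ℝ → M}
    (h : φ.IsGeodesicFrom ⟨ι z, X z⟩ T γ) {t : ℝ} (ht : t ∈ Ioo 0 T) :
    φ.expMap ι X (t, z) = γ t := by
  have hex : 0 < (t, z).1 ∧ ∃ γ : ℝ → M, ∃ T, (t, z).1 < T ∧
      φ.IsGeodesicFrom ⟨ι (t, z).2, X (t, z).2⟩ T γ := ⟨ht.1, γ, T, ht.2, h⟩
  rw [Metric.expMap, dif_pos hex]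
  obtain ⟨T', hT', h'⟩ := hex.2.choose_spec
  exact h'.eqOn (vector_ne_zero_of_unit hu z) h ⟨ht.1, lt_min hT' ht.2⟩

/-- The characteristic from `z`, up to its time of existence. -/
lemma isGeodesicFrom_expMap [T2Space M] (hu : ∀ z, φ.toFun ⟨ι z, X z⟩ = 1) {z : N} {T : ℝ}
    (hT : 0 < T) {γ : ℝ → M} (h : φ.IsGeodesicFrom ⟨ι z, X z⟩ T γ) :
    φ.IsGeodesicFrom ⟨ι z, X z⟩ T (fun s => φ.expMap ι X (s, z)) := by
  have he : EqOn (fun s => φ.expMap ι X (s, z)) γ (Ioo 0 T) := fun s hs => expMap_eq hu h hs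
  refine (h.isGeodesicOn.congr isOpen_Ioo he).isGeodesicFrom (h.initial.congr' ?_)
  filter_upwards [Ioo_mem_nhdsGT hT] with s hs
  exact velocity_congr (he.eventuallyEq_of_mem (isOpen_Ioo.mem_nhds hs)).symm

lemma exists_isGeodesicFrom_expMap [T2Space M] (hu : ∀ z, φ.toFun ⟨ι z, X z⟩ = 1) {t : ℝ} {z : N}
    (h : (t, z) ∈ φ.domain ι X) :
    ∃ T, t < T ∧ φ.IsGeodesicFrom ⟨ι z, X z⟩ T (fun s => φ.expMap ι X (s, z)) := by
  obtain ⟨h0, T, hT, γ, hγ⟩ := h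
  exact ⟨T, hT, isGeodesicFrom_expMap hu (lt_of_le_of_lt h0 hT) hγ⟩

end Characteristics

end Finsler
end

noncomputable section

namespace Finsler

open Lagrangian

/-! ### Variations of the characteristics and their propagation in time. -/

section Variations

variable {n : ℕ} {M : Type*} [TopologicalSpace M]
  [ChartedSpace (EuclideanHalfSpace (n + 1)) M] [IsManifold (𝓡∂ (n + 1)) ∞ M]
  {N : Type*} [TopologicalSpace N] [ChartedSpace (EuclideanSpace ℝ (Fin n)) N]

local notation "E" => EuclideanSpace ℝ (Fin (n + 1))

local notation "Z" => EuclideanSpace ℝ (Fin n)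

local notation "𝓗" => range (𝓡∂ (n + 1))

variable (φ : Metric n M) (ι : N → M) (X : ∀ z : N, TangentSpace (𝓡∂ (n + 1)) (ι z)) (g : N → ℝ)

/-- The velocity of the characteristics in charts: `z₀` selects a chart of the parameter space and
`p` a chart of `M`. -/
def Metric.stateCoord (z₀ : N) (p : M) (q : ℝ × EuclideanSpace ℝ (Fin n)) :
    EuclideanSpace ℝ (Fin (n + 1)) × EuclideanSpace ℝ (Fin (n + 1)) :=
  coordCurve p (fun s => φ.expMap ι X (s, (extChartAt (𝓡 n) z₀).symm q.2)) q.1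

/-- Near `(t₀, z₀)` the characteristics form a twice differentiable family of solutions, whose
initial values are immersed, and they satisfy the Gauss lemma. -/
structure Metric.IsVariationAt (z₀ : N) (p : M) (t₀ : ℝ) : Prop where
  domain : ∀ᶠ q in 𝓝 (t₀, extChartAt (𝓡 n) z₀ z₀),
    (q.1, (extChartAt (𝓡 n) z₀).symm q.2) ∈ φ.domain ι X ∧ 0 < q.1 ∧
      φ.expMap ι X (q.1, (extChartAt (𝓡 n) z₀).symm q.2) ∈
        (chartAt (EuclideanHalfSpace (n + 1)) p).source
  contDiffAt : ContDiffAt ℝ 2 (φ.stateCoord ι X z₀ p) (t₀, extChartAt (𝓡 n) z₀ z₀)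
  injective : ∀ w, fderiv ℝ (φ.stateCoord ι X z₀ p) (t₀, extChartAt (𝓡 n) z₀ z₀) w = 0 → w = 0
  gauss : ∀ᶠ q in 𝓝 (t₀, extChartAt (𝓡 n) z₀ z₀), ∀ w,
    momentum 𝓗 (φ.energy p) (φ.stateCoord ι X z₀ p q)
      (fderiv ℝ (φ.stateCoord ι X z₀ p) q w).1 =
      w.1 + fderiv ℝ (g ∘ (extChartAt (𝓡 n) z₀).symm) q.2 w.2

/-- The map `Ξ` describes the characteristics in the chart at `p` for times in `(a, b)` and
parameters in `O`. -/
structure Metric.IsFlowBox (z₀ : N) (p : M) (a b : ℝ) (O : Set (EuclideanSpace ℝ (Fin n)))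
    (Ξ : ℝ × EuclideanSpace ℝ (Fin n) →
      EuclideanSpace ℝ (Fin (n + 1)) × EuclideanSpace ℝ (Fin (n + 1))) : Prop where
  nonneg : 0 ≤ a
  isOpen : IsOpen O
  contDiffAt : ∀ t ∈ Ioo a b, ∀ ζ ∈ O, ContDiffAt ℝ 2 Ξ (t, ζ)
  hasDerivAt : ∀ t ∈ Ioo a b, ∀ ζ ∈ O,
    HasDerivAt (fun t => Ξ (t, ζ)) (sprayField 𝓗 (φ.energy p) (Ξ (t, ζ))) t
  mem : ∀ t ∈ Ioo a b, ∀ ζ ∈ O, Ξ (t, ζ) ∈ interiorState (n := n) p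
  geodesic : ∀ ζ ∈ O, ∃ γ, φ.IsGeodesicFrom
    ⟨ι ((extChartAt (𝓡 n) z₀).symm ζ), X ((extChartAt (𝓡 n) z₀).symm ζ)⟩ b γ ∧
    ∀ t ∈ Ioo a b, velocity (n := n) γ t = (tchart p).symm (Ξ (t, ζ))

variable {φ ι X g} {z₀ : N} {p : M} {a b : ℝ} {O : Set (EuclideanSpace ℝ (Fin n))}
  {Ξ : ℝ × EuclideanSpace ℝ (Fin n) →
    EuclideanSpace ℝ (Fin (n + 1)) × EuclideanSpace ℝ (Fin (n + 1))}

lemma Metric.IsFlowBox.mem_domain (h : φ.IsFlowBox ι X z₀ p a b O Ξ) {t : ℝ} {ζ : Z}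
    (ht : t ∈ Ioo a b) (hζ : ζ ∈ O) : (t, (extChartAt (𝓡 n) z₀).symm ζ) ∈ φ.domain ι X := by
  obtain ⟨γ, hγ, -⟩ := h.geodesic ζ hζ
  exact ⟨h.nonneg.trans ht.1.le, b, ht.2, γ, hγ⟩

lemma Metric.IsFlowBox.velocity_eq [T2Space M] (h : φ.IsFlowBox ι X z₀ p a b O Ξ)
    (hu : ∀ z, φ.toFun ⟨ι z, X z⟩ = 1) {t : ℝ} {ζ : Z} (ht : t ∈ Ioo a b) (hζ : ζ ∈ O) :
    velocity (n := n) (fun s => φ.expMap ι X (s, (extChartAt (𝓡 n) z₀).symm ζ)) t =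
      (tchart p).symm (Ξ (t, ζ)) := by
  obtain ⟨γ, hγ, hv⟩ := h.geodesic ζ hζ
  rw [← hv t ht]
  refine velocity_congr ?_
  filter_upwards [isOpen_Ioo.mem_nhds (show t ∈ Ioo 0 b from ⟨h.nonneg.trans_lt ht.1, ht.2⟩)]
    with s hs
  exact expMap_eq hu hγ hs

lemma Metric.IsFlowBox.stateCoord_eq [T2Space M] (h : φ.IsFlowBox ι X z₀ p a b O Ξ)
    (hu : ∀ z, φ.toFun ⟨ι z, X z⟩ = 1) {t : ℝ} {ζ : Z} (ht : t ∈ Ioo a b) (hζ : ζ ∈ O) :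
    φ.stateCoord ι X z₀ p (t, ζ) = Ξ (t, ζ) := by
  rw [Metric.stateCoord, coordCurve, h.velocity_eq hu ht hζ]
  exact (tchart p).right_inv
    (stateDomain_subset_target (interiorState_subset p (h.mem t ht ζ hζ)))

lemma Metric.IsFlowBox.mem_source [T2Space M] (h : φ.IsFlowBox ι X z₀ p a b O Ξ)
    (hu : ∀ z, φ.toFun ⟨ι z, X z⟩ = 1) {t : ℝ} {ζ : Z} (ht : t ∈ Ioo a b) (hζ : ζ ∈ O) :
    φ.expMap ι X (t, (extChartAt (𝓡 n) z₀).symm ζ) ∈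
      (chartAt (EuclideanHalfSpace (n + 1)) p).source := by
  have h1 := congrArg Bundle.TotalSpace.proj (h.velocity_eq hu ht hζ)
  have h2 := tchart_symm_source (interiorState_subset p (h.mem t ht ζ hζ))
  rw [← h1] at h2
  exact h2

lemma Metric.IsFlowBox.stateCoord_eventuallyEq [T2Space M] (h : φ.IsFlowBox ι X z₀ p a b O Ξ)
    (hu : ∀ z, φ.toFun ⟨ι z, X z⟩ = 1) {t : ℝ} {ζ : Z} (ht : t ∈ Ioo a b) (hζ : ζ ∈ O) :
    φ.stateCoord ι X z₀ p =ᶠ[𝓝 (t, ζ)] Ξ := by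
  filter_upwards [prod_mem_nhds (isOpen_Ioo.mem_nhds ht) (h.isOpen.mem_nhds hζ)] with q hq
  exact h.stateCoord_eq hu hq.1 hq.2

lemma Metric.IsFlowBox.energy_eq [T2Space M] (h : φ.IsFlowBox ι X z₀ p a b O Ξ)
    (hu : ∀ z, φ.toFun ⟨ι z, X z⟩ = 1) {t : ℝ} {ζ : Z} (ht : t ∈ Ioo a b) (hζ : ζ ∈ O) :
    φ.energy p (Ξ (t, ζ)) = 1 / 2 := by
  obtain ⟨γ, hγ, hv⟩ := h.geodesic ζ hζ
  have hm := interiorState_subset p (h.mem t ht ζ hζ)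
  have h1 := energy_tchart (φ := φ) (tchart_symm_source hm)
  rw [(tchart p).right_inv (stateDomain_subset_target hm), ← hv t ht] at h1
  rw [h1, hγ.toFun_velocity (vector_ne_zero_of_unit hu _) ⟨h.nonneg.trans_lt ht.1, ht.2⟩, hu]
  norm_num

lemma Metric.IsFlowBox.fderiv_time (h : φ.IsFlowBox ι X z₀ p a b O Ξ) {t : ℝ} {ζ : Z}
    (ht : t ∈ Ioo a b) (hζ : ζ ∈ O) :
    fderiv ℝ Ξ (t, ζ) (1, 0) = sprayField 𝓗 (φ.energy p) (Ξ (t, ζ)) := by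
  have hline : HasDerivAt (fun t : ℝ => (t, ζ)) ((1, 0) : ℝ × Z) t :=
    (hasDerivAt_id t).prodMk (hasDerivAt_const t ζ)
  have h1 : HasDerivAt (fun t => Ξ (t, ζ)) (fderiv ℝ Ξ (t, ζ) (1, 0)) t :=
    HasFDerivAt.comp_hasDerivAt (f := fun t : ℝ => (t, ζ)) t
      ((h.contDiffAt t ht ζ hζ).differentiableAt (by norm_num)).hasFDerivAt hline
  exact h1.unique (h.hasDerivAt t ht ζ hζ)

lemma Metric.IsFlowBox.hasDerivAt_pairing [T2Space M] (h : φ.IsFlowBox ι X z₀ p a b O Ξ)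
    (hu : ∀ z, φ.toFun ⟨ι z, X z⟩ = 1) {t : ℝ} {ζ : Z} (ht : t ∈ Ioo a b) (hζ : ζ ∈ O)
    (w : ℝ × Z) :
    HasDerivAt (fun t => momentum 𝓗 (φ.energy p) (Ξ (t, ζ)) (fderiv ℝ Ξ (t, ζ) w).1) 0 t := by
  have hm := h.mem t ht ζ hζ
  have hs := interiorState_subset p hm
  have hnear : ∀ᶠ q in 𝓝 (t, ζ), q.1 ∈ Ioo a b ∧ q.2 ∈ O :=
    prod_mem_nhds (isOpen_Ioo.mem_nhds ht) (h.isOpen.mem_nhds hζ)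
  have hEL := (hasDerivAt_momentum_iff (c := fun t => Ξ (t, ζ)) uniqueDiffOn_halfSpace
    (h.hasDerivAt t ht ζ hζ) (fst_mem_interior hm) (contDiffWithinAt_energy hs)
    (fiberHessian_pos hs)).2 rfl
  exact hasDerivAt_momentum_fderiv (p := (t, ζ)) (k := 1 / 2) (h.contDiffAt t ht ζ hζ)
    (hnear.mono fun q hq => by rw [h.fderiv_time hq.1 hq.2]; rfl) (fst_mem_interior hm)
    (contDiffWithinAt_energy hs) hEL (hnear.mono fun q hq => h.energy_eq hu hq.1 hq.2) w

lemma Metric.IsFlowBox.pairing_eq [T2Space M] (h : φ.IsFlowBox ι X z₀ p a b O Ξ)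
    (hu : ∀ z, φ.toFun ⟨ι z, X z⟩ = 1) {t t' : ℝ} {ζ : Z} (ht : t ∈ Ioo a b) (ht' : t' ∈ Ioo a b)
    (hζ : ζ ∈ O) (w : ℝ × Z) :
    momentum 𝓗 (φ.energy p) (Ξ (t, ζ)) (fderiv ℝ Ξ (t, ζ) w).1 =
      momentum 𝓗 (φ.energy p) (Ξ (t', ζ)) (fderiv ℝ Ξ (t', ζ) w).1 :=
  isOpen_Ioo.is_const_of_deriv_eq_zero isPreconnected_Ioo
    (fun _ hτ => (h.hasDerivAt_pairing hu hτ hζ w).differentiableAt.differentiableWithinAt)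
    (fun _ hτ => (h.hasDerivAt_pairing hu hτ hζ w).deriv) ht ht'

/-- The Gauss identity is only required at one time `t'` of the box, because its left-hand side is
constant in time. Injectivity is required at `t` itself. -/
lemma Metric.IsFlowBox.isVariationAt [T2Space M] (h : φ.IsFlowBox ι X z₀ p a b O Ξ)
    (hu : ∀ z, φ.toFun ⟨ι z, X z⟩ = 1) (hO : extChartAt (𝓡 n) z₀ z₀ ∈ O) {t t' : ℝ}
    (ht : t ∈ Ioo a b) (ht' : t' ∈ Ioo a b)
    (hinj : ∀ w, fderiv ℝ Ξ (t, extChartAt (𝓡 n) z₀ z₀) w = 0 → w = 0)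
    (hgauss : ∀ᶠ ζ in 𝓝 (extChartAt (𝓡 n) z₀ z₀), ∀ w : ℝ × Z,
      momentum 𝓗 (φ.energy p) (Ξ (t', ζ)) (fderiv ℝ Ξ (t', ζ) w).1 =
        w.1 + fderiv ℝ (g ∘ (extChartAt (𝓡 n) z₀).symm) ζ w.2) :
    φ.IsVariationAt ι X g z₀ p t := by
  have hnear : ∀ᶠ q in 𝓝 (t, extChartAt (𝓡 n) z₀ z₀), q.1 ∈ Ioo a b ∧ q.2 ∈ O :=
    prod_mem_nhds (isOpen_Ioo.mem_nhds ht) (h.isOpen.mem_nhds hO)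
  have heq := h.stateCoord_eventuallyEq hu ht hO
  refine ⟨hnear.mono fun q hq => ⟨h.mem_domain hq.1 hq.2, h.nonneg.trans_lt hq.1.1,
    h.mem_source hu hq.1 hq.2⟩, (h.contDiffAt t ht _ hO).congr_of_eventuallyEq heq, ?_, ?_⟩
  · rw [heq.fderiv_eq]
    exact hinj
  · filter_upwards [hnear, continuous_snd.continuousAt.eventually hgauss,
      heq.eventually_nhds] with q hq hg he w
    rw [Filter.Eventually.self_of_nhds he, Filter.EventuallyEq.fderiv_eq he, ← hg w]
    exact h.pairing_eq hu hq.1 ht' hq.2 w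

/-- The variation property is locally constant along a characteristic. -/
lemma exists_isVariationAt_iff [T2Space M] (hu : ∀ z, φ.toFun ⟨ι z, X z⟩ = 1) {t : ℝ}
    (hdom : (t, z₀) ∈ φ.domain ι X) (ht : 0 < t)
    (hp : φ.expMap ι X (t, z₀) ∈ (chartAt (EuclideanHalfSpace (n + 1)) p).source) :
    ∃ ε > 0, ∀ t₁ ∈ Ioo (t - ε) (t + ε), φ.IsVariationAt ι X g z₀ p t₁ →
      ∀ t₂ ∈ Ioo (t - ε) (t + ε), φ.IsVariationAt ι X g z₀ p t₂ := by
  obtain ⟨T, hT, hgeo⟩ := exists_isGeodesicFrom_expMap hu hdom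
  have hz₀ : (extChartAt (𝓡 n) z₀).symm (extChartAt (𝓡 n) z₀ z₀) = z₀ := extChartAt_to_inv z₀
  set ζ₀ := extChartAt (𝓡 n) z₀ z₀ with hζ₀
  have htT : t ∈ Ioo 0 T := ⟨ht, hT⟩
  set c : ℝ → E × E := coordCurve p (fun s => φ.expMap ι X (s, z₀)) with hc
  have hmem : c t ∈ interiorState (n := n) p := (hgeo.isGeodesicOn t htT).1.coordCurve_mem hp
  obtain ⟨Φ, ε₀, B, hε₀, hBo, hB0, hΦ0, hΦ, hΦadd⟩ := exists_local_flow
    ((contDiffAt_sprayField_energy (φ := φ) hmem).of_le (m := 2) (WithTop.coe_le_coe.2 le_top))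
    ((isOpen_interiorState p).mem_nhds hmem)
  have hcB : ∀ᶠ s in 𝓝 t, c s ∈ B :=
    (hgeo.isGeodesicOn.hasDerivAt htT hp).continuousAt.preimage_mem_nhds (hBo.mem_nhds hB0)
  obtain ⟨ε₁, hε₁, hball⟩ := Metric.eventually_nhds_iff_ball.1
    (hcB.and (isOpen_Ioo.mem_nhds htT))
  rw [Real.ball_eq_Ioo] at hball
  set ε := min ε₁ (ε₀ / 2) with hε
  have hεpos : 0 < ε := lt_min hε₁ (by linarith)
  have hsub : Ioo (t - ε) (t + ε) ⊆ Ioo (t - ε₁) (t + ε₁) :=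
    Ioo_subset_Ioo (by linarith [min_le_left ε₁ (ε₀ / 2)]) (by linarith [min_le_left ε₁ (ε₀ / 2)])
  have hε2 : 2 * ε ≤ ε₀ := by linarith [min_le_right ε₁ (ε₀ / 2)]
  -- Were `t - ε` negative, the tested time, which then evaluates to 0, would belong to the
  -- interval, although the interval lies in `Ioo 0 T`.
  have ha : 0 ≤ t - ε := by
    by_contra hneg
    have h1 := (hball ((max (t - ε) 0 + min t 0) / 2) (hsub ⟨by
      rw [max_eq_right (by linarith), min_eq_right ht.le]; linarith, by
      rw [max_eq_right (by linarith), min_eq_right ht.le]; linarith⟩)).2.1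
    rw [max_eq_right (by linarith), min_eq_right ht.le] at h1
    linarith
  refine ⟨ε, hεpos, fun t₁ ht₁ hV t₂ ht₂ => ?_⟩
  have hx₁ : φ.stateCoord ι X z₀ p (t₁, ζ₀) ∈ B := by
    have h1 := (hball t₁ (hsub ht₁)).1
    rw [Metric.stateCoord]
    simp only
    rw [hz₀]
    exact h1
  have hslice : Tendsto (fun ζ : Z => (t₁, ζ)) (𝓝 ζ₀) (𝓝 (t₁, ζ₀)) :=
    (continuous_const.prodMk continuous_id).continuousAt
  have hO' : ∀ᶠ ζ in 𝓝 ζ₀, φ.stateCoord ι X z₀ p (t₁, ζ) ∈ B ∧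
      ContDiffAt ℝ 2 (φ.stateCoord ι X z₀ p) (t₁, ζ) ∧
      (t₁, (extChartAt (𝓡 n) z₀).symm ζ) ∈ φ.domain ι X ∧
      φ.expMap ι X (t₁, (extChartAt (𝓡 n) z₀).symm ζ) ∈
        (chartAt (EuclideanHalfSpace (n + 1)) p).source := by
    filter_upwards [hslice.eventually (hV.contDiffAt.continuousAt.preimage_mem_nhds
      (hBo.mem_nhds hx₁)), hslice.eventually (hV.contDiffAt.eventually (by simp)),
      hslice.eventually hV.domain] with ζ h1 h2 h3
    exact ⟨h1, h2, h3.1, h3.2.2⟩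
  obtain ⟨O, hOsub, hOo, hO0⟩ := eventually_nhds_iff.1 hO'
  -- The flow is restarted at `t₁` from the states of all nearby characteristics. Gluing its
  -- trajectories to the existing geodesics shows that it describes the same characteristics.
  set Ξ : ℝ × Z → E × E := fun q => Φ (q.1 - t₁, φ.stateCoord ι X z₀ p (t₁, q.2)) with hΞ
  have htime : ∀ s ∈ Ioo (t - ε) (t + ε), s - t₁ ∈ Ioo (-ε₀) ε₀ := fun s hs =>
    ⟨by linarith [hs.1, ht₁.2], by linarith [hs.2, ht₁.1]⟩
  have hbox : φ.IsFlowBox ι X z₀ p (t - ε) (t + ε) O Ξ := by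
    have hmemI : ∀ s ∈ Ioo (t - ε) (t + ε), ∀ ζ ∈ O, Ξ (s, ζ) ∈ interiorState (n := n) p :=
      fun s hs ζ hζ => (hΦ _ (htime s hs) _ (hOsub ζ hζ).1).2.1
    have hder : ∀ s ∈ Ioo (t - ε) (t + ε), ∀ ζ ∈ O,
        HasDerivAt (fun s => Ξ (s, ζ)) (sprayField 𝓗 (φ.energy p) (Ξ (s, ζ))) s :=
      fun s hs ζ hζ => HasDerivAt.comp_sub_const s t₁ (hΦ _ (htime s hs) _ (hOsub ζ hζ).1).2.2.1
    refine ⟨ha, hOo, fun s hs ζ hζ => ?_, hder, hmemI, fun ζ hζ => ?_⟩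
    · have h1 := (hΦ _ (htime s hs) _ (hOsub ζ hζ).1).1
      have h2 : ContDiffAt ℝ 2 (fun q : ℝ × Z => φ.stateCoord ι X z₀ p (t₁, q.2)) (s, ζ) :=
        ContDiffAt.comp (s, ζ) (g := φ.stateCoord ι X z₀ p) (f := fun q : ℝ × Z => (t₁, q.2))
          (hOsub ζ hζ).2.1 (contDiffAt_const.prodMk contDiffAt_snd)
      exact ContDiffAt.comp (s, ζ) (g := Φ) h1 ((contDiffAt_fst.sub contDiffAt_const).prodMk h2)
    · obtain ⟨hη, hηv⟩ := isGeodesicOn_of_chart (φ := φ) (p := p) (c := fun s => Ξ (s, ζ))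
        isOpen_Ioo fun s hs => ⟨hder s hs ζ hζ, hmemI s hs ζ hζ⟩
      obtain ⟨T', hT', hgeo'⟩ := exists_isGeodesicFrom_expMap hu (hOsub ζ hζ).2.2.1
      obtain ⟨γ', hγ', heq⟩ := hgeo'.exists_glue hη ha ht₁ hT' (by
        rw [hηv t₁ ht₁]
        simp only [hΞ, sub_self]
        rw [hΦ0 _ (hOsub ζ hζ).1]
        exact ((tchart p).left_inv (mem_tchart_source.2 (hOsub ζ hζ).2.2.2)).symm)
      refine ⟨γ', hγ', fun s hs => ?_⟩
      rw [velocity_congr (heq.eventuallyEq_of_mem (isOpen_Ioo.mem_nhds hs)), hηv s hs]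
  have heq₁ := hbox.stateCoord_eventuallyEq hu ht₁ hO0
  have hinj₁ : ∀ w, fderiv ℝ Ξ (t₁, ζ₀) w = 0 → w = 0 := by
    rw [← heq₁.fderiv_eq]
    exact hV.injective
  have hΞ₁ : Ξ (t₁, ζ₀) ∈ B := by rw [← heq₁.self_of_nhds]; exact hx₁
  refine hbox.isVariationAt hu hO0 ht₂ ht₁ (fun w hw => ?_) ?_
  · have hs : t₂ - t₁ ∈ Ioo (-ε₀) ε₀ := htime t₂ ht₂
    have hshift : Tendsto (fun q : ℝ × Z => (q.1 - (t₂ - t₁), q.2)) (𝓝 (t₂, ζ₀))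
        (𝓝 (t₁, ζ₀)) := by
      have : ContinuousAt (fun q : ℝ × Z => (q.1 - (t₂ - t₁), q.2)) (t₂, ζ₀) := by fun_prop
      simpa [ContinuousAt] using this
    -- By the group law the family near `t₂` is the family near `t₁` followed by the fixed flow map
    -- of time `t₂ - t₁`. The time shift has identity derivative and the flow map an injective one,
    -- so injectivity is carried over.
    have hev : Ξ =ᶠ[𝓝 (t₂, ζ₀)] fun q => Φ (t₂ - t₁, Ξ (q.1 - (t₂ - t₁), q.2)) := by
      filter_upwards [prod_mem_nhds (isOpen_Ioo.mem_nhds ht₂) (hOo.mem_nhds hO0),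
        hshift.eventually (prod_mem_nhds (isOpen_Ioo.mem_nhds ht₁) (hOo.mem_nhds hO0)),
        hshift.eventually ((hbox.contDiffAt t₁ ht₁ ζ₀ hO0).continuousAt.preimage_mem_nhds
          (hBo.mem_nhds hΞ₁))] with q h1 h2 h3
      have h4 := hΦadd _ (hOsub q.2 h1.2).1 (q.1 - (t₂ - t₁) - t₁) (htime _ h2.1) (t₂ - t₁) hs
        (by convert htime q.1 h1.1 using 1; ring) h3
      simp only [hΞ]
      rw [h4]
      congr 2
      ring
    have hsh : HasFDerivAt (fun q : ℝ × Z => (q.1 - (t₂ - t₁), q.2))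
        (ContinuousLinearMap.id ℝ (ℝ × Z)) (t₂, ζ₀) :=
      ((hasFDerivAt_fst.sub_const (t₂ - t₁)).prodMk hasFDerivAt_snd).congr_fderiv
        (ContinuousLinearMap.fst_prod_snd ..)
    have hval : ((t₂ - (t₂ - t₁), ζ₀) : ℝ × Z) = (t₁, ζ₀) := by simp
    have hΞd : HasFDerivAt Ξ (fderiv ℝ Ξ (t₁, ζ₀)) (t₂ - (t₂ - t₁), ζ₀) := by
      rw [hval]
      exact ((hbox.contDiffAt t₁ ht₁ ζ₀ hO0).differentiableAt (by norm_num)).hasFDerivAt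
    have hΦd : HasFDerivAt Φ (fderiv ℝ Φ (t₂ - t₁, Ξ (t₁, ζ₀)))
        (t₂ - t₁, Ξ (t₂ - (t₂ - t₁), ζ₀)) := by
      rw [hval]
      exact ((hΦ _ hs _ hΞ₁).1.differentiableAt (by norm_num)).hasFDerivAt
    have h5 : HasFDerivAt (fun q : ℝ × Z => Φ (t₂ - t₁, Ξ (q.1 - (t₂ - t₁), q.2)))
        ((fderiv ℝ Φ (t₂ - t₁, Ξ (t₁, ζ₀))).comp
          ((ContinuousLinearMap.inr ℝ ℝ (E × E)).comp
            ((fderiv ℝ Ξ (t₁, ζ₀)).comp (ContinuousLinearMap.id ℝ (ℝ × Z))))) (t₂, ζ₀) :=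
      hΦd.comp (t₂, ζ₀) ((hasFDerivAt_prodMk_right (t₂ - t₁) _).comp (t₂, ζ₀)
        (HasFDerivAt.comp (f := fun q : ℝ × Z => (q.1 - (t₂ - t₁), q.2)) (t₂, ζ₀) hΞd hsh))
    rw [(h5.congr_of_eventuallyEq hev).fderiv] at hw
    exact hinj₁ w ((hΦ _ hs _ hΞ₁).2.2.2 _ hw)
  · filter_upwards [hslice.eventually hV.gauss, hslice.eventually heq₁.eventually_nhds]
      with ζ h1 h2 w
    rw [← h1 w, Filter.Eventually.self_of_nhds h2, Filter.EventuallyEq.fderiv_eq h2]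

lemma stateCoord_mem [T2Space M] (hu : ∀ z, φ.toFun ⟨ι z, X z⟩ = 1) {q : ℝ × Z}
    (hdom : (q.1, (extChartAt (𝓡 n) z₀).symm q.2) ∈ φ.domain ι X) (h0 : 0 < q.1)
    (hp : φ.expMap ι X (q.1, (extChartAt (𝓡 n) z₀).symm q.2) ∈
      (chartAt (EuclideanHalfSpace (n + 1)) p).source) :
    φ.stateCoord ι X z₀ p q ∈ interiorState (n := n) p ∧
      (tchart p).symm (φ.stateCoord ι X z₀ p q) =
        velocity (n := n) (fun s => φ.expMap ι X (s, (extChartAt (𝓡 n) z₀).symm q.2)) q.1 := by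
  obtain ⟨T, hT, hgeo⟩ := exists_isGeodesicFrom_expMap hu hdom
  exact ⟨(hgeo.isGeodesicOn q.1 ⟨h0, hT⟩).1.coordCurve_mem hp,
    (tchart p).left_inv (mem_tchart_source.2 hp)⟩

lemma Metric.IsVariationAt.of_mem_source [T2Space M] (hu : ∀ z, φ.toFun ⟨ι z, X z⟩ = 1) {t : ℝ}
    {p' : M} (h : φ.IsVariationAt ι X g z₀ p t)
    (hp' : φ.expMap ι X (t, z₀) ∈ (chartAt (EuclideanHalfSpace (n + 1)) p').source) :
    φ.IsVariationAt ι X g z₀ p' t := by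
  have hz₀ : (extChartAt (𝓡 n) z₀).symm (extChartAt (𝓡 n) z₀ z₀) = z₀ := extChartAt_to_inv z₀
  set ζ₀ := extChartAt (𝓡 n) z₀ z₀ with hζ₀
  set ξ := φ.stateCoord ι X z₀ p with hξ
  have hsrc : ∀ q : ℝ × Z, (q.1, (extChartAt (𝓡 n) z₀).symm q.2) ∈ φ.domain ι X → 0 < q.1 →
      φ.expMap ι X (q.1, (extChartAt (𝓡 n) z₀).symm q.2) ∈
        (chartAt (EuclideanHalfSpace (n + 1)) p).source →
      (extChartAt (𝓡∂ (n + 1)) p).symm (ξ q).1 =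
        φ.expMap ι X (q.1, (extChartAt (𝓡 n) z₀).symm q.2) := fun q h1 h2 h3 => by
    obtain ⟨h4, h5⟩ := stateCoord_mem hu h1 h2 h3
    rw [← tchart_symm_proj (q := ξ q) (chartInterior_subset p h4.1), h5]
    rfl
  have hover : (ξ (t, ζ₀)).1 ∈ overlap (n := n) p p' := by
    obtain ⟨h1, h2, h3⟩ := h.domain.self_of_nhds
    refine ⟨(stateCoord_mem hu h1 h2 h3).1.1, ?_⟩
    rw [hsrc (t, ζ₀) h1 h2 h3]
    simp only [hz₀]
    exact hp'
  have hnear : ∀ᶠ q in 𝓝 (t, ζ₀), (ξ q).1 ∈ overlap (n := n) p p' :=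
    (continuous_fst.continuousAt.comp h.contDiffAt.continuousAt).preimage_mem_nhds
      ((isOpen_overlap p p').mem_nhds hover)
  have hdom' : ∀ᶠ q in 𝓝 (t, ζ₀), (q.1, (extChartAt (𝓡 n) z₀).symm q.2) ∈ φ.domain ι X ∧
      0 < q.1 ∧ φ.expMap ι X (q.1, (extChartAt (𝓡 n) z₀).symm q.2) ∈
        (chartAt (EuclideanHalfSpace (n + 1)) p').source := by
    filter_upwards [hnear, h.domain] with q h1 h2
    refine ⟨h2.1, h2.2.1, ?_⟩
    rw [← hsrc q h2.1 h2.2.1 h2.2.2]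
    exact h1.2
  have heq : φ.stateCoord ι X z₀ p' =ᶠ[𝓝 (t, ζ₀)] fun q => tangentTransition p p' (ξ q) := by
    filter_upwards [hnear, h.domain] with q h1 h2
    have h3 := tchart_tchart_symm (v := (ξ q).2) h1
    rw [Prod.mk.eta, (stateCoord_mem hu h2.1 h2.2.1 h2.2.2).2] at h3
    exact h3
  have hder : ∀ᶠ q in 𝓝 (t, ζ₀), ∀ w, fderiv ℝ (φ.stateCoord ι X z₀ p') q w =
      (fderiv ℝ (transition (n := n) p p') (ξ q).1 (fderiv ℝ ξ q w).1,
        fderiv ℝ (fderiv ℝ (transition (n := n) p p')) (ξ q).1 (fderiv ℝ ξ q w).1 (ξ q).2 +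
          fderiv ℝ (transition (n := n) p p') (ξ q).1 (fderiv ℝ ξ q w).2) := by
    filter_upwards [hnear, heq.eventually_nhds, h.contDiffAt.eventually (by simp)]
      with q h1 h2 h3 w
    have h4 : HasFDerivAt (fun q => tangentTransition p p' (ξ q))
        ((fderiv ℝ (tangentTransition (n := n) p p') (ξ q)).comp (fderiv ℝ ξ q)) q :=
      ((contDiffAt_tangentTransition h1).differentiableAt (by simp)).hasFDerivAt.comp q
        (h3.differentiableAt (by norm_num)).hasFDerivAt
    rw [Filter.EventuallyEq.fderiv_eq h2, h4.fderiv, ContinuousLinearMap.comp_apply,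
      ← fderiv_tangentTransition h1]
  refine ⟨hdom', ?_, fun w hw => h.injective w ?_, ?_⟩
  · refine ContDiffAt.congr_of_eventuallyEq ?_ heq
    exact ContDiffAt.comp (t, ζ₀) ((contDiffAt_tangentTransition hover).of_le
      (WithTop.coe_le_coe.2 le_top)) h.contDiffAt
  -- The derivative of the tangent change of coordinates is block triangular with the same injective
  -- diagonal blocks: the position part vanishes first, then the velocity part.
  · have hi : ∀ v, fderiv ℝ (transition (n := n) p p') (ξ (t, ζ₀)).1 v = 0 → v = 0 := fun v hv =>
      by_contra fun h0 => fderiv_transition_ne_zero hover h0 hv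
    rw [hder.self_of_nhds w, Prod.mk_eq_zero] at hw
    have h1 := hi _ hw.1
    have h2 := hw.2
    rw [h1, map_zero, ContinuousLinearMap.zero_apply, zero_add] at h2
    exact Prod.ext h1 (hi _ h2)
  · filter_upwards [hder, h.gauss, heq, hnear, h.domain] with q h1 h2 h3 h4 h5 w
    rw [h1 w, h3, ← h2 w,
      momentum_transition (stateCoord_mem hu h5.1 h5.2.1 h5.2.2).1 h4]
    rfl

/-- The variation property propagates along a characteristic. -/
lemma isVariationAt_of_small [T2Space M] (hu : ∀ z, φ.toFun ⟨ι z, X z⟩ = 1)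
    {p₀ : M} {δ : ℝ} (hδ : 0 < δ) (hsmall : ∀ t ∈ Ioo 0 δ, φ.IsVariationAt ι X g z₀ p₀ t) {t : ℝ}
    (hdom : (t, z₀) ∈ φ.domain ι X) (ht : 0 < t)
    (hp : φ.expMap ι X (t, z₀) ∈ (chartAt (EuclideanHalfSpace (n + 1)) p).source) :
    φ.IsVariationAt ι X g z₀ p t := by
  have hz₀ : (extChartAt (𝓡 n) z₀).symm (extChartAt (𝓡 n) z₀ z₀) = z₀ := extChartAt_to_inv z₀
  obtain ⟨-, T, hT, γ, hγ⟩ := id hdom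
  set R : Set ℝ := {t | ∃ p, φ.IsVariationAt ι X g z₀ p t} with hR
  suffices h : Ioo 0 T ⊆ interior R by
    obtain ⟨p', hp'⟩ := interior_subset (h ⟨ht, hT⟩)
    exact hp'.of_mem_source hu hp
  have hsub : Ioo 0 δ ⊆ interior R :=
    interior_maximal (fun t ht => ⟨p₀, hsmall t ht⟩) isOpen_Ioo
  have hT0 : 0 < T := ht.trans hT
  -- The times with the variation property contain an initial interval, and the local step makes
  -- their interior relatively closed in `Ioo 0 T`.
  refine isPreconnected_Ioo.subset_of_closure_inter_subset isOpen_interior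
    ⟨min δ T / 2, ⟨by positivity, ?_⟩, hsub ⟨by positivity, ?_⟩⟩ ?_
  · linarith [min_le_right δ T]
  · linarith [min_le_left δ T]
  rintro s ⟨hs, hsT⟩
  have hdoms : (s, z₀) ∈ φ.domain ι X := ⟨hsT.1.le, T, hsT.2, γ, hγ⟩
  obtain ⟨ε, hε, hstep⟩ := exists_isVariationAt_iff (g := g) hu hdoms hsT.1
    (mem_chart_source (EuclideanHalfSpace (n + 1)) (φ.expMap ι X (s, z₀)))
  have hcont : ContinuousAt (fun s => φ.expMap ι X (s, z₀)) s :=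
    ((isGeodesicFrom_expMap hu hT0 hγ).isGeodesicOn s hsT).1.contMDiffAt.continuousAt
  have hnear : ∀ᶠ τ in 𝓝 s, τ ∈ Ioo (s - ε) (s + ε) ∧ φ.expMap ι X (τ, z₀) ∈
      (chartAt (EuclideanHalfSpace (n + 1)) (φ.expMap ι X (s, z₀))).source :=
    Filter.Eventually.and (isOpen_Ioo.mem_nhds ⟨by linarith, by linarith⟩) (hcont.preimage_mem_nhds
      (chart_source_mem_nhds (EuclideanHalfSpace (n + 1)) (φ.expMap ι X (s, z₀))))
  obtain ⟨τ, hτR, hτ, hτs⟩ := ((mem_closure_iff_frequently.1 hs).and_eventually hnear).exists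
  obtain ⟨p', hp'⟩ := interior_subset hτR
  have h1 := hstep τ hτ (hp'.of_mem_source hu hτs)
  exact mem_interior.2 ⟨Ioo (s - ε) (s + ε), fun r hr => ⟨_, h1 r hr⟩, isOpen_Ioo,
    ⟨by linarith, by linarith⟩⟩

end Variations

end Finsler
end

noncomputable section

namespace Finsler

open Lagrangian

/-! ### Initial data of the characteristics on the boundary. -/

section Initial

variable {n : ℕ} {M : Type*} [TopologicalSpace M]
  [ChartedSpace (EuclideanHalfSpace (n + 1)) M] [IsManifold (𝓡∂ (n + 1)) ∞ M]
  {N : Type*} [TopologicalSpace N] [ChartedSpace (EuclideanSpace ℝ (Fin n)) N]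

local notation "E" => EuclideanSpace ℝ (Fin (n + 1))

local notation "Z" => EuclideanSpace ℝ (Fin n)

local notation "𝓗" => range (𝓡∂ (n + 1))

variable {φ : Metric n M} {ι : N → M} {X : ∀ z : N, TangentSpace (𝓡∂ (n + 1)) (ι z)} {g : N → ℝ}
  {z₀ : N} {ζ : EuclideanSpace ℝ (Fin n)}

variable (ι z₀) in
/-- The parameters whose characteristic starts in the chart at `ι z₀`. -/
def paramDomain : Set (EuclideanSpace ℝ (Fin n)) :=
  {ζ | ζ ∈ (extChartAt (𝓡 n) z₀).target ∧ ι ((extChartAt (𝓡 n) z₀).symm ζ) ∈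
    (chartAt (EuclideanHalfSpace (n + 1)) (ι z₀)).source}

variable (X z₀) in
/-- The initial velocities of the characteristics in the chart at `ι z₀`. -/
def initialCoord (ζ : EuclideanSpace ℝ (Fin n)) :
    EuclideanSpace ℝ (Fin (n + 1)) × EuclideanSpace ℝ (Fin (n + 1)) :=
  tchart (ι z₀) ⟨ι ((extChartAt (𝓡 n) z₀).symm ζ), X ((extChartAt (𝓡 n) z₀).symm ζ)⟩

lemma isOpen_paramDomain (hι : IsBoundary (n := n) ι) : IsOpen (paramDomain (n := n) ι z₀) :=
  (hι.smooth.continuous.comp_continuousOn (continuousOn_extChartAt_symm z₀)).isOpen_inter_preimage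
    (isOpen_extChartAt_target z₀) (chartAt (EuclideanHalfSpace (n + 1)) (ι z₀)).open_source

lemma mem_paramDomain_self : extChartAt (𝓡 n) z₀ z₀ ∈ paramDomain (n := n) ι z₀ := by
  refine ⟨mem_extChartAt_target z₀, ?_⟩
  rw [extChartAt_to_inv]
  exact mem_chart_source _ _

lemma initialCoord_fst : (initialCoord X z₀ ζ).1 =
    extChartAt (𝓡∂ (n + 1)) (ι z₀) (ι ((extChartAt (𝓡 n) z₀).symm ζ)) := tchart_fst _ _

lemma initialCoord_mem (hX : φ.IsCharacteristicField ι g X)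
    (hζ : ζ ∈ paramDomain (n := n) ι z₀) :
    initialCoord X z₀ ζ ∈ stateDomain (n := n) (ι z₀) :=
  tchart_mem_stateDomain hζ.2 (vector_ne_zero_of_unit hX.unit _)

lemma tchart_symm_initialCoord (hζ : ζ ∈ paramDomain (n := n) ι z₀) :
    (tchart (ι z₀)).symm (initialCoord X z₀ ζ) =
      ⟨ι ((extChartAt (𝓡 n) z₀).symm ζ), X ((extChartAt (𝓡 n) z₀).symm ζ)⟩ :=
  (tchart (ι z₀)).left_inv (mem_tchart_source.2 hζ.2)

lemma mem_chartInterior_of_pos {p : M} {x : E} (hx : x ∈ (extChartAt (𝓡∂ (n + 1)) p).target)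
    (h0 : 0 < x 0) : x ∈ chartInterior (n := n) p := by
  have h1 : (𝓗 : Set E) ∈ 𝓝 x := by
    rw [range_modelWithCornersEuclideanHalfSpace]
    have h2 : ContinuousAt (fun y : E => y 0) x := (EuclideanSpace.proj 0).continuous.continuousAt
    filter_upwards [h2.eventually (lt_mem_nhds h0)] with y hy using hy.le
  refine mem_interior_iff_mem_nhds.2 ?_
  have h3 := extChartAt_target_mem_nhdsWithin_of_mem (I := 𝓡∂ (n + 1)) hx
  rwa [nhdsWithin_eq_nhds.2 h1] at h3

lemma mem_halfSpace_iff {x : E} : x ∈ (𝓗 : Set E) ↔ 0 ≤ x 0 := by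
  rw [range_modelWithCornersEuclideanHalfSpace]
  rfl

/-- A positive first coordinate would put the point in the interior of `M`, which is disjoint from
the boundary. -/
lemma initialCoord_fst_zero (hι : IsBoundary (n := n) ι) (hζ : ζ ∈ paramDomain (n := n) ι z₀) :
    (initialCoord X z₀ ζ).1 0 = 0 := by
  have ht : (initialCoord X z₀ ζ).1 ∈ (extChartAt (𝓡∂ (n + 1)) (ι z₀)).target := by
    rw [initialCoord_fst]
    exact (extChartAt (𝓡∂ (n + 1)) (ι z₀)).map_source (by rw [extChartAt_source]; exact hζ.2)
  refine le_antisymm (not_lt.1 fun hpos => ?_)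
    (mem_halfSpace_iff.1 (target_subset_halfSpace _ ht))
  have h1 := mem_chartInterior_of_pos ht hpos
  rw [initialCoord_fst, ← mem_interior_iff hζ.2] at h1
  have h2 : ι ((extChartAt (𝓡 n) z₀).symm ζ) ∈ (𝓡∂ (n + 1)).boundary M := by
    rw [← hι.range_eq]
    exact mem_range_self _
  exact disjoint_left.1 ModelWithCorners.disjoint_interior_boundary h1 h2

/-- At its own centre the preferred chart has identity derivative, so the inward condition can be
read off directly. -/
lemma initialCoord_snd_pos (hX : φ.IsCharacteristicField ι g X) :
    0 < (initialCoord X z₀ (extChartAt (𝓡 n) z₀ z₀)).2 0 := by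
  have h1 : initialCoord X z₀ (extChartAt (𝓡 n) z₀ z₀) = tchart (ι z₀) ⟨ι z₀, X z₀⟩ := by
    rw [initialCoord, extChartAt_to_inv]
  have h2 : ∀ v : TangentSpace (𝓡∂ (n + 1)) (ι z₀), tangentCoord (n := n) (ι z₀) (ι z₀) v = v :=
    fun v => by
      rw [tangentCoord, mfderiv_extChartAt_self]
      rfl
  rw [h1, tchart_mk (mem_chart_source _ _), h2]
  exact hX.inward z₀

variable [IsManifold (𝓡 n) ∞ N]

lemma contMDiffAt_param (hζ : ζ ∈ (extChartAt (𝓡 n) z₀).target) :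
    ContMDiffAt 𝓘(ℝ, Z) (𝓡 n) ∞ (extChartAt (𝓡 n) z₀).symm ζ :=
  (contMDiffOn_extChartAt_symm (I := 𝓡 n) (n := ∞) z₀).contMDiffAt
    ((isOpen_extChartAt_target z₀).mem_nhds hζ)

lemma contDiffAt_initialCoord (hX : φ.IsCharacteristicField ι g X)
    (hζ : ζ ∈ paramDomain (n := n) ι z₀) : ContDiffAt ℝ ∞ (initialCoord X z₀) ζ := by
  have h1 := contMDiffAt_param hζ.1
  have h2 := (hX.smooth ((extChartAt (𝓡 n) z₀).symm ζ)).comp ζ h1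
  have h3 : ContMDiffAt (𝓡∂ (n + 1)).tangent 𝓘(ℝ, E × E) ∞ (tchart (ι z₀))
      ⟨ι ((extChartAt (𝓡 n) z₀).symm ζ), X ((extChartAt (𝓡 n) z₀).symm ζ)⟩ := by
    refine contMDiffAt_extChartAt' ?_
    have h4 := (mem_tchart_source (n := n) (p := ι z₀) (u := ⟨ι ((extChartAt (𝓡 n) z₀).symm ζ),
      X ((extChartAt (𝓡 n) z₀).symm ζ)⟩)).2 hζ.2
    rwa [tchart, extChartAt_source] at h4
  exact (h3.comp ζ h2).contDiffAt

variable (z₀ ζ) in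
/-- The derivative of the inverse of the chart at `z₀`. -/
def paramDeriv : EuclideanSpace ℝ (Fin n) →L[ℝ]
    TangentSpace (𝓡 n) ((extChartAt (𝓡 n) z₀).symm ζ) :=
  mfderiv 𝓘(ℝ, EuclideanSpace ℝ (Fin n)) (𝓡 n) (extChartAt (𝓡 n) z₀).symm ζ

lemma paramDeriv_injective (hζ : ζ ∈ (extChartAt (𝓡 n) z₀).target) {w : Z}
    (hw : paramDeriv z₀ ζ w = 0) : w = 0 := by
  have : IsManifold (𝓡 n) 1 N := IsManifold.of_le (n := ∞) (WithTop.coe_le_coe.2 le_top)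
  have h1 := isInvertible_mfderivWithin_extChartAt_symm (I := 𝓡 n) hζ
  rw [ModelWithCorners.range_eq_univ, mfderivWithin_univ] at h1
  obtain ⟨e, he⟩ := h1
  have h2 : e w = 0 := (DFunLike.congr_fun he w).trans hw
  exact e.map_eq_zero_iff.1 h2

lemma fderiv_comp_param (hg : ContMDiff (𝓡 n) 𝓘(ℝ, ℝ) ∞ g)
    (hζ : ζ ∈ (extChartAt (𝓡 n) z₀).target) (w : Z) :
    fderiv ℝ (g ∘ (extChartAt (𝓡 n) z₀).symm) ζ w =
      mfderiv (𝓡 n) 𝓘(ℝ, ℝ) g ((extChartAt (𝓡 n) z₀).symm ζ) (paramDeriv z₀ ζ w) := by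
  rw [← mfderiv_eq_fderiv, mfderiv_comp ζ ((hg _).mdifferentiableAt (by simp))
    ((contMDiffAt_param hζ).mdifferentiableAt (by simp))]
  rfl

lemma fderiv_initialCoord_fst (hι : IsBoundary (n := n) ι) (hX : φ.IsCharacteristicField ι g X)
    (hζ : ζ ∈ paramDomain (n := n) ι z₀) (w : Z) :
    (fderiv ℝ (initialCoord X z₀) ζ w).1 =
      tangentCoord (ι z₀) (ι ((extChartAt (𝓡 n) z₀).symm ζ))
        (mfderiv (𝓡 n) (𝓡∂ (n + 1)) ι ((extChartAt (𝓡 n) z₀).symm ζ) (paramDeriv z₀ ζ w)) := by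
  have h1 : fderiv ℝ (fun ζ => (initialCoord X z₀ ζ).1) ζ w =
      (fderiv ℝ (initialCoord X z₀) ζ w).1 := by
    have h2 : HasFDerivAt (fun ζ => (initialCoord X z₀ ζ).1) ((ContinuousLinearMap.fst ℝ E E).comp
        (fderiv ℝ (initialCoord X z₀) ζ)) ζ :=
      hasFDerivAt_fst.comp ζ
        ((contDiffAt_initialCoord hX hζ).differentiableAt (by simp)).hasFDerivAt
    rw [h2.fderiv]
    rfl
  have h3 : (fun ζ => (initialCoord X z₀ ζ).1) = extChartAt (𝓡∂ (n + 1)) (ι z₀) ∘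
      (ι ∘ (extChartAt (𝓡 n) z₀).symm) := funext fun ζ => initialCoord_fst
  have h4 := (contMDiffAt_param hζ.1).mdifferentiableAt (by simp)
  have h5 := (hι.smooth ((extChartAt (𝓡 n) z₀).symm ζ)).mdifferentiableAt (by simp)
  have h6 : MDifferentiableAt (𝓡∂ (n + 1)) 𝓘(ℝ, E) (extChartAt (𝓡∂ (n + 1)) (ι z₀))
      ((ι ∘ (extChartAt (𝓡 n) z₀).symm) ζ) := mdifferentiableAt_extChartAt hζ.2
  rw [← h1, h3, ← mfderiv_eq_fderiv, mfderiv_comp ζ h6 (h5.comp ζ h4), mfderiv_comp ζ h5 h4]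
  rfl

/-- The tangential part of the Gauss identity at time 0; the next lemma is its radial part, which
comes from unit speed. -/
lemma momentum_initialCoord (hι : IsBoundary (n := n) ι) (hg : ContMDiff (𝓡 n) 𝓘(ℝ, ℝ) ∞ g)
    (hX : φ.IsCharacteristicField ι g X) (hζ : ζ ∈ paramDomain (n := n) ι z₀) (w : Z) :
    momentum 𝓗 (φ.energy (ι z₀)) (initialCoord X z₀ ζ) (fderiv ℝ (initialCoord X z₀) ζ w).1 =
      fderiv ℝ (g ∘ (extChartAt (𝓡 n) z₀).symm) ζ w := by
  rw [fderiv_initialCoord_fst hι hX hζ, fderiv_comp_param hg hζ.1, ← hX.dual_eq,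
    dual_eq_momentum hζ.2 (vector_ne_zero_of_unit hX.unit _)]
  rfl

lemma momentum_initialCoord_self (hX : φ.IsCharacteristicField ι g X)
    (hζ : ζ ∈ paramDomain (n := n) ι z₀) :
    momentum 𝓗 (φ.energy (ι z₀)) (initialCoord X z₀ ζ) (initialCoord X z₀ ζ).2 = 1 := by
  rw [momentum_self (initialCoord_mem hX hζ)]
  have h1 := energy_tchart (φ := φ) (p := ι z₀) (u := ⟨ι ((extChartAt (𝓡 n) z₀).symm ζ),
    X ((extChartAt (𝓡 n) z₀).symm ζ)⟩) hζ.2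
  rw [hX.unit] at h1
  rw [initialCoord, h1]
  norm_num

/-- The initial positions and velocities span a complement of the fibre. -/
lemma initialCoord_immersive (hι : IsBoundary (n := n) ι) (hX : φ.IsCharacteristicField ι g X)
    {w : ℝ × Z} (hw : w.1 • (initialCoord X z₀ (extChartAt (𝓡 n) z₀ z₀)).2 +
      (fderiv ℝ (initialCoord X z₀) (extChartAt (𝓡 n) z₀ z₀) w.2).1 = 0) : w = 0 := by
  set ζ₀ := extChartAt (𝓡 n) z₀ z₀ with hζ₀
  have hζ : ζ₀ ∈ paramDomain (n := n) ι z₀ := mem_paramDomain_self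
  -- Boundary variations have no normal component, whereas the initial velocity has a positive one.
  -- This forces the time component of `w` to vanish, and the rest follows from the immersion.
  have h0 : (fderiv ℝ (initialCoord X z₀) ζ₀ w.2).1 0 = 0 := by
    let ℓ : (E × E) →L[ℝ] ℝ := (EuclideanSpace.proj (0 : Fin (n + 1))).comp
      (ContinuousLinearMap.fst ℝ E E)
    have h1 : HasFDerivAt (fun ζ => ℓ (initialCoord X z₀ ζ))
        (ℓ.comp (fderiv ℝ (initialCoord X z₀) ζ₀)) ζ₀ :=
      ℓ.hasFDerivAt.comp ζ₀
        ((contDiffAt_initialCoord hX hζ).differentiableAt (by simp)).hasFDerivAt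
    have h2 : (fun ζ => ℓ (initialCoord X z₀ ζ)) =ᶠ[𝓝 ζ₀] fun _ => 0 := by
      filter_upwards [(isOpen_paramDomain hι).mem_nhds hζ] with ζ h3
      exact initialCoord_fst_zero hι h3
    exact DFunLike.congr_fun (h1.unique ((hasFDerivAt_const (0 : ℝ) ζ₀).congr_of_eventuallyEq h2))
      w.2
  have h1 : w.1 = 0 := by
    have h2 := congrArg (fun v : E => v 0) hw
    simp only [PiLp.add_apply, PiLp.smul_apply, PiLp.zero_apply, h0, add_zero, smul_eq_mul] at h2
    exact (mul_eq_zero.1 h2).resolve_right (initialCoord_snd_pos hX).ne'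
  rw [h1, zero_smul, zero_add, fderiv_initialCoord_fst hι hX hζ] at hw
  obtain ⟨e, he⟩ := isInvertible_mfderiv_extChartAt (I := 𝓡∂ (n + 1)) (x := ι z₀)
    (y := ι ((extChartAt (𝓡 n) z₀).symm ζ₀)) (by rw [extChartAt_source]; exact hζ.2)
  rw [tangentCoord, ← he] at hw
  have h3 := e.map_eq_zero_iff.1 hw
  have h4 := (injective_iff_map_eq_zero (mfderiv (𝓡 n) (𝓡∂ (n + 1)) ι
    ((extChartAt (𝓡 n) z₀).symm ζ₀))).1 (hι.immersive _) _ h3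
  exact Prod.ext h1 (paramDeriv_injective hζ.1 h4)

end Initial

end Finsler
end

noncomputable section

namespace Finsler

open Lagrangian

/-! ### The flow out of the boundary. -/

section Boundary

variable {n : ℕ} {M : Type*} [TopologicalSpace M]
  [ChartedSpace (EuclideanHalfSpace (n + 1)) M] [IsManifold (𝓡∂ (n + 1)) ∞ M]
  {N : Type*} [TopologicalSpace N] [ChartedSpace (EuclideanSpace ℝ (Fin n)) N]
  [IsManifold (𝓡 n) ∞ N]

local notation "E" => EuclideanSpace ℝ (Fin (n + 1))

local notation "Z" => EuclideanSpace ℝ (Fin n)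

local notation "𝓗" => range (𝓡∂ (n + 1))

variable {φ : Metric n M} {ι : N → M} {X : ∀ z : N, TangentSpace (𝓡∂ (n + 1)) (ι z)} {g : N → ℝ}
  {z₀ : N}

/-- The family of trajectories starting at the boundary. -/
lemma exists_boundary_family (hι : IsBoundary (n := n) ι) (hX : φ.IsCharacteristicField ι g X)
    (z₀ : N) : ∃ (Ξ : ℝ × Z → E × E) (δ : ℝ) (O : Set Z), 0 < δ ∧ IsOpen O ∧
      extChartAt (𝓡 n) z₀ z₀ ∈ O ∧ O ⊆ paramDomain (n := n) ι z₀ ∧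
      (∀ ζ ∈ O, Ξ (0, ζ) = initialCoord X z₀ ζ ∧ ∀ t ∈ Ico 0 δ, ContDiffAt ℝ 2 Ξ (t, ζ) ∧
        HasDerivAt (fun t => Ξ (t, ζ)) (sprayField 𝓗 (φ.energy (ι z₀)) (Ξ (t, ζ))) t ∧
        (0 < t → Ξ (t, ζ) ∈ interiorState (n := n) (ι z₀))) := by
  set p := ι z₀ with hp
  set ζ₀ := extChartAt (𝓡 n) z₀ z₀ with hζ₀
  have hζ₀mem : ζ₀ ∈ paramDomain (n := n) ι z₀ := mem_paramDomain_self
  set ξ₀ : Z → E × E := initialCoord X z₀ with hξ₀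
  have hq₀ : ξ₀ ζ₀ ∈ stateDomain (n := n) p := initialCoord_mem hX hζ₀mem
  obtain ⟨G, hG, hGs⟩ := exists_extend_sprayField (φ := φ) hq₀
  obtain ⟨U, hUo, hUm, hU⟩ := mem_nhdsWithin.1
    (extChartAt_target_mem_nhdsWithin_of_mem (I := 𝓡∂ (n + 1)) hq₀.1)
  -- Positivity is recorded for the field `G` and not for the velocity coordinate, since outside the
  -- half space the extension need not have the form of a second order equation.
  have hGpos : 0 < (G (ξ₀ ζ₀)).1 0 := by
    rw [hGs _ (target_subset_halfSpace p hq₀.1)]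
    exact initialCoord_snd_pos hX
  have hW : ∀ᶠ q : E × E in 𝓝 (ξ₀ ζ₀), q.1 ∈ U ∧ q.2 ≠ 0 ∧ 0 < (G q).1 0 := by
    have h1 : ContinuousAt (fun q => (G q).1 0) (ξ₀ ζ₀) :=
      ((EuclideanSpace.proj (0 : Fin (n + 1))).continuous.comp
        continuous_fst).continuousAt.comp hG.continuousAt
    filter_upwards [continuous_fst.continuousAt.preimage_mem_nhds (hUo.mem_nhds hUm),
      continuous_snd.continuousAt.preimage_mem_nhds (isOpen_compl_singleton.mem_nhds hq₀.2),
      h1.eventually (lt_mem_nhds hGpos)] with q h2 h3 h4 using ⟨h2, h3, h4⟩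
  obtain ⟨Φ, δ, B, hδ, hBo, hB0, hΦ0, hΦ, -⟩ := exists_local_flow hG hW
  have hOo : IsOpen (paramDomain (n := n) ι z₀ ∩ ξ₀ ⁻¹' B) :=
    ContinuousOn.isOpen_inter_preimage
      (fun ζ hζ => (contDiffAt_initialCoord hX hζ).continuousAt.continuousWithinAt)
      (isOpen_paramDomain hι) hBo
  have hI : ∀ t ∈ Ico 0 δ, t ∈ Ioo (-δ) δ := fun t ht => ⟨by linarith [ht.1], ht.2⟩
  refine ⟨fun q => Φ (q.1, ξ₀ q.2), δ, paramDomain (n := n) ι z₀ ∩ ξ₀ ⁻¹' B, hδ, hOo,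
    ⟨hζ₀mem, hB0⟩, inter_subset_left, fun ζ hζ => ⟨hΦ0 _ hζ.2, fun t ht => ?_⟩⟩
  obtain ⟨h1, h2, h3, -⟩ := hΦ t (hI t ht) _ hζ.2
  have hx0 : (ξ₀ ζ).1 0 = 0 := initialCoord_fst_zero hι hζ.1
  have hb : ∀ s ∈ Ico 0 δ, HasDerivAt (fun s => (Φ (s, ξ₀ ζ)).1 0)
      ((G (Φ (s, ξ₀ ζ))).1 0) s := fun s hs =>
    ((EuclideanSpace.proj (0 : Fin (n + 1))).comp
      (ContinuousLinearMap.fst ℝ E E)).hasFDerivAt.comp_hasDerivAt s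
      (hΦ s (hI s hs) _ hζ.2).2.2.1
  -- The normal coordinate starts at 0 and increases, so trajectories enter the interior at once;
  -- there the extended field agrees with the spray.
  have hmono : StrictMonoOn (fun s => (Φ (s, ξ₀ ζ)).1 0) (Ico 0 δ) := by
    refine strictMonoOn_of_deriv_pos (convex_Ico 0 δ)
      (fun s hs => (hb s hs).continuousAt.continuousWithinAt) fun s hs => ?_
    rw [(hb s (interior_subset hs)).deriv]
    exact (hΦ s (hI s (interior_subset hs)) _ hζ.2).2.1.2.2
  have hval : (Φ (0, ξ₀ ζ)).1 0 = 0 := by rw [hΦ0 _ hζ.2, hx0]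
  have hnn : 0 ≤ (Φ (t, ξ₀ ζ)).1 0 := by
    rw [← hval]
    exact hmono.monotoneOn ⟨le_rfl, hδ⟩ ht ht.1
  have hH : (Φ (t, ξ₀ ζ)).1 ∈ (𝓗 : Set E) := mem_halfSpace_iff.2 hnn
  refine ⟨?_, ?_, fun h0 => ⟨?_, h2.2.1⟩⟩
  · have h4 : ContDiffAt ℝ 2 (fun q : ℝ × Z => ξ₀ q.2) (t, ζ) :=
      ContDiffAt.comp (t, ζ) (g := ξ₀) ((contDiffAt_initialCoord hX hζ.1).of_le
        (WithTop.coe_le_coe.2 le_top)) contDiffAt_snd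
    exact ContDiffAt.comp (t, ζ) (g := Φ) h1 (contDiffAt_fst.prodMk h4)
  · rw [← hGs _ hH]
    exact h3
  · refine mem_chartInterior_of_pos (hU ⟨h2.1, hH⟩) ?_
    rw [← hval]
    exact hmono ⟨le_rfl, hδ⟩ ht h0

/-- The characteristics near the boundary. -/
theorem exists_boundary_flowBox [T2Space M] (hι : IsBoundary (n := n) ι)
    (hg : ContMDiff (𝓡 n) 𝓘(ℝ, ℝ) ∞ g) (hX : φ.IsCharacteristicField ι g X) (z₀ : N) :
    ∃ (Ξ : ℝ × Z → E × E) (δ : ℝ) (O : Set Z), 0 < δ ∧ extChartAt (𝓡 n) z₀ z₀ ∈ O ∧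
      φ.IsFlowBox ι X z₀ (ι z₀) 0 δ O Ξ ∧
      (∀ t ∈ Ioo 0 δ, ∀ ζ ∈ O, ∀ w, (fderiv ℝ Ξ (t, ζ) w).1 = 0 → w = 0) ∧
      ∀ t ∈ Ioo 0 δ, ∀ ζ ∈ O, ∀ w : ℝ × Z,
        momentum 𝓗 (φ.energy (ι z₀)) (Ξ (t, ζ)) (fderiv ℝ Ξ (t, ζ) w).1 =
          w.1 + fderiv ℝ (g ∘ (extChartAt (𝓡 n) z₀).symm) ζ w.2 := by
  obtain ⟨Ξ, δ₁, O₁, hδ₁, hO₁, hζ₁, hsub, hΞ⟩ := exists_boundary_family hι hX z₀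
  set p := ι z₀ with hp
  set ζ₀ := extChartAt (𝓡 n) z₀ z₀ with hζ₀
  have hder0 : ∀ ζ ∈ O₁, ∀ w : ℝ × Z, fderiv ℝ Ξ (0, ζ) w =
      w.1 • sprayField 𝓗 (φ.energy p) (initialCoord X z₀ ζ) +
        fderiv ℝ (initialCoord X z₀) ζ w.2 := fun ζ hζ w => by
    obtain ⟨h0, hall⟩ := hΞ ζ hζ
    obtain ⟨h1, h2, -⟩ := hall 0 ⟨le_rfl, hδ₁⟩
    have hd := (h1.differentiableAt (by norm_num)).hasFDerivAt
    have hline : HasDerivAt (fun t : ℝ => (t, ζ)) ((1, 0) : ℝ × Z) 0 :=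
      (hasDerivAt_id (0 : ℝ)).prodMk (hasDerivAt_const (0 : ℝ) ζ)
    have h3 : HasDerivAt (fun t => Ξ (t, ζ)) (fderiv ℝ Ξ (0, ζ) (1, 0)) 0 :=
      HasFDerivAt.comp_hasDerivAt (f := fun t : ℝ => (t, ζ)) 0 hd hline
    have h4 : fderiv ℝ Ξ (0, ζ) (1, 0) = sprayField 𝓗 (φ.energy p) (initialCoord X z₀ ζ) := by
      rw [← h0]
      exact h3.unique h2
    have h5 : HasFDerivAt (fun ζ => Ξ (0, ζ))
        ((fderiv ℝ Ξ (0, ζ)).comp (ContinuousLinearMap.inr ℝ ℝ Z)) ζ :=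
      hd.comp ζ (hasFDerivAt_prodMk_right (0 : ℝ) ζ)
    have h6 : initialCoord X z₀ =ᶠ[𝓝 ζ] fun ζ => Ξ (0, ζ) := by
      filter_upwards [hO₁.mem_nhds hζ] with ζ' h7 using (hΞ ζ' h7).1.symm
    rw [h6.fderiv_eq, h5.fderiv, ← h4, ContinuousLinearMap.comp_apply, ← map_smul, ← map_add]
    simp
  have hC0 : ContDiffAt ℝ 2 Ξ (0, ζ₀) := ((hΞ ζ₀ hζ₁).2 0 ⟨le_rfl, hδ₁⟩).1
  -- At the boundary the variation of the position is already an isomorphism, and this is an open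
  -- condition. It later excludes conjugate points for small times, uniformly near `z₀`.
  have hinj : ∀ᶠ q in 𝓝 ((0 : ℝ), ζ₀), ∀ w, (fderiv ℝ Ξ q w).1 = 0 → w = 0 := by
    set A : ℝ × Z → (ℝ × Z) →L[ℝ] E := fun q =>
      (ContinuousLinearMap.fst ℝ E E).comp (fderiv ℝ Ξ q) with hA
    have h1 : ContinuousAt A (0, ζ₀) :=
      continuousAt_const.clm_comp (hC0.fderiv_right (m := 1) (by norm_num)).continuousAt
    have h2 : Function.Injective (A (0, ζ₀)) := by
      rw [injective_iff_map_eq_zero]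
      intro w hw
      refine initialCoord_immersive hι hX (z₀ := z₀) ?_
      have h3 : (fderiv ℝ Ξ (0, ζ₀) w).1 = 0 := hw
      rw [hder0 ζ₀ hζ₁] at h3
      exact h3
    have hdim : Module.finrank ℝ (ℝ × Z) = Module.finrank ℝ E := by
      rw [Module.finrank_prod, finrank_euclideanSpace_fin, finrank_euclideanSpace_fin,
        Module.finrank_self, add_comm]
    let e := (LinearEquiv.ofInjectiveOfFinrankEq (A (0, ζ₀)).toLinearMap h2 hdim
      ).toContinuousLinearEquiv
    have h3 : A (0, ζ₀) = (e : (ℝ × Z) →L[ℝ] E) := by ext1 <;> rfl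
    filter_upwards [h1.preimage_mem_nhds (by rw [h3]; exact ContinuousLinearEquiv.nhds e)]
      with q hq w hw
    obtain ⟨e', he'⟩ := hq
    have h4 : e' w = 0 := (DFunLike.congr_fun he' w).trans hw
    exact e'.map_eq_zero_iff.1 h4
  rw [nhds_prod_eq] at hinj
  obtain ⟨I, hI, O₂, hO₂, hinj_box⟩ := mem_prod_iff.1 hinj
  obtain ⟨δ₂, hδ₂, hIδ⟩ := Metric.mem_nhds_iff.1 hI
  rw [Real.ball_eq_Ioo, zero_sub, zero_add] at hIδ
  obtain ⟨O₃, hO₃sub, hO₃, hζ₃⟩ := mem_nhds_iff.1 hO₂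
  have hlt : ∀ t ∈ Ioo 0 (min δ₁ δ₂), t ∈ Ico 0 δ₁ ∧ t ∈ Ioo (-δ₂) δ₂ := fun t ht =>
    ⟨⟨ht.1.le, ht.2.trans_le (min_le_left _ _)⟩, by linarith [ht.1],
      ht.2.trans_le (min_le_right _ _)⟩
  have hlim : ∀ ζ ∈ O₁, Tendsto (fun t => Ξ (t, ζ)) (𝓝[>] 0) (𝓝 (initialCoord X z₀ ζ)) :=
    fun ζ hζ => by
      have h1 := ((hΞ ζ hζ).2 0 ⟨le_rfl, hδ₁⟩).2.1.continuousAt.tendsto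
      rw [(hΞ ζ hζ).1] at h1
      exact h1.mono_left nhdsWithin_le_nhds
  have hbox : φ.IsFlowBox ι X z₀ p 0 (min δ₁ δ₂) (O₁ ∩ O₃) Ξ := by
    have hmem : ∀ t ∈ Ioo 0 (min δ₁ δ₂), ∀ ζ ∈ O₁ ∩ O₃, Ξ (t, ζ) ∈ interiorState (n := n) p :=
      fun t ht ζ hζ => ((hΞ ζ hζ.1).2 t (hlt t ht).1).2.2 ht.1
    have hder : ∀ t ∈ Ioo 0 (min δ₁ δ₂), ∀ ζ ∈ O₁ ∩ O₃,
        HasDerivAt (fun t => Ξ (t, ζ)) (sprayField 𝓗 (φ.energy p) (Ξ (t, ζ))) t :=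
      fun t ht ζ hζ => ((hΞ ζ hζ.1).2 t (hlt t ht).1).2.1
    refine ⟨le_rfl, hO₁.inter hO₃, fun t ht ζ hζ => ((hΞ ζ hζ.1).2 t (hlt t ht).1).1, hder, hmem,
      fun ζ hζ => ?_⟩
    obtain ⟨hη, hηv⟩ := isGeodesicOn_of_chart (φ := φ) (p := p) (c := fun t => Ξ (t, ζ))
      isOpen_Ioo fun t ht => ⟨hder t ht ζ hζ, hmem t ht ζ hζ⟩
    refine ⟨_, hη.isGeodesicFrom ?_, hηv⟩
    have hζp := hsub hζ.1
    have h1 : Tendsto (fun t => (tchart p).symm (Ξ (t, ζ))) (𝓝[>] 0)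
        (𝓝 ((tchart p).symm (initialCoord X z₀ ζ))) := by
      refine ((continuousOn_tchart_symm p) _ (stateDomain_subset_target
        (initialCoord_mem hX hζp))).tendsto.comp (tendsto_nhdsWithin_iff.2 ⟨hlim ζ hζ.1, ?_⟩)
      filter_upwards [Ioo_mem_nhdsGT (lt_min hδ₁ hδ₂)] with t ht
      exact stateDomain_subset_target (interiorState_subset p (hmem t ht ζ hζ))
    rw [tchart_symm_initialCoord hζp] at h1
    refine h1.congr' ?_
    filter_upwards [Ioo_mem_nhdsGT (lt_min hδ₁ hδ₂)] with t ht using (hηv t ht).symm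
  refine ⟨Ξ, min δ₁ δ₂, O₁ ∩ O₃, lt_min hδ₁ hδ₂, ⟨hζ₁, hζ₃⟩, hbox, fun t ht ζ hζ =>
    hinj_box (mk_mem_prod (hIδ (hlt t ht).2) (hO₃sub hζ.2)), fun t ht ζ hζ w => ?_⟩
  have hζp := hsub hζ.1
  have hstate := initialCoord_mem hX hζp
  have hP : Tendsto (fun t => momentum 𝓗 (φ.energy p) (Ξ (t, ζ))) (𝓝[>] 0)
      (𝓝 (momentum 𝓗 (φ.energy p) (initialCoord X z₀ ζ))) := by
    refine (contDiffWithinAt_momentum uniqueDiffOn_halfSpace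
      (target_subset_halfSpace p hstate.1)
      (contDiffWithinAt_energy hstate)).continuousWithinAt.tendsto.comp
      (tendsto_nhdsWithin_iff.2 ⟨hlim ζ hζ.1, ?_⟩)
    filter_upwards [Ioo_mem_nhdsGT (lt_min hδ₁ hδ₂)] with t ht
    exact ⟨interior_subset (fst_mem_interior (hbox.mem t ht ζ hζ)), mem_univ _⟩
  have hD : Tendsto (fun t => (fderiv ℝ Ξ (t, ζ) w).1) (𝓝[>] 0)
      (𝓝 (fderiv ℝ Ξ (0, ζ) w).1) := by
    have h1 : ContinuousAt (fderiv ℝ Ξ) (0, ζ) :=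
      (((hΞ ζ hζ.1).2 0 ⟨le_rfl, hδ₁⟩).1.fderiv_right (m := 1) (by norm_num)).continuousAt
    have h2 : ContinuousAt (fun t : ℝ => fderiv ℝ Ξ (t, ζ)) 0 :=
      ContinuousAt.comp (f := fun t : ℝ => (t, ζ)) h1 (by fun_prop)
    exact (continuous_fst.continuousAt.tendsto.comp
      (h2.clm_apply continuousAt_const).tendsto).mono_left nhdsWithin_le_nhds
  -- The pairing is constant for positive times, so the Gauss identity follows from its limit at t =
  -- 0, where the initial data determine it.
  have hlim2 : Tendsto (fun t => momentum 𝓗 (φ.energy p) (Ξ (t, ζ)) (fderiv ℝ Ξ (t, ζ) w).1)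
      (𝓝[>] 0) (𝓝 (momentum 𝓗 (φ.energy p) (initialCoord X z₀ ζ) (fderiv ℝ Ξ (0, ζ) w).1)) :=
    isBoundedBilinearMap_apply.continuous.continuousAt.tendsto.comp
      (hP.prodMk_nhds hD)
  have hval : momentum 𝓗 (φ.energy p) (initialCoord X z₀ ζ) (fderiv ℝ Ξ (0, ζ) w).1 =
      w.1 + fderiv ℝ (g ∘ (extChartAt (𝓡 n) z₀).symm) ζ w.2 := by
    rw [hder0 ζ hζ.1, ← momentum_initialCoord hι hg hX hζp]
    have h1 : (w.1 • sprayField 𝓗 (φ.energy p) (initialCoord X z₀ ζ) +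
        fderiv ℝ (initialCoord X z₀) ζ w.2).1 = w.1 • (initialCoord X z₀ ζ).2 +
        (fderiv ℝ (initialCoord X z₀) ζ w.2).1 := rfl
    rw [h1, map_add, map_smul, momentum_initialCoord_self hX hζp, smul_eq_mul, mul_one]
  rw [hval] at hlim2
  refine tendsto_nhds_unique (Tendsto.congr' ?_ tendsto_const_nhds) hlim2
  filter_upwards [Ioo_mem_nhdsGT (lt_min hδ₁ hδ₂)] with s hs
  exact hbox.pairing_eq hX.unit ht hs hζ w

end Boundary

end Finsler
end

noncomputable section

/-! ### Orders of conjugacy computed in charts. -/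

section LinearAlgebra

open Module

/-- The gradient of a linear form, as a linear map. -/
def gradientMap (V : Type*) [NormedAddCommGroup V] [InnerProductSpace ℝ V]
    [FiniteDimensional ℝ V] : (V →L[ℝ] ℝ) →L[ℝ] V :=
  LinearMap.toContinuousLinearMap
    { toFun := fun f => (InnerProductSpace.toDual ℝ V).symm f
      map_add' := fun f f' => map_add _ f f'
      map_smul' := fun c f => by simp }

lemma inner_gradientMap {V : Type*} [NormedAddCommGroup V] [InnerProductSpace ℝ V]
    [FiniteDimensional ℝ V] (f : V →L[ℝ] ℝ) (v : V) : inner ℝ (gradientMap V f) v = f v :=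
  InnerProductSpace.toDual_symm_apply

lemma finrank_ker_eq_of_conj {V V' W W' : Type*} [AddCommGroup V] [Module ℝ V] [AddCommGroup V']
    [Module ℝ V'] [AddCommGroup W] [Module ℝ W] [AddCommGroup W'] [Module ℝ W'] {A : V →ₗ[ℝ] W}
    {B : V' →ₗ[ℝ] W'} (e : V ≃ₗ[ℝ] V') (e' : W ≃ₗ[ℝ] W') (h : ∀ w, e' (A w) = B (e w)) :
    finrank ℝ (LinearMap.ker A) = finrank ℝ (LinearMap.ker B) := by
  have hker : LinearMap.ker A = (LinearMap.ker B).comap e.toLinearMap := by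
    ext w
    rw [LinearMap.mem_ker, Submodule.mem_comap, LinearMap.mem_ker, LinearEquiv.coe_coe, ← h,
      e'.map_eq_zero_iff]
  rw [hker]
  exact (LinearEquiv.ofSubmodule' e _).finrank_eq

end LinearAlgebra

namespace Finsler

open Lagrangian Module

section Conjugate

variable {n : ℕ} {M : Type*} [TopologicalSpace M]
  [ChartedSpace (EuclideanHalfSpace (n + 1)) M] [IsManifold (𝓡∂ (n + 1)) ∞ M]
  {N : Type*} [TopologicalSpace N] [ChartedSpace (EuclideanSpace ℝ (Fin n)) N]

local notation "E" => EuclideanSpace ℝ (Fin (n + 1))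

local notation "Z" => EuclideanSpace ℝ (Fin n)

local notation "𝓗" => range (𝓡∂ (n + 1))

variable (φ : Metric n M) (ι : N → M) (X : ∀ z : N, TangentSpace (𝓡∂ (n + 1)) (ι z))

/-- The variation of the position of the characteristics in charts. -/
def Metric.positionDeriv (z₀ : N) (p : M) (q : ℝ × EuclideanSpace ℝ (Fin n)) :
    (ℝ × EuclideanSpace ℝ (Fin n)) →L[ℝ] EuclideanSpace ℝ (Fin (n + 1)) :=
  (ContinuousLinearMap.fst ℝ E E).comp (fderiv ℝ (φ.stateCoord ι X z₀ p) q)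

/-- The variation of the momentum of the characteristics in charts. -/
def Metric.momentumDeriv (z₀ : N) (p : M) (q : ℝ × EuclideanSpace ℝ (Fin n)) :
    (ℝ × EuclideanSpace ℝ (Fin n)) →L[ℝ] EuclideanSpace ℝ (Fin (n + 1)) :=
  (gradientMap E).comp
    (fderiv ℝ (fun q => momentum 𝓗 (φ.energy p) (φ.stateCoord ι X z₀ p q)) q)

variable {φ ι X} {g : N → ℝ} {z₀ : N} {p : M} {t₀ : ℝ}

lemma stateCoord_fst (q : ℝ × Z) : (φ.stateCoord ι X z₀ p q).1 =
    extChartAt (𝓡∂ (n + 1)) p (φ.expMap ι X (q.1, (extChartAt (𝓡 n) z₀).symm q.2)) :=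
  tchart_fst _ _

lemma Metric.IsVariationAt.eventually_mem [T2Space M] (hu : ∀ z, φ.toFun ⟨ι z, X z⟩ = 1)
    (h : φ.IsVariationAt ι X g z₀ p t₀) :
    ∀ᶠ q in 𝓝 (t₀, extChartAt (𝓡 n) z₀ z₀),
      φ.stateCoord ι X z₀ p q ∈ interiorState (n := n) p := by
  filter_upwards [h.domain] with q hq using (stateCoord_mem hu hq.1 hq.2.1 hq.2.2).1

/-- The conjugate points are the singularities of the exponential map in charts. -/
lemma order_eq_finrank [T2Space M] [IsManifold (𝓡 n) ∞ N] (hu : ∀ z, φ.toFun ⟨ι z, X z⟩ = 1)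
    {x : ℝ × N} (hx : x.2 ∈ (chartAt (EuclideanSpace ℝ (Fin n)) z₀).source)
    (hdom : ∀ᶠ q in 𝓝 (x.1, extChartAt (𝓡 n) z₀ x.2),
      (q.1, (extChartAt (𝓡 n) z₀).symm q.2) ∈ φ.domain ι X ∧ 0 < q.1 ∧
        φ.expMap ι X (q.1, (extChartAt (𝓡 n) z₀).symm q.2) ∈
          (chartAt (EuclideanHalfSpace (n + 1)) p).source)
    (hd : DifferentiableAt ℝ (φ.stateCoord ι X z₀ p) (x.1, extChartAt (𝓡 n) z₀ x.2)) :
    φ.order ι X x = finrank ℝ (LinearMap.ker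
      (φ.positionDeriv ι X z₀ p (x.1, extChartAt (𝓡 n) z₀ x.2)).toLinearMap) := by
  have : IsManifold (𝓡 n) 1 N := IsManifold.of_le (n := ∞) (WithTop.coe_le_coe.2 le_top)
  set Θ := extChartAt (𝓘(ℝ, ℝ).prod (𝓡 n)) ((x.1, z₀) : ℝ × N) with hΘ
  have hΘe : ∀ y : ℝ × N, Θ y = (y.1, extChartAt (𝓡 n) z₀ y.2) := fun y => by
    simp [hΘ, chartAt_self_eq]
  have hxs : x ∈ Θ.source := by
    simp only [hΘ, extChartAt_prod, PartialEquiv.prod_source, mem_prod, extChartAt_source]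
    exact ⟨mem_univ _, hx⟩
  have hxs' : x ∈ (chartAt (ModelProd ℝ (EuclideanSpace ℝ (Fin n)))
      ((x.1, z₀) : ℝ × N)).source := by
    rw [← extChartAt_source (𝓘(ℝ, ℝ).prod (𝓡 n))]
    exact hxs
  have hΘc : ContinuousAt Θ x := continuousAt_extChartAt' hxs
  have hΘd : MDifferentiableAt (𝓘(ℝ, ℝ).prod (𝓡 n)) 𝓘(ℝ, ℝ × Z) Θ x :=
    mdifferentiableAt_extChartAt hxs'
  obtain ⟨e, he⟩ := isInvertible_mfderiv_extChartAt (I := 𝓘(ℝ, ℝ).prod (𝓡 n)) hxs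
  set ξ : ℝ × Z → E := fun q => (φ.stateCoord ι X z₀ p q).1 with hξ
  have hξd : HasFDerivAt ξ (φ.positionDeriv ι X z₀ p (Θ x)) (Θ x) := by
    rw [hΘe]
    exact hasFDerivAt_fst.comp _ hd.hasFDerivAt
  have hnear : ∀ᶠ y in 𝓝 x, φ.expMap ι X y ∈ (chartAt (EuclideanHalfSpace (n + 1)) p).source ∧
      extChartAt (𝓡∂ (n + 1)) p (φ.expMap ι X y) = ξ (Θ y) := by
    filter_upwards [hΘc.eventually (by rw [hΘe]; exact hdom),
      (isOpen_extChartAt_source (I := 𝓘(ℝ, ℝ).prod (𝓡 n)) ((x.1, z₀) : ℝ × N)).mem_nhds hxs]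
      with y hy hys
    have hy2 : y.2 ∈ (extChartAt (𝓡 n) z₀).source := by
      simp only [extChartAt_prod, PartialEquiv.prod_source, mem_prod] at hys
      exact hys.2
    rw [hΘe] at hy ⊢
    simp only [(extChartAt (𝓡 n) z₀).left_inv hy2] at hy
    refine ⟨hy.2.2, ?_⟩
    simp only [hξ, stateCoord_fst, (extChartAt (𝓡 n) z₀).left_inv hy2]
  have hself := hnear.self_of_nhds
  have hint : ξ (Θ x) ∈ chartInterior (n := n) p := by
    rw [hΘe]
    have h1 := hdom.self_of_nhds
    exact (stateCoord_mem hu h1.1 h1.2.1 h1.2.2).1.1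
  have hcomp : MDifferentiableAt (𝓘(ℝ, ℝ).prod (𝓡 n)) 𝓘(ℝ, E) (ξ ∘ Θ) x :=
    MDifferentiableAt.comp x hξd.differentiableAt.mdifferentiableAt hΘd
  have hF : MDifferentiableAt (𝓘(ℝ, ℝ).prod (𝓡 n)) (𝓡∂ (n + 1)) (φ.expMap ι X) x := by
    have h1 : MDifferentiableAt 𝓘(ℝ, E) (𝓡∂ (n + 1)) (extChartAt (𝓡∂ (n + 1)) p).symm
        ((ξ ∘ Θ) x) :=
      ((contMDiffOn_extChartAt_symm (I := 𝓡∂ (n + 1)) (n := ∞) p).contMDiffAt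
        (mem_interior_iff_mem_nhds.1 hint)).mdifferentiableAt (by simp)
    refine (MDifferentiableAt.comp x h1 hcomp).congr_of_eventuallyEq ?_
    filter_upwards [hnear] with y hy
    rw [Function.comp_apply, Function.comp_apply, ← hy.2,
      (extChartAt (𝓡∂ (n + 1)) p).left_inv (by rw [extChartAt_source]; exact hy.1)]
  have hchart : MDifferentiableAt (𝓡∂ (n + 1)) 𝓘(ℝ, E) (extChartAt (𝓡∂ (n + 1)) p)
      (φ.expMap ι X x) := mdifferentiableAt_extChartAt hself.1
  obtain ⟨e', he'⟩ := isInvertible_mfderiv_extChartAt (I := 𝓡∂ (n + 1)) (x := p)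
    (y := φ.expMap ι X x) (by rw [extChartAt_source]; exact hself.1)
  -- By the chain rule the differential of the exponential map is conjugate, through the invertible
  -- derivatives of the charts, to the variation of the position.
  have hkey : ∀ w, e' (mfderiv (𝓘(ℝ, ℝ).prod (𝓡 n)) (𝓡∂ (n + 1)) (φ.expMap ι X) x w) =
      φ.positionDeriv ι X z₀ p (Θ x) (e w) := fun w => by
    have h1 : extChartAt (𝓡∂ (n + 1)) p ∘ φ.expMap ι X =ᶠ[𝓝 x] ξ ∘ Θ :=
      hnear.mono fun y hy => hy.2
    have h2 := h1.mfderiv_eq (I := 𝓘(ℝ, ℝ).prod (𝓡 n)) (I' := 𝓘(ℝ, E))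
    rw [mfderiv_comp x hchart hF,
      mfderiv_comp x hξd.differentiableAt.mdifferentiableAt hΘd, mfderiv_eq_fderiv,
      hξd.fderiv, ← he, ← he'] at h2
    exact DFunLike.congr_fun h2 w
  rw [Metric.order, ← hΘe]
  exact finrank_ker_eq_of_conj e.toLinearEquiv e'.toLinearEquiv hkey

end Conjugate

end Finsler
end

noncomputable section

namespace Finsler

open Lagrangian Module

/-! ### The local index of conjugate points. -/

section Index

variable {n : ℕ} {M : Type*} [TopologicalSpace M] [T2Space M]
  [ChartedSpace (EuclideanHalfSpace (n + 1)) M] [IsManifold (𝓡∂ (n + 1)) ∞ M]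
  {N : Type*} [TopologicalSpace N] [ChartedSpace (EuclideanSpace ℝ (Fin n)) N]

local notation "E" => EuclideanSpace ℝ (Fin (n + 1))

local notation "Z" => EuclideanSpace ℝ (Fin n)

local notation "𝓗" => range (𝓡∂ (n + 1))

variable {φ : Metric n M} {ι : N → M} {X : ∀ z : N, TangentSpace (𝓡∂ (n + 1)) (ι z)} {g : N → ℝ}
  {z₀ : N} {p : M} {t₀ : ℝ}

lemma Metric.IsVariationAt.eventually_velocity (hu : ∀ z, φ.toFun ⟨ι z, X z⟩ = 1)
    (h : φ.IsVariationAt ι X g z₀ p t₀) :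
    ∀ᶠ q in 𝓝 (t₀, extChartAt (𝓡 n) z₀ z₀),
      (fderiv ℝ (φ.stateCoord ι X z₀ p) q (1, 0)).1 = (φ.stateCoord ι X z₀ p q).2 := by
  filter_upwards [h.domain, h.contDiffAt.eventually (by simp)] with q hq hc
  obtain ⟨T, hT, hgeo⟩ := exists_isGeodesicFrom_expMap hu hq.1
  have h1 := hgeo.isGeodesicOn.hasDerivAt (show q.1 ∈ Ioo 0 T from ⟨hq.2.1, hT⟩) hq.2.2
  have hline : HasDerivAt (fun t : ℝ => (t, q.2)) ((1, 0) : ℝ × Z) q.1 :=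
    (hasDerivAt_id q.1).prodMk (hasDerivAt_const q.1 q.2)
  have h2 : HasDerivAt (fun t => φ.stateCoord ι X z₀ p (t, q.2))
      (fderiv ℝ (φ.stateCoord ι X z₀ p) q (1, 0)) q.1 :=
    HasFDerivAt.comp_hasDerivAt (f := fun t : ℝ => (t, q.2)) q.1
      (hc.differentiableAt (by norm_num)).hasFDerivAt hline
  rw [h2.unique h1]
  rfl

lemma contDiffAt_momentum_energy {q : E × E} (hq : q ∈ interiorState (n := n) p) :
    ContDiffAt ℝ ∞ (momentum 𝓗 (φ.energy p)) q :=
  (contDiffWithinAt_momentum uniqueDiffOn_halfSpace (interior_subset (fst_mem_interior hq))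
    (contDiffWithinAt_energy (interiorState_subset p hq))).contDiffAt
    (prod_univ_mem_nhds (fst_mem_interior hq))

lemma Metric.IsVariationAt.contDiffAt_momentum (hu : ∀ z, φ.toFun ⟨ι z, X z⟩ = 1)
    (h : φ.IsVariationAt ι X g z₀ p t₀) :
    ContDiffAt ℝ 2 (fun q => momentum 𝓗 (φ.energy p) (φ.stateCoord ι X z₀ p q))
      (t₀, extChartAt (𝓡 n) z₀ z₀) :=
  ContDiffAt.comp (g := momentum 𝓗 (φ.energy p)) (t₀, extChartAt (𝓡 n) z₀ z₀)
    ((contDiffAt_momentum_energy (h.eventually_mem hu).self_of_nhds).of_le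
      (WithTop.coe_le_coe.2 le_top)) h.contDiffAt

/-- Where the variation of the position vanishes, the variation of the momentum is given by the
Hessian of the energy along the fibres. -/
lemma Metric.IsVariationAt.inner_momentumDeriv (hu : ∀ z, φ.toFun ⟨ι z, X z⟩ = 1)
    (h : φ.IsVariationAt ι X g z₀ p t₀) {w : ℝ × Z}
    (hw : φ.positionDeriv ι X z₀ p (t₀, extChartAt (𝓡 n) z₀ z₀) w = 0) (v : E) :
    inner ℝ (φ.momentumDeriv ι X z₀ p (t₀, extChartAt (𝓡 n) z₀ z₀) w) v =
      fiberHessian 𝓗 (φ.energy p) (φ.stateCoord ι X z₀ p (t₀, extChartAt (𝓡 n) z₀ z₀))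
        (fderiv ℝ (φ.stateCoord ι X z₀ p) (t₀, extChartAt (𝓡 n) z₀ z₀) w).2 v := by
  have hm := (h.eventually_mem hu).self_of_nhds
  have h1 := (hasFDerivAt_momentum (L := φ.energy p) uniqueDiffOn_halfSpace (fst_mem_interior hm)
    (contDiffWithinAt_energy (interiorState_subset p hm))).comp _
    (h.contDiffAt.differentiableAt (by norm_num)).hasFDerivAt
  have h2 : (fderiv ℝ (φ.stateCoord ι X z₀ p) (t₀, extChartAt (𝓡 n) z₀ z₀) w).1 = 0 := hw
  rw [Metric.momentumDeriv, ContinuousLinearMap.comp_apply, inner_gradientMap]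
  refine (DFunLike.congr_fun (DFunLike.congr_fun h1.fderiv w) v).trans ?_
  rw [ContinuousLinearMap.comp_apply, fderivWithin_momentum_apply, h2]
  have h3 : ((0, 0) : E × E) = 0 := rfl
  rw [h3, map_zero, zero_add]

lemma Metric.IsVariationAt.exists_isIndexFor [IsManifold (𝓡 n) ∞ N]
    (hu : ∀ z, φ.toFun ⟨ι z, X z⟩ = 1) (hg : ContMDiff (𝓡 n) 𝓘(ℝ, ℝ) ∞ g)
    (h : φ.IsVariationAt ι X g z₀ p t₀) :
    ∃ s ∈ 𝓝 (t₀, extChartAt (𝓡 n) z₀ z₀), ∃ κ, 0 ≤ κ ∧ ∃ m, IsIndexFor s κ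
      (fun q => finrank ℝ (LinearMap.ker (φ.positionDeriv ι X z₀ p q).toLinearMap)) m := by
  set q₀ := (t₀, extChartAt (𝓡 n) z₀ z₀) with hq₀
  have hm := (h.eventually_mem hu).self_of_nhds
  have hH := fiberHessian_pos (φ := φ) (interiorState_subset p hm)
  have hpd : ∀ᶠ q in 𝓝 q₀, ∀ w, φ.positionDeriv ι X z₀ p q w =
      fderiv ℝ (fun q => (φ.stateCoord ι X z₀ p q).1) q w := by
    filter_upwards [h.contDiffAt.eventually (by simp)] with q hc w
    have h1 : HasFDerivAt (fun q => (φ.stateCoord ι X z₀ p q).1) (φ.positionDeriv ι X z₀ p q) q :=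
      hasFDerivAt_fst.comp q (hc.differentiableAt (by norm_num)).hasFDerivAt
    rw [h1.fderiv]
  have hA : ContDiffAt ℝ 1 (φ.positionDeriv ι X z₀ p) q₀ :=
    contDiffAt_const.clm_comp (h.contDiffAt.fderiv_right (by norm_num))
  have hB : ContDiffAt ℝ 1 (φ.momentumDeriv ι X z₀ p) q₀ :=
    contDiffAt_const.clm_comp ((h.contDiffAt_momentum hu).fderiv_right (by norm_num))
  have htarget : ∀ᶠ q : ℝ × Z in 𝓝 q₀, q.2 ∈ (extChartAt (𝓡 n) z₀).target :=
    continuous_snd.continuousAt.preimage_mem_nhds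
      ((isOpen_extChartAt_target z₀).mem_nhds (mem_extChartAt_target z₀))
  set f : ℝ × Z → ℝ := fun q => q.1 + (g ∘ (extChartAt (𝓡 n) z₀).symm) q.2 with hf
  have hgc : ∀ ζ ∈ (extChartAt (𝓡 n) z₀).target,
      ContDiffAt ℝ ∞ (g ∘ (extChartAt (𝓡 n) z₀).symm) ζ := fun ζ hζ =>
    ((hg _).comp ζ (contMDiffAt_param hζ)).contDiffAt
  have hfd : ∀ q : ℝ × Z, q.2 ∈ (extChartAt (𝓡 n) z₀).target → ContDiffAt ℝ 2 f q ∧ ∀ w,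
      fderiv ℝ f q w = w.1 + fderiv ℝ (g ∘ (extChartAt (𝓡 n) z₀).symm) q.2 w.2 := fun q hq => by
    have h1 := hgc q.2 hq
    refine ⟨contDiffAt_fst.add (ContDiffAt.comp (g := g ∘ (extChartAt (𝓡 n) z₀).symm) q
      (h1.of_le (WithTop.coe_le_coe.2 le_top)) contDiffAt_snd), fun w => ?_⟩
    have h2 : HasFDerivAt f (ContinuousLinearMap.fst ℝ ℝ Z +
        (fderiv ℝ (g ∘ (extChartAt (𝓡 n) z₀).symm) q.2).comp (ContinuousLinearMap.snd ℝ ℝ Z)) q :=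
      hasFDerivAt_fst.add ((h1.differentiableAt (by simp)).hasFDerivAt.comp q hasFDerivAt_snd)
    rw [h2.fderiv]
    rfl
  have hev := ((h.gauss.and htarget).and hpd).eventually_nhds
  -- The remaining goals are equality of dimensions, isotropy from the exactness of d(t + g),
  -- injectivity of the pair, and positivity of the crossing; the last two rest on the positive
  -- fibre Hessian.
  refine exists_isIndexFor_of_lagrangian (B := φ.momentumDeriv ι X z₀ p) ?_ hA hB ?_ ?_ ?_
  · rw [Module.finrank_prod, finrank_euclideanSpace_fin, finrank_euclideanSpace_fin,
      Module.finrank_self, add_comm]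
  · filter_upwards [hev, h.contDiffAt.eventually (by simp),
      (h.contDiffAt_momentum hu).eventually (by simp)] with q h1 h2 h3 w w'
    have h4 := Filter.Eventually.self_of_nhds h1
    rw [real_inner_comm, real_inner_comm (φ.momentumDeriv ι X z₀ p q w), Metric.momentumDeriv,
      ContinuousLinearMap.comp_apply, ContinuousLinearMap.comp_apply, inner_gradientMap,
      inner_gradientMap, h4.2, h4.2]
    refine fderiv_momentum_symm (x := fun q => (φ.stateCoord ι X z₀ p q).1) (h := f)
      (contDiffAt_fst.comp q h2)
      (h3.differentiableAt (by norm_num)) (hfd q h4.1.2).1 ?_ w' w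
    filter_upwards [h1] with q' h5 w
    rw [← h5.2, (hfd q' h5.1.2).2, ← h5.1.1]
    rfl
  · intro w hw hBw
    refine h.injective w (Prod.ext hw ?_)
    by_contra hne
    have h1 := hH _ hne
    rw [← h.inner_momentumDeriv hu hw, hBw, inner_zero_left] at h1
    exact lt_irrefl _ h1
  · intro w hw0 hw
    -- The position variation of `w` vanishes, so its velocity variation cannot. The latter is the
    -- time derivative of the former, and the Hessian is evaluated on it.
    have hne : (fderiv ℝ (φ.stateCoord ι X z₀ p) q₀ w).2 ≠ 0 := fun h0 =>
      hw0 (h.injective w (Prod.ext hw h0))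
    have hline : HasDerivAt (fun t : ℝ => (t, q₀.2)) ((1, 0) : ℝ × Z) q₀.1 :=
      (hasDerivAt_id q₀.1).prodMk (hasDerivAt_const q₀.1 q₀.2)
    have h1 : HasDerivAt (fun t => φ.positionDeriv ι X z₀ p (t, q₀.2))
        (fderiv ℝ (φ.positionDeriv ι X z₀ p) q₀ (1, 0)) q₀.1 :=
      HasFDerivAt.comp_hasDerivAt (f := fun t : ℝ => (t, q₀.2)) q₀.1
        (hA.differentiableAt one_ne_zero).hasFDerivAt hline
    have h2 : fderiv ℝ (φ.positionDeriv ι X z₀ p) q₀ (1, 0) w =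
        (fderiv ℝ (φ.stateCoord ι X z₀ p) q₀ w).2 := by
      have h3 := h1.clm_apply (hasDerivAt_const q₀.1 w)
      rw [map_zero, add_zero] at h3
      exact h3.unique (hasDerivAt_fderiv_fst h.contDiffAt (h.eventually_velocity hu) w)
    rw [h2, h.inner_momentumDeriv hu hw]
    exact hH _ hne

/-- The flow box at the boundary starts the propagation along the characteristic. -/
lemma isVariationAt_of_mem_domain [IsManifold (𝓡 n) ∞ N] (hι : IsBoundary (n := n) ι)
    (hg : ContMDiff (𝓡 n) 𝓘(ℝ, ℝ) ∞ g) (hX : φ.IsCharacteristicField ι g X)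
    (hdom : (t₀, z₀) ∈ φ.domain ι X) (ht : 0 < t₀)
    (hp : φ.expMap ι X (t₀, z₀) ∈ (chartAt (EuclideanHalfSpace (n + 1)) p).source) :
    φ.IsVariationAt ι X g z₀ p t₀ := by
  obtain ⟨Ξ, δ, O, hδ, hO, hbox, hinj, hgauss⟩ := exists_boundary_flowBox hι hg hX z₀
  refine isVariationAt_of_small (p₀ := ι z₀) hX.unit hδ (fun t ht => ?_) hdom ht hp
  refine hbox.isVariationAt hX.unit hO ht ht (fun w hw => hinj t ht _ hO w ?_) ?_
  · rw [hw]
    rfl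
  · filter_upwards [hbox.isOpen.mem_nhds hO] with ζ hζ using hgauss t ht ζ hζ

lemma Metric.IsVariationAt.eventually_order_eq [IsManifold (𝓡 n) ∞ N]
    (hu : ∀ z, φ.toFun ⟨ι z, X z⟩ = 1) (h : φ.IsVariationAt ι X g z₀ p t₀) :
    ∀ᶠ x in 𝓝 (t₀, z₀), (x ∈ φ.domain ι X ∧ 0 < x.1) ∧
      φ.order ι X x = finrank ℝ (LinearMap.ker
        (φ.positionDeriv ι X z₀ p (x.1, extChartAt (𝓡 n) z₀ x.2)).toLinearMap) := by
  have hc : ContinuousAt (fun x : ℝ × N => (x.1, extChartAt (𝓡 n) z₀ x.2)) (t₀, z₀) :=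
    continuousAt_fst.prodMk ((continuousAt_extChartAt z₀).comp (f := Prod.snd) continuousAt_snd)
  filter_upwards [hc.tendsto.eventually h.domain.eventually_nhds,
    hc.tendsto.eventually (h.contDiffAt.eventually (by simp)),
    continuousAt_snd.preimage_mem_nhds (chart_source_mem_nhds (EuclideanSpace ℝ (Fin n)) z₀)]
    with x h1 h2 h3
  refine ⟨?_, order_eq_finrank hu h3 h1 (h2.differentiableAt (by norm_num))⟩
  have h4 := Filter.Eventually.self_of_nhds h1
  have h5 : (extChartAt (𝓡 n) z₀).symm (extChartAt (𝓡 n) z₀ x.2) = x.2 :=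
    (extChartAt (𝓡 n) z₀).left_inv (by rw [extChartAt_source]; exact h3)
  simp only [h5] at h4
  exact ⟨h4.1, h4.2.1⟩

/-- There are no conjugate points near the boundary. -/
lemma exists_order_eq_zero [IsManifold (𝓡 n) ∞ N] (hι : IsBoundary (n := n) ι)
    (hg : ContMDiff (𝓡 n) 𝓘(ℝ, ℝ) ∞ g) (hX : φ.IsCharacteristicField ι g X) (z₀ : N) :
    ∃ δ > 0, ∀ᶠ z in 𝓝 z₀, ∀ t ∈ Ioo 0 δ, φ.order ι X (t, z) = 0 := by
  obtain ⟨Ξ, δ, O, hδ, hO, hbox, hinj, -⟩ := exists_boundary_flowBox hι hg hX z₀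
  refine ⟨δ, hδ, ?_⟩
  filter_upwards [(continuousAt_extChartAt (I := 𝓡 n) z₀).preimage_mem_nhds
    (hbox.isOpen.mem_nhds hO), chart_source_mem_nhds (EuclideanSpace ℝ (Fin n)) z₀]
    with z hz hzs t ht
  have heq := hbox.stateCoord_eventuallyEq hX.unit ht hz
  rw [order_eq_finrank (z₀ := z₀) (p := ι z₀) hX.unit hzs ?_
    (((hbox.contDiffAt t ht _ hz).congr_of_eventuallyEq heq).differentiableAt (by norm_num))]
  · rw [Metric.positionDeriv, heq.fderiv_eq, LinearMap.ker_eq_bot'.2 fun w hw => hinj t ht _ hz w hw,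
      finrank_bot]
  · filter_upwards [prod_mem_nhds (isOpen_Ioo.mem_nhds ht) (hbox.isOpen.mem_nhds hz)] with q hq
    exact ⟨hbox.mem_domain hq.1 hq.2, hbox.nonneg.trans_lt hq.1.1,
      hbox.mem_source hX.unit hq.1 hq.2⟩

end Index

end Finsler
end

noncomputable section

namespace Finsler

open Module

/-! ### Conjugate times as counted points, and the theorem. -/

section Multiplicity

variable {n : ℕ} {M : Type*} [TopologicalSpace M]
  [ChartedSpace (EuclideanHalfSpace (n + 1)) M] [IsManifold (𝓡∂ (n + 1)) ∞ M]
  {N : Type*} [TopologicalSpace N] [ChartedSpace (EuclideanSpace ℝ (Fin n)) N]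

open Classical in
/-- The multiplicity of `(t, z)` as a conjugate point, which is zero for the other points. -/
def Metric.multiplicity (φ : Metric n M) (ι : N → M) (X : ∀ z : N, TangentSpace (𝓡∂ (n + 1)) (ι z))
    (z : N) (t : ℝ) : ℕ :=
  if φ.IsConjugate ι X (t, z) then φ.order ι X (t, z) else 0

variable {φ : Metric n M} {ι : N → M} {X : ∀ z : N, TangentSpace (𝓡∂ (n + 1)) (ι z)} {g : N → ℝ}

lemma multiplicity_ne_zero_iff {z : N} {t : ℝ} :
    φ.multiplicity ι X z t ≠ 0 ↔ φ.IsConjugate ι X (t, z) := by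
  rw [Metric.multiplicity]
  split_ifs with h
  · exact ⟨fun _ => h, fun _ => h.2.2.ne'⟩
  · simp [h]

lemma multiplicity_eq_order {z : N} {t : ℝ} (hd : (t, z) ∈ φ.domain ι X) (ht : 0 < t) :
    φ.multiplicity ι X z t = φ.order ι X (t, z) := by
  rw [Metric.multiplicity]
  split_ifs with h
  · rfl
  · by_contra h0
    exact h ⟨hd, ht, Nat.pos_of_ne_zero (Ne.symm h0)⟩

lemma conjugateCount_eq (z : N) (A : Set ℝ) :
    φ.conjugateCount ι X z A = weightedCard (φ.multiplicity ι X z) A := by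
  rw [Metric.conjugateCount, weightedCard]
  congr 1
  ext q
  simp only [mem_ofPred_eq, Metric.multiplicity]
  split_ifs with h <;> simp [h]

lemma isJthConjugate_iff {j : ℕ} {z : N} {t : ℝ} :
    φ.IsJthConjugate ι X j z t ↔ IsJthPoint (φ.multiplicity ι X z) j t := by
  rw [Metric.IsJthConjugate, IsJthPoint, conjugateCount_eq, conjugateCount_eq,
    ← multiplicity_ne_zero_iff, pos_iff_ne_zero]

/-- A `j`-th conjugate time is unique, so the infimum is over a single value. -/
lemma conjugateTime_eq {j : ℕ} {z : N} {t : ℝ} (h : φ.IsJthConjugate ι X j z t) :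
    φ.conjugateTime ι X j z = ENNReal.ofReal t := by
  have hset : {t | φ.IsJthConjugate ι X j z t} = {t} := by
    ext s
    refine ⟨fun hs => ?_, fun hs => hs ▸ h⟩
    have h1 := isJthConjugate_iff.1 h
    have h2 := isJthConjugate_iff.1 (show φ.IsJthConjugate ι X j z s from hs)
    exact le_antisymm (h2.le h1.2.2) (h1.le h2.2.2)
  rw [Metric.conjugateTime, hset, image_singleton, sInf_singleton]

lemma conjugateTime_eq_top_iff {j : ℕ} {z : N} :
    φ.conjugateTime ι X j z = ⊤ ↔ ∀ t, ¬ φ.IsJthConjugate ι X j z t := by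
  refine ⟨fun h t ht => ENNReal.ofReal_ne_top ((conjugateTime_eq ht).symm.trans h), fun h => ?_⟩
  have hset : {t | φ.IsJthConjugate ι X j z t} = ∅ := eq_empty_of_forall_notMem h
  rw [Metric.conjugateTime, hset, image_empty, sInf_empty]

/-- The conjugate points form an indexed family. -/
theorem isIndexedFamily_multiplicity [T2Space M] [IsManifold (𝓡 n) ∞ N]
    (hι : IsBoundary (n := n) ι) (hg : ContMDiff (𝓡 n) 𝓘(ℝ, ℝ) ∞ g)
    (hX : φ.IsCharacteristicField ι g X) :
    IsIndexedFamily (φ.domain ι X) (φ.multiplicity ι X) fun z₀ z => extChartAt (𝓡 n) z₀ z where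
  continuousAt z₀ := continuousAt_extChartAt z₀
  mem_of_le := by
    rintro z s t ⟨-, T, hT, γ, hγ⟩ hs hst
    exact ⟨hs, T, hst.trans_lt hT, γ, hγ⟩
  mem_of_ne_zero z t h := by
    have h1 := multiplicity_ne_zero_iff.1 h
    exact ⟨h1.2.1, h1.1⟩
  start z₀ := by
    obtain ⟨δ, hδ, h⟩ := exists_order_eq_zero hι hg hX z₀
    refine ⟨δ, hδ, h.mono fun z hz t ht => ?_⟩
    by_contra h0
    exact (multiplicity_ne_zero_iff.1 h0).2.2.ne' (hz t ht)
  index t₀ z₀ ht hd := by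
    have h := isVariationAt_of_mem_domain hι hg hX hd ht
      (mem_chart_source (EuclideanHalfSpace (n + 1)) (φ.expMap ι X (t₀, z₀)))
    obtain ⟨s, hs, κ, hκ, m, hm⟩ := h.exists_isIndexFor hX.unit hg
    refine ⟨s, hs, κ, hκ, _, m, hm, ?_⟩
    filter_upwards [h.eventually_order_eq hX.unit] with x hx
    rw [← hx.2]
    exact multiplicity_eq_order hx.1.1 hx.1.2

end Multiplicity

end Finsler

end

theorem mainTheorem7 {n : ℕ} {M : Type*} [TopologicalSpace M] [T2Space M]
    [ChartedSpace (EuclideanHalfSpace (n + 1)) M] [IsManifold (𝓡∂ (n + 1)) ∞ M]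
    {N : Type*} [TopologicalSpace N] [ChartedSpace (EuclideanSpace ℝ (Fin n)) N]
    [IsManifold (𝓡 n) ∞ N]
    (φ : Finsler.Metric n M) (ι : N → M) (hι : Finsler.IsBoundary (n := n) ι)
    (g : N → ℝ) (hg : ContMDiff (𝓡 n) 𝓘(ℝ, ℝ) ∞ g)
    (X : ∀ z : N, TangentSpace (𝓡∂ (n + 1)) (ι z)) (hX : φ.IsCharacteristicField ι g X) :
    (∀ j : ℕ, 1 ≤ j →
      -- the set where `λ_j` is finite is open, and `λ_j` is locally Lipschitz there
      (∀ z₀ : N, φ.conjugateTime ι X j z₀ ≠ ⊤ →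
        ∃ U ∈ 𝓝 z₀, ∃ C : ℝ, (∀ z ∈ U, φ.conjugateTime ι X j z ≠ ⊤) ∧
          ∀ z ∈ U, ∀ z' ∈ U,
            |(φ.conjugateTime ι X j z).toReal - (φ.conjugateTime ι X j z').toReal| ≤
              C * ‖extChartAt (𝓡 n) z₀ z - extChartAt (𝓡 n) z₀ z'‖) ∧
      -- where `λ_j` is infinite, no `j`-th conjugate point appears nearby in bounded time
      (∀ z₀ : N, φ.conjugateTime ι X j z₀ = ⊤ → ∀ t : ℝ, (t, z₀) ∈ φ.domain ι X →
        ∀ᶠ z in 𝓝 z₀, ENNReal.ofReal t < φ.conjugateTime ι X j z)) ∧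
    -- the conjugate points near a given one lie in a cone transverse to the radial direction
    (∀ x₀ : ℝ × N, φ.IsConjugate ι X x₀ →
      ∃ C : ℝ, ∀ᶠ x in 𝓝 x₀, φ.IsConjugate ι X x →
        |x.1 - x₀.1| ≤ C * ‖extChartAt (𝓡 n) x₀.2 x.2 - extChartAt (𝓡 n) x₀.2 x₀.2‖) := by
  have hF := Finsler.isIndexedFamily_multiplicity hι hg hX
  have htop : ∀ {j z}, φ.conjugateTime ι X j z ≠ ⊤ ↔
      ∃ t, IsJthPoint (φ.multiplicity ι X z) j t := fun {j z} => by
    rw [Ne, Finsler.conjugateTime_eq_top_iff]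
    simp only [not_forall, not_not, Finsler.isJthConjugate_iff]
  have hval : ∀ {j z t}, IsJthPoint (φ.multiplicity ι X z) j t →
      φ.conjugateTime ι X j z = ENNReal.ofReal t ∧ 0 < t := fun {j z t} h =>
    have h' := Finsler.isJthConjugate_iff.2 h
    ⟨Finsler.conjugateTime_eq h', h'.1.2.1⟩
  refine ⟨fun j hj => ⟨fun z₀ h₀ => ?_, fun z₀ h₀ t ht => ?_⟩, fun x₀ h₀ => ?_⟩
  · obtain ⟨t₀, ht₀⟩ := htop.1 h₀
    obtain ⟨V, hV, κ, hex, hlip⟩ := hF.exists_lipschitz_isJthPoint hj ht₀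
    refine ⟨V, hV, κ, fun z hz => htop.2 (hex z hz), fun z hz z' hz' => ?_⟩
    obtain ⟨t, ht⟩ := hex z hz
    obtain ⟨t', ht'⟩ := hex z' hz'
    rw [(hval ht).1, (hval ht').1, ENNReal.toReal_ofReal (hval ht).2.le,
      ENNReal.toReal_ofReal (hval ht').2.le]
    exact hlip z hz z' hz' t t' ht ht'
  · have hnone : ∀ s, ¬ IsJthPoint (φ.multiplicity ι X z₀) j s := fun s hs =>
      htop.2 ⟨s, hs⟩ h₀
    filter_upwards [hF.lt_of_forall_not_isJthPoint hj hnone ht.1 ht] with z hz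
    by_cases hz' : φ.conjugateTime ι X j z = ⊤
    · rw [hz']
      exact ENNReal.ofReal_lt_top
    -- Conjugate times are positive, so the strict inequality of real times survives the passage to
    -- extended nonnegative reals.
    · obtain ⟨s, hs⟩ := htop.1 hz'
      rw [(hval hs).1]
      exact (ENNReal.ofReal_lt_ofReal_iff (hval hs).2).2 (hz s hs)
  · obtain ⟨κ, hκ⟩ := hF.eventually_cone (t₀ := x₀.1) (z₀ := x₀.2)
      (Finsler.multiplicity_ne_zero_iff.2 h₀)
    refine ⟨κ, ?_⟩
    filter_upwards [hκ] with x hx hc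
    exact hx (Finsler.multiplicity_ne_zero_iff.2 hc)
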